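/- **Setting.** Let $d\in\{2,3\}$ and let $\Omega\subset\mathbb{R}^d$ be a bounded Lipschitz domain (open, connected, nonempty, locally below the graph of a Lipschitz function) with boundary $\Gamma=\partial\Omega$ and exterior unit normal $n$. Let $H^1(\Omega)$ carry the norm $(\|\varphi\|_{L^2(\Omega)}^2+\|\nabla\varphi\|_{L^2(\Omega)}^2)^{1/2}$, let $\varphi|_\Gamma\in L^2(\Gamma)$ denote the trace of $\varphi\in H^1(\Omega)$, and let $H^{1/2}(\Gamma)=\{\varphi|_\Gamma:\varphi\in H^1(\Omega)\}$ with $\|f\|_{H^{1/2}(\Gamma)}=\inf\{\|\varphi\|_{H^1(\Omega)}:\varphi|_\Gamma=f\}$. Let $S\subset\Omega$ be a boundary layer, i.e. a Lipschitz domain with $\Gamma\subset\partial S$ together with a conforming triangulation $\mathcal{T}$ of $\overline S$ into finitely many nondegenerate closed simplices, and put $\Gamma^c=\partial S\setminus\Gamma$. Let $\mathcal{P}^q(\mathcal{T})$ be the piecewise polynomials of degree at most $q$; let $\mathcal{S}^p(\mathcal{T})$ be the functions in $C^0(\overline S)$ that are polynomials of degree at most $p$ on each $T\in\mathcal{T}$,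 and $\mathcal{S}^p_0(\mathcal{T})$ those vanishing on $\partial S$; let $\mathsf{RT}^q_{\Gamma^c}(\mathcal{T})$ be the fields $\sigma$ on $S$ that on each $T\in\mathcal{T}$ have the form $\sigma(x)=a(x)+b(x)\,x$ with $a\in(\mathcal{P}^q)^d$, $b\in\mathcal{P}^q$, whose normal component is continuous across the faces shared by two elements and satisfies $n\cdot\sigma=0$ on $\Gamma^c$. **Theorem.** Let $g\in H^{1/2}(\Gamma)$ and let $u\in H^1(\Omega)$ solve $\Delta u=0$ in $\Omega$ (in the sense of distributions), $u|_\Gamma=g$. Let $v\in H^1(\Omega)$ with $\Delta v=0$. Let $p\ge 1$ and $q\ge 0$ be integers, and let $J_h:H^{1/2}(\Gamma)\to\mathcal{S}^p(\mathcal{F}_h^\Gamma):=\{\varphi_h|_\Gamma:\varphi_h\in\mathcal{S}^p(\mathcal{T})\}$ be an arbitrary projection, i.e. any map into this space with $J_hf=f$ for all $f$ in it. Then: 1. There is a unique $w_h\in\mathcal{S}^p(\mathcal{T})$ with $w_h=J_h(g-v|_\Gamma)$ on $\Gamma$, $w_h=0$ on $\Gamma^c$ and $$(\nabla w_h,\nabla\varphi_h)_{L^2(S)}=0\quad\text{for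 all }\varphi_h\in\mathcal{S}^p_0(\mathcal{T}).$$ 2. There is a unique pair $(\tau_h,\omega_h)\in\mathsf{RT}^q_{\Gamma^c}(\mathcal{T})\times\mathcal{P}^q(\mathcal{T})$ with $$(\tau_h,\sigma_h)_{L^2(S)}+(\operatorname{div}\sigma_h,\omega_h)_{L^2(S)}=(g-v|_\Gamma,\,n\cdot\sigma_h)_{L^2(\Gamma)},\qquad(\operatorname{div}\tau_h,\psi_h)_{L^2(S)}=0$$ for all $(\sigma_h,\psi_h)\in\mathsf{RT}^q_{\Gamma^c}(\mathcal{T})\times\mathcal{P}^q(\mathcal{T})$. 3. These solutions satisfy $$2\,(g-v|_\Gamma,\,n\cdot\tau_h)_{L^2(\Gamma)}-\|\tau_h\|_{L^2(S)}^2\le\|\nabla(u-v)\|_{L^2(\Omega)}^2$$ and $$\|\nabla(u-v)\|_{L^2(\Omega)}\le\|\nabla w_h\|_{L^2(S)}+\|(1-J_h)(g-v|_\Gamma)\|_{H^{1/2}(\Gamma)}.$$ -/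

import Mathlib

open MeasureTheory Filter Topology Set
open scoped ContDiff ENNReal

noncomputable section

namespace BoundaryLayer

/-- The Euclidean space `ℝ^d`. -/
abbrev Euc (d : ℕ) : Type := EuclideanSpace ℝ (Fin d)

/-! ### Lipschitz domains and boundary layers -/

/-- A Lipschitz domain: nonempty, connected, open, and near each boundary point it is the part of
space below the graph of a Lipschitz function, in a rotated coordinate system with vertical unit
vector `e` (`y - ⟪e, y⟫ e` is the horizontal part of `y`). -/
structure IsLipschitzDomain {d : ℕ} (Ω : Set (Euc d)) : Prop where
  isOpen : IsOpen Ω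
  isConnected : IsConnected Ω
  locally_below_graph : ∀ x ∈ frontier Ω, ∃ (e : Euc d) (K : NNReal) (γ : Euc d → ℝ),
    ‖e‖ = 1 ∧ LipschitzWith K γ ∧
      ∀ᶠ y in 𝓝 x, y ∈ Ω ↔ inner ℝ e y < γ (y - inner ℝ e y • e)

/-- A conforming triangulation of `S`: finitely many nondegenerate closed `d`-simplices, given by
their vertex sets, which cover the closure of `S`, and any two of which intersect in the convex
hull of their common vertices. -/
structure Triangulation {d : ℕ} (S : Set (Euc d)) where
  elements : Finset (Finset (Euc d))
  card_eq : ∀ T ∈ elements, T.card = d + 1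
  affineIndependent : ∀ T ∈ elements, AffineIndependent ℝ ((↑) : T → Euc d)
  cover : ⋃ T ∈ elements, convexHull ℝ (T : Set (Euc d)) = closure S
  conforming : ∀ T ∈ elements, ∀ T' ∈ elements,
    convexHull ℝ (T : Set (Euc d)) ∩ convexHull ℝ (T' : Set (Euc d)) =
      convexHull ℝ ((T : Set (Euc d)) ∩ (T' : Set (Euc d)))

/-! ### The space `H¹(Ω)` -/

/-- Smooth functions with compact support in `Ω`. -/
def IsTestFunction {d : ℕ} (Ω : Set (Euc d)) (φ : Euc d → ℝ) : Prop :=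
  ContDiff ℝ ∞ φ ∧ HasCompactSupport φ ∧ tsupport φ ⊆ Ω

/-- `L²(Ω; F)`. -/
abbrev L2 {d : ℕ} (Ω : Set (Euc d)) (F : Type) [NormedAddCommGroup F] : Type :=
  Lp F 2 ((volume : Measure (Euc d)).restrict Ω)

/-- `G` is the weak gradient of `u` in `Ω`. -/
def IsWeakGradient {d : ℕ} (Ω : Set (Euc d)) (u : L2 Ω ℝ) (G : L2 Ω (Euc d)) : Prop :=
  ∀ φ : Euc d → ℝ, IsTestFunction Ω φ → ∀ i : Fin d,
    ∫ x in Ω, u x * fderiv ℝ φ x (EuclideanSpace.single i 1) = -∫ x in Ω, G x i * φ x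

lemma IsTestFunction.memLp {d : ℕ} {Ω : Set (Euc d)} {φ : Euc d → ℝ} (h : IsTestFunction Ω φ) :
    MemLp φ 2 ((volume : Measure (Euc d)).restrict Ω) :=
  (h.1.continuous.memLp_of_hasCompactSupport h.2.1).restrict Ω

lemma IsTestFunction.memLp_fderiv {d : ℕ} {Ω : Set (Euc d)} {φ : Euc d → ℝ}
    (h : IsTestFunction Ω φ) (e : Euc d) :
    MemLp (fun x => fderiv ℝ φ x e) 2 ((volume : Measure (Euc d)).restrict Ω) := by
  refine (Continuous.memLp_of_hasCompactSupport ?_ ?_).restrict Ω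
  · exact (h.1.continuous_fderiv (by simp)).clm_apply continuous_const
  · exact h.2.1.fderiv_apply ℝ e

lemma memLp_coord {d : ℕ} {Ω : Set (Euc d)} (G : L2 Ω (Euc d)) (i : Fin d) :
    MemLp (fun x => G x i) 2 ((volume : Measure (Euc d)).restrict Ω) :=
  (EuclideanSpace.proj (𝕜 := ℝ) i).comp_memLp' (Lp.memLp G)

/-- `H¹(Ω)`, realised as the space of pairs `(u, ∇u)` in `L²(Ω) × L²(Ω)^d` with the Hilbert norm
`(‖u‖² + ‖∇u‖²)^{1/2}`. -/
def H1 {d : ℕ} (Ω : Set (Euc d)) : Submodule ℝ (WithLp 2 (L2 Ω ℝ × L2 Ω (Euc d))) where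
  carrier := {z | IsWeakGradient Ω z.fst z.snd}
  zero_mem' := by
    intro φ hφ i
    have h1 : ((0 : L2 Ω ℝ) : Euc d → ℝ) =ᵐ[volume.restrict Ω] 0 := Lp.coeFn_zero _ _ _
    have h2 : ((0 : L2 Ω (Euc d)) : Euc d → Euc d) =ᵐ[volume.restrict Ω] 0 := Lp.coeFn_zero _ _ _
    have e1 : ∫ x in Ω, (0 : L2 Ω ℝ) x * fderiv ℝ φ x (EuclideanSpace.single i 1) = 0 := by
      apply integral_eq_zero_of_ae
      filter_upwards [h1] with x hx
      rw [hx]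
      simp
    have e2 : ∫ x in Ω, (0 : L2 Ω (Euc d)) x i * φ x = 0 := by
      apply integral_eq_zero_of_ae
      filter_upwards [h2] with x hx
      rw [hx]
      simp
    simp only [WithLp.zero_fst, WithLp.zero_snd]
    rw [e1, e2, neg_zero]
  add_mem' := by
    intro a b ha hb φ hφ i
    have e1 : ∫ x in Ω, (a.fst + b.fst : L2 Ω ℝ) x * fderiv ℝ φ x (EuclideanSpace.single i 1) =
        (∫ x in Ω, a.fst x * fderiv ℝ φ x (EuclideanSpace.single i 1)) +
          ∫ x in Ω, b.fst x * fderiv ℝ φ x (EuclideanSpace.single i 1) := by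
      have ia : Integrable (fun x => a.fst x * fderiv ℝ φ x (EuclideanSpace.single i 1))
          (volume.restrict Ω) := (Lp.memLp a.fst).integrable_mul (hφ.memLp_fderiv _)
      have ib : Integrable (fun x => b.fst x * fderiv ℝ φ x (EuclideanSpace.single i 1))
          (volume.restrict Ω) := (Lp.memLp b.fst).integrable_mul (hφ.memLp_fderiv _)
      rw [← integral_add ia ib]
      apply integral_congr_ae
      filter_upwards [Lp.coeFn_add a.fst b.fst] with x hx
      rw [hx]
      simp only [Pi.add_apply, add_mul]
    have e2 : ∫ x in Ω, (a.snd + b.snd : L2 Ω (Euc d)) x i * φ x =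
        (∫ x in Ω, a.snd x i * φ x) + ∫ x in Ω, b.snd x i * φ x := by
      have ia : Integrable (fun x => a.snd x i * φ x) (volume.restrict Ω) :=
        (memLp_coord a.snd i).integrable_mul hφ.memLp
      have ib : Integrable (fun x => b.snd x i * φ x) (volume.restrict Ω) :=
        (memLp_coord b.snd i).integrable_mul hφ.memLp
      rw [← integral_add ia ib]
      apply integral_congr_ae
      filter_upwards [Lp.coeFn_add a.snd b.snd] with x hx
      rw [hx]
      simp only [Pi.add_apply, PiLp.add_apply, add_mul]
    simp only [WithLp.add_fst, WithLp.add_snd]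
    rw [e1, e2, ha φ hφ i, hb φ hφ i]
    ring
  smul_mem' := by
    intro c a ha φ hφ i
    have e1 : ∫ x in Ω, (c • a.fst : L2 Ω ℝ) x * fderiv ℝ φ x (EuclideanSpace.single i 1) =
        c * ∫ x in Ω, a.fst x * fderiv ℝ φ x (EuclideanSpace.single i 1) := by
      rw [← integral_const_mul]
      apply integral_congr_ae
      filter_upwards [Lp.coeFn_smul c a.fst] with x hx
      simp [hx, mul_assoc]
    have e2 : ∫ x in Ω, (c • a.snd : L2 Ω (Euc d)) x i * φ x = c * ∫ x in Ω, a.snd x i * φ x := by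
      rw [← integral_const_mul]
      apply integral_congr_ae
      filter_upwards [Lp.coeFn_smul c a.snd] with x hx
      simp [hx, mul_assoc]
    simp only [WithLp.smul_fst, WithLp.smul_snd]
    rw [e1, e2, ha φ hφ i]
    ring

/-- The function underlying an element of `H¹(Ω)`. -/
def fn {d : ℕ} {Ω : Set (Euc d)} (u : H1 Ω) : L2 Ω ℝ := u.1.fst

/-- The weak gradient of an element of `H¹(Ω)`. -/
def weakGrad {d : ℕ} {Ω : Set (Euc d)} (u : H1 Ω) : L2 Ω (Euc d) := u.1.snd

/-- `Δ u = 0` in `Ω` in the sense of distributions. -/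
def IsHarmonic {d : ℕ} {Ω : Set (Euc d)} (u : H1 Ω) : Prop :=
  ∀ φ : Euc d → ℝ, IsTestFunction Ω φ → ∫ x in Ω, inner ℝ (weakGrad u x) (gradient φ x) = 0

/-! ### Traces and the space `H^{1/2}(Γ)`, `Γ = ∂Ω` -/

/-- The surface measure on `∂Ω`: the `(d-1)`-dimensional Hausdorff measure, normalised so that it
is Lebesgue measure on hyperplanes. -/
def surf {d : ℕ} (Ω : Set (Euc d)) : Measure (Euc d) :=
  (Measure.euclideanHausdorffMeasure (d - 1)).restrict (frontier Ω)

/-- `L²(Γ)`. -/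
abbrev L2Bdry {d : ℕ} (Ω : Set (Euc d)) : Type := Lp ℝ 2 (surf Ω)

lemma gradient_add_smooth {d : ℕ} {φ ψ : Euc d → ℝ} (hφ : ContDiff ℝ ∞ φ) (hψ : ContDiff ℝ ∞ ψ)
    (x : Euc d) : gradient (φ + ψ) x = gradient φ x + gradient ψ x := by
  unfold gradient
  rw [fderiv_add (hφ.differentiable (by simp) x) (hψ.differentiable (by simp) x), map_add]

lemma gradient_smul_smooth {d : ℕ} {φ : Euc d → ℝ} (hφ : ContDiff ℝ ∞ φ) (c : ℝ)
    (x : Euc d) : gradient (c • φ) x = c • gradient φ x := by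
  unfold gradient
  rw [fderiv_const_smul (hφ.differentiable (by simp) x), map_smul]

/-- The graph of the restriction map `ψ|_Ω ↦ ψ|_Γ` for `ψ ∈ C^∞(ℝ^d)`. -/
def smoothTraceGraph {d : ℕ} (Ω : Set (Euc d)) : Submodule ℝ (H1 Ω × L2Bdry Ω) where
  carrier := {z | ∃ ψ : Euc d → ℝ, ContDiff ℝ ∞ ψ ∧
    fn z.1 =ᵐ[volume.restrict Ω] ψ ∧ weakGrad z.1 =ᵐ[volume.restrict Ω] gradient ψ ∧
    z.2 =ᵐ[surf Ω] ψ}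
  zero_mem' := by
    refine ⟨0, contDiff_const, Lp.coeFn_zero _ _ _, ?_, Lp.coeFn_zero _ _ _⟩
    refine (Lp.coeFn_zero _ _ _).trans (Eventually.of_forall fun x => ?_)
    simp [gradient]
  add_mem' := by
    rintro a b ⟨ψ, h1, h2, h3, h4⟩ ⟨χ, k1, k2, k3, k4⟩
    refine ⟨ψ + χ, h1.add k1, (Lp.coeFn_add (fn a.1) (fn b.1)).trans (h2.add k2), ?_,
      (Lp.coeFn_add a.2 b.2).trans (h4.add k4)⟩
    refine (Lp.coeFn_add (weakGrad a.1) (weakGrad b.1)).trans ((h3.add k3).trans ?_)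
    exact Eventually.of_forall fun x => (gradient_add_smooth h1 k1 x).symm
  smul_mem' := by
    rintro c a ⟨ψ, h1, h2, h3, h4⟩
    refine ⟨c • ψ, h1.const_smul c, (Lp.coeFn_smul c (fn a.1)).trans (h2.const_smul c), ?_,
      (Lp.coeFn_smul c a.2).trans (h4.const_smul c)⟩
    refine (Lp.coeFn_smul c (weakGrad a.1)).trans ((h3.const_smul c).trans ?_)
    exact Eventually.of_forall fun x => (gradient_smul_smooth h1 c x).symm

/-- The graph of the trace operator `H¹(Ω) → L²(Γ)`, which is the continuous extension of the
restriction map: `(φ, f)` belongs to it if some smooth `ψ_n` satisfy `ψ_n → φ` in `H¹(Ω)` and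
`ψ_n|_Γ → f` in `L²(Γ)`. -/
def traceGraph {d : ℕ} (Ω : Set (Euc d)) : Submodule ℝ (H1 Ω × L2Bdry Ω) :=
  (smoothTraceGraph Ω).topologicalClosure

/-- `H^{1/2}(Γ)`, the space of traces of `H¹(Ω)`-functions. -/
def HHalf {d : ℕ} (Ω : Set (Euc d)) : Submodule ℝ (L2Bdry Ω) :=
  (traceGraph Ω).map (LinearMap.snd ℝ (H1 Ω) (L2Bdry Ω))

open Classical in
/-- The trace `φ|_Γ` of `φ ∈ H¹(Ω)`. (On a bounded Lipschitz domain it exists and is unique.) -/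
def trace {d : ℕ} {Ω : Set (Euc d)} (φ : H1 Ω) : HHalf Ω :=
  if h : ∃ f : HHalf Ω, (φ, (f : L2Bdry Ω)) ∈ traceGraph Ω then h.choose else 0

/-- The quotient norm of `H^{1/2}(Γ)`. -/
def halfNorm {d : ℕ} {Ω : Set (Euc d)} (f : HHalf Ω) : ℝ :=
  sInf {r : ℝ | ∃ φ : H1 Ω, trace φ = f ∧ r = ‖φ‖}

/-! ### Finite element spaces

A piecewise polynomial object on a triangulation is given by one polynomial per element. -/

/-- Real polynomials in `d` variables. -/
abbrev Poly (d : ℕ) : Type := MvPolynomial (Fin d) ℝ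

/-- The value of a polynomial at a point. -/
def pval {d : ℕ} (P : Poly d) (x : Euc d) : ℝ := MvPolynomial.eval (fun i => x i) P

/-- The value of a polynomial vector field at a point. -/
def vval {d : ℕ} (σ : Fin d → Poly d) (x : Euc d) : Euc d := WithLp.toLp 2 fun i => pval (σ i) x

/-- The gradient of a polynomial. -/
def pgrad {d : ℕ} (P : Poly d) : Fin d → Poly d := fun i => MvPolynomial.pderiv i P

/-- The divergence of a polynomial vector field. -/
def pdiv {d : ℕ} (σ : Fin d → Poly d) : Poly d := ∑ i, MvPolynomial.pderiv i (σ i)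

/-- The exterior unit normal of the simplex with vertex set `T` on the face opposite to its
vertex `z`: the normalised component orthogonal to that face of `∑_{y ∈ T} (y - z)`, a vector which
points from `z` towards the face. -/
def outerNormal {d : ℕ} (T : Finset (Euc d)) (z : Euc d) : Euc d :=
  let F : Set (Euc d) := (T : Set (Euc d)) \ {z}
  let h : Euc d := (vectorSpan ℝ F)ᗮ.starProjection (∑ y ∈ T, (y - z))
  ‖h‖⁻¹ • h

/-- The closed face of the simplex with vertex set `T` opposite to its vertex `z`. -/
def face {d : ℕ} (T : Finset (Euc d)) (z : Euc d) : Set (Euc d) :=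
  convexHull ℝ ((T : Set (Euc d)) \ {z})

namespace Triangulation

variable {d : ℕ} {S : Set (Euc d)}

/-- Families of polynomials, one for each element. -/
abbrev PwPoly (𝒯 : Triangulation S) : Type := 𝒯.elements → Poly d

/-- Families of polynomial vector fields, one for each element. -/
abbrev PwVec (𝒯 : Triangulation S) : Type := 𝒯.elements → Fin d → Poly d

/-- The closed simplex belonging to an element. -/
def cell (𝒯 : Triangulation S) (T : 𝒯.elements) : Set (Euc d) :=
  convexHull ℝ ((T : Finset (Euc d)) : Set (Euc d))

/-- The scalar product of `L²(S)` for piecewise polynomials. -/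
def inner₁ (𝒯 : Triangulation S) (φ ψ : 𝒯.PwPoly) : ℝ :=
  ∑ T, ∫ x in 𝒯.cell T, pval (φ T) x * pval (ψ T) x

/-- The scalar product of `L²(S)^d` for piecewise polynomial vector fields. -/
def inner₂ (𝒯 : Triangulation S) (σ τ : 𝒯.PwVec) : ℝ :=
  ∑ T, ∫ x in 𝒯.cell T, inner ℝ (vval (σ T) x) (vval (τ T) x)

/-- The norm of `L²(S)^d` for piecewise polynomial vector fields. -/
def norm₂ (𝒯 : Triangulation S) (σ : 𝒯.PwVec) : ℝ := √(𝒯.inner₂ σ σ)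

/-- The piecewise gradient. -/
def grad (𝒯 : Triangulation S) (φ : 𝒯.PwPoly) : 𝒯.PwVec := fun T => pgrad (φ T)

/-- The piecewise divergence. -/
def div (𝒯 : Triangulation S) (σ : 𝒯.PwVec) : 𝒯.PwPoly := fun T => pdiv (σ T)

/-- `P^q(𝒯)`: piecewise polynomials of degree at most `q`. -/
def P (𝒯 : Triangulation S) (q : ℕ) : Set 𝒯.PwPoly := {φ | ∀ T, (φ T).totalDegree ≤ q}

/-- `S^p(𝒯)`: continuous piecewise polynomials of degree at most `p`, i.e. those whose pieces agree
where elements meet. -/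
def Lagrange (𝒯 : Triangulation S) (p : ℕ) : Set 𝒯.PwPoly :=
  {φ ∈ 𝒯.P p | ∀ T T', ∀ x ∈ 𝒯.cell T ∩ 𝒯.cell T', pval (φ T) x = pval (φ T') x}

/-- `φ = 0` on the set `A`. -/
def VanishesOn (𝒯 : Triangulation S) (φ : 𝒯.PwPoly) (A : Set (Euc d)) : Prop :=
  ∀ T, ∀ x ∈ 𝒯.cell T ∩ A, pval (φ T) x = 0

/-- `S^p_0(𝒯)`: elements of `S^p(𝒯)` which vanish on `∂S`. -/
def Lagrange₀ (𝒯 : Triangulation S) (p : ℕ) : Set 𝒯.PwPoly :=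
  {φ ∈ 𝒯.Lagrange p | 𝒯.VanishesOn φ (frontier S)}

/-- `φ|_Γ = f` in `L²(Γ)`, where `Γ = ∂Ω`. -/
def RestrictsTo (𝒯 : Triangulation S) {Ω : Set (Euc d)} (φ : 𝒯.PwPoly) (f : L2Bdry Ω) : Prop :=
  ∀ᵐ x ∂(surf Ω), ∀ T, x ∈ 𝒯.cell T → f x = pval (φ T) x

/-- The space `{φ|_Γ : φ ∈ S^p(𝒯)}` of Lagrange boundary traces, `Γ = ∂Ω`. -/
def LagrangeTraces (𝒯 : Triangulation S) (Ω : Set (Euc d)) (p : ℕ) : Set (HHalf Ω) :=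
  {f | ∃ φ ∈ 𝒯.Lagrange p, 𝒯.RestrictsTo φ (f : L2Bdry Ω)}

/-- `RT^q(𝒯)`: on each element `σ(x) = a(x) + b(x) x` with polynomials `a`, `b` of degree at most
`q`, and the normal component does not jump across faces shared by two elements. -/
def RT (𝒯 : Triangulation S) (q : ℕ) : Set 𝒯.PwVec :=
  {σ | (∀ T, ∃ (a : Fin d → Poly d) (b : Poly d), (∀ i, (a i).totalDegree ≤ q) ∧
      b.totalDegree ≤ q ∧ ∀ i, σ T i = a i + b * MvPolynomial.X i) ∧
    ∀ T T' : 𝒯.elements, T ≠ T' → ∀ z ∈ (T : Finset (Euc d)), ∀ z' ∈ (T' : Finset (Euc d)),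
      ((T : Finset (Euc d)) : Set (Euc d)) \ {z} = ((T' : Finset (Euc d)) : Set (Euc d)) \ {z'} →
        ∀ x ∈ face (T : Finset (Euc d)) z,
          inner ℝ (outerNormal (T : Finset (Euc d)) z) (vval (σ T) x - vval (σ T') x) = 0}

/-- `RT^q_{Γᶜ}(𝒯)`: elements of `RT^q(𝒯)` whose normal component vanishes on `Γᶜ = ∂S \ ∂Ω`. -/
def RT₀ (𝒯 : Triangulation S) (Ω : Set (Euc d)) (q : ℕ) : Set 𝒯.PwVec :=
  {σ ∈ 𝒯.RT q | ∀ T : 𝒯.elements, ∀ z ∈ (T : Finset (Euc d)),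
    face (T : Finset (Euc d)) z ⊆ frontier S →
      ∀ x ∈ face (T : Finset (Euc d)) z ∩ (frontier S \ frontier Ω),
        inner ℝ (outerNormal (T : Finset (Euc d)) z) (vval (σ T) x) = 0}

open Classical in
/-- The normal component `n · σ` on `∂S`. The sum runs over the boundary faces containing `x`;
for almost every `x ∈ ∂S` there is exactly one. -/
def normalTrace (𝒯 : Triangulation S) (σ : 𝒯.PwVec) (x : Euc d) : ℝ :=
  ∑ T : 𝒯.elements, ∑ z ∈ (T : Finset (Euc d)),
    if face (T : Finset (Euc d)) z ⊆ frontier S ∧ x ∈ face (T : Finset (Euc d)) z then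
      inner ℝ (outerNormal (T : Finset (Euc d)) z) (vval (σ T) x)
    else 0

/-- The scalar product `(f, n · σ)` in `L²(Γ)`, `Γ = ∂Ω ⊆ ∂S`. -/
def bdryPairing (𝒯 : Triangulation S) {Ω : Set (Euc d)} (f : L2Bdry Ω) (σ : 𝒯.PwVec) : ℝ :=
  ∫ x, f x * 𝒯.normalTrace σ x ∂(surf Ω)

/-- `w ∈ S^p(𝒯)` is discrete harmonic in `S` with `w = f` on `Γ = ∂Ω` and `w = 0` on
`Γᶜ = ∂S \ Γ`. -/
structure IsDirichletSolution (𝒯 : Triangulation S) {Ω : Set (Euc d)} (p : ℕ) (f : L2Bdry Ω)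
    (w : 𝒯.PwPoly) : Prop where
  mem : w ∈ 𝒯.Lagrange p
  eq_on : 𝒯.RestrictsTo w f
  zero_on : 𝒯.VanishesOn w (frontier S \ frontier Ω)
  galerkin : ∀ φ ∈ 𝒯.Lagrange₀ p, 𝒯.inner₂ (𝒯.grad w) (𝒯.grad φ) = 0

/-- `(τ, ρ) ∈ RT^q_{Γᶜ}(𝒯) × P^q(𝒯)` solves the mixed problem with data `f` on `Γ = ∂Ω`. -/
structure IsMixedSolution (𝒯 : Triangulation S) {Ω : Set (Euc d)} (q : ℕ) (f : L2Bdry Ω)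
    (τ : 𝒯.PwVec) (ρ : 𝒯.PwPoly) : Prop where
  mem_RT : τ ∈ 𝒯.RT₀ Ω q
  mem_P : ρ ∈ 𝒯.P q
  flux : ∀ σ ∈ 𝒯.RT₀ Ω q, 𝒯.inner₂ τ σ + 𝒯.inner₁ (𝒯.div σ) ρ = 𝒯.bdryPairing f σ
  div_free : ∀ ψ ∈ 𝒯.P q, 𝒯.inner₁ (𝒯.div τ) ψ = 0

end Triangulation

end BoundaryLayer

end

open MeasureTheory Filter Topology Set
open scoped ContDiff ENNReal

noncomputable section

namespace BoundaryLayer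

/-! Put e = u - v and f = g - v|_Γ. Then e is harmonic with trace f, and the two estimates are the
two sides of the duality for its Dirichlet energy.

Lower bound. Since div RT^q ⊆ P^q, the second mixed equation makes τ_h exactly divergence-free
(`IsMixedSolution.div_eq_zero`). Its normal component does not jump and vanishes on Γᶜ, so Green's
formula gives (f, n·τ_h)_Γ = (∇e, τ_h) for the zero extension of τ_h (`bdryPairing_eq`). Expanding 0
≤ ‖∇e - τ_h‖² yields `lower_bound`.

Upper bound. As w_h vanishes on Γᶜ, its zero extension W belongs to H¹(Ω) (`exists_zero_extension`).
If φ has trace (1 - J_h)f, then e - φ - W has zero trace, so its gradient is orthogonal to that of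
the harmonic function e (`inner_weakGrad_eq_zero`). Hence ‖∇e‖² = (∇e, ∇φ + ∇W) ≤ ‖∇e‖ (‖φ‖ + ‖∇W‖),
and `upper_bound` takes the infimum over φ.

Solvability. Both problems are square and finite-dimensional, so injectivity suffices
(`exists_forall_form_eq`). For the Dirichlet problem the data must first be extended so as to vanish
on Γᶜ; `lift` does this. It works because S and Ω coincide near Γ (`eventually_mem_iff`), which
makes Γ and Γᶜ disjoint closed sets: a connected piece of ∂S lies in one of them. For the mixed
problem the divergence must be onto P^q (`eq_zero_of_orthogonal_div`): bubble fields force an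
orthogonal ρ to be constant on each element, fields on two neighbouring elements equate these
constants, `strongly_connected` spreads the equality, and one field with flux through Γ makes the
constant zero.

Analysis. Traces are defined by closing the graph of restriction, so their existence and uniqueness
and Green's formulas have to be derived. Almost all of Γ is covered by faces of elements
(`ae_exists_face`), so everything rests on the divergence theorem on a simplex
(`integral_divergence`), obtained by integrating along rays from a vertex. Applied to ψ²(x - z) it
gives the trace inequality (`exists_trace_bound`). Density of smooth functions (`dense_smooth`) and
the orthogonality above (`integral_eq_zero_of_zero_extension`) are proved by duality, with
mollifiers shifted out of or into Ω, so that weak convergence of the mollifications is enough. -/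

variable {d : ℕ}

/-! ### Simplices in barycentric coordinates. -/

/-- The vertex set of a nondegenerate `d`-simplex. -/
structure IsSimplex (T : Finset (Euc d)) : Prop where
  card_eq : T.card = d + 1
  affineIndependent : AffineIndependent ℝ ((↑) : T → Euc d)

/-- The vertices of a simplex as an affine basis. -/
def IsSimplex.basis {T : Finset (Euc d)} (hT : IsSimplex T) : AffineBasis T ℝ (Euc d) :=
  ⟨(↑), hT.affineIndependent, by
    rw [hT.affineIndependent.affineSpan_eq_top_iff_card_eq_finrank_add_one]
    simp [hT.card_eq]⟩

lemma IsSimplex.coe_basis {T : Finset (Euc d)} (hT : IsSimplex T) (z : T) :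
    hT.basis z = (z : Euc d) := rfl

open Classical in
/-- The barycentric coordinate of the simplex `T` belonging to its vertex `z`. -/
def bary (T : Finset (Euc d)) (z : Euc d) : Euc d →ᵃ[ℝ] ℝ :=
  if h : IsSimplex T ∧ z ∈ T then h.1.basis.coord ⟨z, h.2⟩ else AffineMap.const ℝ _ 0

/-- The gradient of the barycentric coordinate `bary T z`. -/
def bgrad (T : Finset (Euc d)) (z : Euc d) : Euc d :=
  (InnerProductSpace.toDual ℝ (Euc d)).symm (LinearMap.toContinuousLinearMap (bary T z).linear)

lemma inner_bgrad (T : Finset (Euc d)) (z v : Euc d) :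
    inner ℝ (bgrad T z) v = (bary T z).linear v := by
  simp [bgrad]

lemma inner_bgrad_sub (T : Finset (Euc d)) (z x y : Euc d) :
    inner ℝ (bgrad T z) (x - y) = bary T z x - bary T z y := by
  rw [inner_bgrad]
  simpa using (bary T z).linearMap_vsub x y

lemma bary_add (T : Finset (Euc d)) (z x v : Euc d) :
    bary T z (x + v) = bary T z x + inner ℝ (bgrad T z) v := by
  have := inner_bgrad_sub T z (x + v) x
  rw [add_sub_cancel_left] at this
  linarith

lemma continuous_bary (T : Finset (Euc d)) (z : Euc d) : Continuous (bary T z) := by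
  have : (bary T z : Euc d → ℝ) = fun x => bary T z 0 + inner ℝ (bgrad T z) x := by
    ext x
    simpa using bary_add T z 0 x
  rw [this]
  fun_prop

lemma bary_lineMap (T : Finset (Euc d)) (z x y : Euc d) (t : ℝ) :
    bary T z (x + t • (y - x)) = bary T z x + t * (bary T z y - bary T z x) := by
  rw [bary_add, inner_smul_right, inner_bgrad_sub]

namespace IsSimplex

variable {T : Finset (Euc d)} (hT : IsSimplex T)
include hT

lemma bary_eq {z : Euc d} (hz : z ∈ T) (x : Euc d) :
    bary T z x = hT.basis.coord ⟨z, hz⟩ x := by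
  simp [bary, hT, hz]

lemma bary_self {z : Euc d} (hz : z ∈ T) : bary T z z = 1 := by
  rw [hT.bary_eq hz]
  exact hT.basis.coord_apply_eq ⟨z, hz⟩

lemma bary_ne {z y : Euc d} (hz : z ∈ T) (hy : y ∈ T) (h : z ≠ y) : bary T z y = 0 := by
  rw [hT.bary_eq hz]
  exact hT.basis.coord_apply_ne (i := ⟨z, hz⟩) (j := ⟨y, hy⟩) (by simpa using h)

lemma sum_bary (x : Euc d) : ∑ z ∈ T, bary T z x = 1 := by
  rw [← hT.basis.sum_coord_apply_eq_one x, ← Finset.sum_coe_sort]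
  exact Finset.sum_congr rfl fun z _ => hT.bary_eq z.2 x

lemma sum_bary_smul (x : Euc d) : ∑ z ∈ T, bary T z x • z = x := by
  conv_rhs => rw [← hT.basis.linear_combination_coord_eq_self x]
  rw [← Finset.sum_coe_sort]
  exact Finset.sum_congr rfl fun z _ => by rw [hT.bary_eq z.2 x, hT.coe_basis]

lemma sum_bgrad_inner (v : Euc d) : ∑ z ∈ T, inner ℝ (bgrad T z) v = 0 := by
  have h1 := hT.sum_bary (0 + v)
  have h2 := hT.sum_bary 0
  simp only [bary_add, Finset.sum_add_distrib] at h1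
  linarith

/-- The derivative in direction v of the identity ∑ λ_z(x) z = x. With `sum_bgrad_inner`, the
derivative of ∑ λ_z = 1, it expands v along the differences of the vertices from any base point. -/
lemma sum_bgrad_smul (v : Euc d) : ∑ z ∈ T, inner ℝ (bgrad T z) v • z = v := by
  have h1 := hT.sum_bary_smul (0 + v)
  have h2 := hT.sum_bary_smul 0
  simp only [bary_add, add_smul, Finset.sum_add_distrib] at h1
  rw [h2, zero_add] at h1
  simpa using h1

lemma range_basis : range hT.basis = (T : Set (Euc d)) := by
  ext x
  constructor
  · rintro ⟨z, rfl⟩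
    exact z.2
  · intro hx
    exact ⟨⟨x, hx⟩, rfl⟩

lemma mem_hull_iff {x : Euc d} :
    x ∈ convexHull ℝ (T : Set (Euc d)) ↔ ∀ z ∈ T, 0 ≤ bary T z x := by
  rw [← hT.range_basis, hT.basis.convexHull_eq_nonneg_coord]
  simp only [mem_ofPred_eq, Subtype.forall]
  exact forall₂_congr fun z hz => by rw [hT.bary_eq hz]

lemma mem_interior_hull_iff {x : Euc d} :
    x ∈ interior (convexHull ℝ (T : Set (Euc d))) ↔ ∀ z ∈ T, 0 < bary T z x := by
  rw [← hT.range_basis, hT.basis.interior_convexHull]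
  simp only [mem_ofPred_eq, Subtype.forall]
  exact forall₂_congr fun z hz => by rw [hT.bary_eq hz]

/-- The zero set of a coordinate is convex and contains the vertices other than its own, which gives
one direction; for the other, dropping the vanishing terms of ∑ λ_z(x) z leaves a convex combination
of points of A. -/
lemma mem_subhull_iff {A : Set (Euc d)} (hA : A ⊆ T) {x : Euc d} :
    x ∈ convexHull ℝ A ↔ (∀ z ∈ T, 0 ≤ bary T z x) ∧ ∀ z ∈ T, z ∉ A → bary T z x = 0 := by
  classical
  constructor
  · intro hx
    refine ⟨hT.mem_hull_iff.1 (convexHull_mono hA hx), fun z hz hzA => ?_⟩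
    have hc : Convex ℝ {y | bary T z y = 0} := by
      have : {y | bary T z y = 0} = (bary T z) ⁻¹' {0} := rfl
      rw [this]
      exact (convex_singleton (0 : ℝ)).affine_preimage (bary T z)
    have hs : A ⊆ {y | bary T z y = 0} := fun y hy =>
      hT.bary_ne hz (hA hy) (fun h => hzA (h ▸ hy))
    exact convexHull_min hs hc hx
  · rintro ⟨h0, h1⟩
    have hx := hT.sum_bary_smul x
    have hs := hT.sum_bary x
    have e1 : ∑ z ∈ T.filter (· ∈ A), bary T z x = 1 := by
      rw [← hs]
      refine Finset.sum_subset (Finset.filter_subset _ _) fun z hz hz' => ?_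
      exact h1 z hz fun h => hz' (Finset.mem_filter.2 ⟨hz, h⟩)
    have e2 : ∑ z ∈ T.filter (· ∈ A), bary T z x • z = x := by
      conv_rhs => rw [← hx]
      refine Finset.sum_subset (Finset.filter_subset _ _) fun z hz hz' => ?_
      rw [h1 z hz fun h => hz' (Finset.mem_filter.2 ⟨hz, h⟩), zero_smul]
    rw [← e2]
    refine (convex_convexHull ℝ A).sum_mem (fun z hz => h0 z (Finset.mem_filter.1 hz).1) e1
      fun z hz => subset_convexHull ℝ A (Finset.mem_filter.1 hz).2

lemma mem_face_iff {z : Euc d} (hz : z ∈ T) {x : Euc d} :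
    x ∈ face T z ↔ x ∈ convexHull ℝ (T : Set (Euc d)) ∧ bary T z x = 0 := by
  rw [face, hT.mem_subhull_iff sdiff_subset, hT.mem_hull_iff]
  refine and_congr_right fun _ => ⟨fun h => h z hz (by simp), fun h y hy hyA => ?_⟩
  have : y = z := by
    by_contra hne
    exact hyA ⟨hy, hne⟩
  rw [this, h]

omit hT in
lemma face_subset (z : Euc d) : face T z ⊆ convexHull ℝ (T : Set (Euc d)) :=
  convexHull_mono sdiff_subset

lemma exists_ne (hd : 1 ≤ d) (z : Euc d) : ∃ y ∈ T, y ≠ z := by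
  have : 1 < T.card := by rw [hT.card_eq]; omega
  exact Finset.exists_mem_ne this z

lemma nonempty : T.Nonempty := by
  rw [← Finset.card_pos, hT.card_eq]
  omega

lemma bgrad_ne_zero (hd : 1 ≤ d) {z : Euc d} (hz : z ∈ T) : bgrad T z ≠ 0 := by
  obtain ⟨y, hy, hyz⟩ := hT.exists_ne hd z
  intro h
  have := inner_bgrad_sub T z z y
  rw [h, hT.bary_self hz, hT.bary_ne hz hy hyz.symm] at this
  simp at this

lemma norm_bgrad_pos (hd : 1 ≤ d) {z : Euc d} (hz : z ∈ T) : 0 < ‖bgrad T z‖ :=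
  norm_pos_iff.2 (hT.bgrad_ne_zero hd hz)

/-- Expand v = ∑ (∇λ_a · v)(a - y) with base point a vertex y ≠ z: the hypothesis removes the only
term that involves z. -/
lemma mem_vectorSpan_of_inner_bgrad {z : Euc d} (hd : 1 ≤ d) {v : Euc d}
    (h : inner ℝ (bgrad T z) v = 0) : v ∈ vectorSpan ℝ ((T : Set (Euc d)) \ {z}) := by
  classical
  obtain ⟨y, hy, hyz⟩ := hT.exists_ne hd z
  have e : v = ∑ a ∈ T, inner ℝ (bgrad T a) v • (a - y) := by
    simp only [smul_sub, Finset.sum_sub_distrib, hT.sum_bgrad_smul, ← Finset.sum_smul,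
      hT.sum_bgrad_inner, zero_smul, sub_zero]
  rw [e]
  refine Submodule.sum_mem _ fun a ha => ?_
  by_cases haz : a = z
  · rw [haz, h, zero_smul]
    exact Submodule.zero_mem _
  · exact Submodule.smul_mem _ _ (vsub_mem_vectorSpan ℝ ⟨ha, haz⟩ ⟨hy, hyz⟩)

/-- The gradient g of λ_z is orthogonal to the face, and a vector orthogonal to g lies in the span
of the face. So the projection of ∑ (y - z) is the multiple of g with the same product with g,
namely -d: each of the d vertices y ≠ z contributes -1. This turns all later statements on normals
into statements on barycentric coordinates. -/
lemma outerNormal_eq (hd : 1 ≤ d) {z : Euc d} (hz : z ∈ T) :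
    outerNormal T z = -(‖bgrad T z‖⁻¹ • bgrad T z) := by
  have hg := hT.norm_bgrad_pos hd hz
  set F : Set (Euc d) := (T : Set (Euc d)) \ {z}
  set g := bgrad T z
  have hgF : g ∈ (vectorSpan ℝ F)ᗮ := by
    rw [Submodule.mem_orthogonal]
    intro v hv
    rw [vectorSpan_def] at hv
    induction hv using Submodule.span_induction with
    | mem x hx =>
      obtain ⟨a, ha, b, hb, rfl⟩ := hx
      rw [real_inner_comm]
      simp only [vsub_eq_sub]
      rw [inner_bgrad_sub, hT.bary_ne hz ha.1 (fun h => ha.2 h.symm),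
        hT.bary_ne hz hb.1 (fun h => hb.2 h.symm), sub_zero]
    | zero => simp
    | add x y _ _ hx hy => rw [inner_add_left, hx, hy, add_zero]
    | smul c x _ hx => rw [inner_smul_left, hx, mul_zero]
  set u : Euc d := ∑ y ∈ T, (y - z)
  have hu : inner ℝ g u = -(d : ℝ) := by
    rw [inner_sum]
    have : ∀ y ∈ T, inner ℝ g (y - z) = (if y = z then (1 : ℝ) else 0) - 1 := by
      intro y hy
      rw [inner_bgrad_sub, hT.bary_self hz]
      split_ifs with h
      · rw [h, hT.bary_self hz]
      · rw [hT.bary_ne hz hy (Ne.symm h)]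
    rw [Finset.sum_congr rfl this, Finset.sum_sub_distrib, Finset.sum_ite_eq' T z]
    simp [hz, hT.card_eq]
  have hproj : (vectorSpan ℝ F)ᗮ.starProjection u = (-(d : ℝ) / ‖g‖ ^ 2) • g := by
    refine Submodule.eq_starProjection_of_mem_orthogonal (Submodule.smul_mem _ _ hgF) ?_
    rw [Submodule.orthogonal_orthogonal]
    refine hT.mem_vectorSpan_of_inner_bgrad hd ?_
    change inner ℝ g _ = 0
    rw [inner_sub_right, hu, inner_smul_right, real_inner_self_eq_norm_sq]
    field_simp
    simp
  have hd' : (0 : ℝ) < d := by exact_mod_cast hd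
  show ‖(vectorSpan ℝ F)ᗮ.starProjection u‖⁻¹ • (vectorSpan ℝ F)ᗮ.starProjection u = _
  rw [hproj, norm_smul, smul_smul, ← neg_smul]
  congr 1
  rw [Real.norm_eq_abs, abs_div, abs_neg, abs_of_pos hd', abs_of_pos (pow_pos hg 2)]
  field_simp

lemma norm_outerNormal (hd : 1 ≤ d) {z : Euc d} (hz : z ∈ T) : ‖outerNormal T z‖ = 1 := by
  have hg := hT.norm_bgrad_pos hd hz
  rw [hT.outerNormal_eq hd hz, norm_neg, norm_smul, norm_inv, norm_norm]
  field_simp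

lemma inner_outerNormal_sub (hd : 1 ≤ d) {z : Euc d} (hz : z ∈ T) (x y : Euc d) :
    inner ℝ (outerNormal T z) (x - y) = ‖bgrad T z‖⁻¹ * (bary T z y - bary T z x) := by
  rw [hT.outerNormal_eq hd hz, inner_neg_left, inner_smul_left, inner_bgrad_sub]
  simp
  ring

omit hT in
lemma isCompact_hull (T : Finset (Euc d)) : IsCompact (convexHull ℝ (T : Set (Euc d))) :=
  (Finset.finite_toSet T).isCompact_convexHull ℝ

omit hT in
lemma isCompact_face (T : Finset (Euc d)) (z : Euc d) : IsCompact (face T z) :=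
  ((Finset.finite_toSet T).subset sdiff_subset).isCompact_convexHull ℝ

end IsSimplex

/-! ### The divergence theorem on a simplex -/

/-- Orthogonal coordinates with first axis `n` and origin `z`. -/
lemma measurePreserving_normal_coords {n : Euc d} (hn : ‖n‖ = 1) (z : Euc d) :
    MeasurePreserving (fun q : ℝ × (Submodule.span ℝ {n})ᗮ => z + (q.1 • n + (q.2 : Euc d)))
      volume volume ∧
    MeasurableEmbedding
      (fun q : ℝ × (Submodule.span ℝ {n})ᗮ => z + (q.1 • n + (q.2 : Euc d))) := by
  set s := Submodule.span ℝ {n}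
  have h1 := (s.measurePreserving_measurableEquivProd z).symm
  rw [InnerProductSpace.euclideanHausdorffMeasure_eq_volume] at h1
  have h2 : MeasurePreserving (LinearIsometryEquiv.toSpanUnitSingleton (𝕜 := ℝ) n hn) :=
    (LinearIsometryEquiv.toSpanUnitSingleton (𝕜 := ℝ) n hn).measurePreserving
  have h3 := h2.prod (MeasurePreserving.id (volume : Measure sᗮ))
  have e : (fun q : ℝ × sᗮ => z + (q.1 • n + (q.2 : Euc d))) =
      (s.measurableEquivProd z).symm ∘
        Prod.map (LinearIsometryEquiv.toSpanUnitSingleton (𝕜 := ℝ) n hn) id := by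
    ext1 q
    simp only [Function.comp, Submodule.measurableEquivProd_symm_apply, Prod.map]
    simp [add_comm]
  rw [e]
  refine ⟨h1.comp h3, ?_⟩
  refine (s.measurableEquivProd z).symm.measurableEmbedding.comp ?_
  exact ((LinearIsometryEquiv.toSpanUnitSingleton (𝕜 := ℝ) n hn).toHomeomorph.prodCongr
    (Homeomorph.refl sᗮ)).measurableEmbedding

lemma finrank_orthogonal_unit {n : Euc d} (hn : ‖n‖ = 1) :
    Module.finrank ℝ (Submodule.span ℝ {n})ᗮ = d - 1 := by
  have h0 : n ≠ 0 := by
    rintro rfl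
    simp at hn
  have h := (Submodule.span ℝ {n}).finrank_add_finrank_orthogonal
  rw [finrank_span_singleton h0, finrank_euclideanSpace_fin] at h
  omega

/-- The hyperplane through `p` with unit normal `n`, parametrised isometrically. -/
lemma integral_hyperplane {n : Euc d} (hn : ‖n‖ = 1) (p : Euc d) (ψ : Euc d → ℝ) (A : Set (Euc d))
    (hA : A ⊆ range fun y : (Submodule.span ℝ {n})ᗮ => p + (y : Euc d)) :
    ∫ x in A, ψ x ∂(Measure.euclideanHausdorffMeasure (d - 1)) =
      ∫ y in (fun y : (Submodule.span ℝ {n})ᗮ => p + (y : Euc d)) ⁻¹' A, ψ (p + y) := by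
  set ι : (Submodule.span ℝ {n})ᗮ → Euc d := fun y => p + (y : Euc d)
  have hι : Isometry ι := (IsometryEquiv.addLeft p).isometry.comp isometry_subtype_coe
  have h := hι.map_euclideanHausdorffMeasure (d := d - 1)
  rw [← finrank_orthogonal_unit hn, InnerProductSpace.euclideanHausdorffMeasure_eq_volume] at h
  have hemb : MeasurableEmbedding ι := hι.isClosedEmbedding.measurableEmbedding
  have e := hemb.setIntegral_map (μ := volume) ψ A
  rw [h, Measure.restrict_restrict₀', inter_eq_self_of_subset_left hA,
    finrank_orthogonal_unit hn] at e
  · exact e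
  · exact hι.isClosedEmbedding.isClosed_range.measurableSet.nullMeasurableSet

namespace IsSimplex

variable {T : Finset (Euc d)}

/-- The height of the simplex `T` over its face opposite to `z`. -/
def height (T : Finset (Euc d)) (z : Euc d) : ℝ := ‖bgrad T z‖⁻¹

/-- The face of `T` opposite to `z`, in coordinates of its hyperplane. -/
def facePatch (T : Finset (Euc d)) (z : Euc d) :
    Set (Submodule.span ℝ {outerNormal T z})ᗮ :=
  (fun y => (z + height T z • outerNormal T z) + (y : Euc d)) ⁻¹' face T z

variable (hT : IsSimplex T)
include hT

lemma height_pos (hd : 1 ≤ d) {z : Euc d} (hz : z ∈ T) : 0 < height T z :=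
  inv_pos.2 (hT.norm_bgrad_pos hd hz)

/-- Here t = 0 is the apex z and t = 1 the plane of the opposite face; the vector y is tangential,
so only the normal part, of length `height T z` = 1/|∇λ_z|, changes the coordinate. -/
lemma bary_cone (hd : 1 ≤ d) {z : Euc d} (hz : z ∈ T) (t : ℝ)
    (y : (Submodule.span ℝ {outerNormal T z})ᗮ) :
    bary T z (z + t • (height T z • outerNormal T z + (y : Euc d))) = 1 - t := by
  have hg := hT.norm_bgrad_pos hd hz
  have hy : inner ℝ (outerNormal T z) (y : Euc d) = 0 :=
    Submodule.mem_orthogonal_singleton_iff_inner_right.1 y.2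
  have hb : bgrad T z = -(‖bgrad T z‖ • outerNormal T z) := by
    rw [hT.outerNormal_eq hd hz, smul_neg, neg_neg, smul_smul, mul_inv_cancel₀ hg.ne', one_smul]
  rw [bary_add, hT.bary_self hz, inner_smul_right, hb, inner_neg_left, inner_smul_left,
    inner_add_right, hy, inner_smul_right, real_inner_self_eq_norm_sq, hT.norm_outerNormal hd hz,
    height]
  simp
  field_simp
  ring

/-- The remaining coordinates vanish at the apex, hence are linear along rays issuing from it. -/
lemma bary_cone_ne {z a : Euc d} (hz : z ∈ T) (ha : a ∈ T) (haz : a ≠ z) (t : ℝ) (w : Euc d) :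
    bary T a (z + t • w) = t * bary T a (z + w) := by
  rw [bary_add, bary_add, hT.bary_ne ha hz haz, inner_smul_right]
  ring

/-- The simplex is the cone with apex z over the opposite face. Given the two coordinate formulas,
only t < 0 needs an argument: there λ_z = 1 - t would exceed the sum 1 of all the nonnegative
coordinates. -/
lemma cone_mem_hull_iff (hd : 1 ≤ d) {z : Euc d} (hz : z ∈ T) {t : ℝ} (ht : t ≠ 0)
    (y : (Submodule.span ℝ {outerNormal T z})ᗮ) :
    z + t • (height T z • outerNormal T z + (y : Euc d)) ∈ convexHull ℝ (T : Set (Euc d)) ↔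
      t ∈ Ioc (0 : ℝ) 1 ∧ y ∈ facePatch T z := by
  have h1 := hT.bary_cone hd hz t y
  have h2 := hT.bary_cone hd hz 1 y
  rw [one_smul, sub_self] at h2
  set w := height T z • outerNormal T z + (y : Euc d)
  have hP : y ∈ facePatch T z ↔ ∀ a ∈ T, 0 ≤ bary T a (z + w) := by
    rw [facePatch, mem_preimage, hT.mem_face_iff hz, hT.mem_hull_iff, add_assoc]
    exact ⟨fun h => h.1, fun h => ⟨h, h2⟩⟩
  rw [hP, hT.mem_hull_iff]
  constructor
  · intro h
    have ht1 : t ≤ 1 := by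
      have := h z hz
      rw [h1] at this
      linarith
    have ht0 : 0 < t := by
      rcases lt_or_gt_of_ne ht with hlt | hgt
      · exfalso
        have hs := hT.sum_bary (z + t • w)
        have hle : bary T z (z + t • w) ≤ ∑ a ∈ T, bary T a (z + t • w) :=
          Finset.single_le_sum (f := fun a => bary T a (z + t • w)) h hz
        rw [hs, h1] at hle
        linarith
      · exact hgt
    refine ⟨⟨ht0, ht1⟩, fun a ha => ?_⟩
    by_cases haz : a = z
    · rw [haz, h2]
    · have := h a ha
      rw [hT.bary_cone_ne hz ha haz] at this
      exact nonneg_of_mul_nonneg_right this ht0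
  · rintro ⟨⟨ht0, ht1⟩, h⟩ a ha
    by_cases haz : a = z
    · rw [haz, h1]
      linarith
    · rw [hT.bary_cone_ne hz ha haz]
      exact mul_nonneg ht0.le (h a ha)

lemma face_subset_range (hd : 1 ≤ d) {z : Euc d} (hz : z ∈ T) :
    face T z ⊆ range fun y : (Submodule.span ℝ {outerNormal T z})ᗮ =>
      (z + height T z • outerNormal T z) + (y : Euc d) := by
  intro x hx
  have hx0 := ((hT.mem_face_iff hz).1 hx).2
  refine ⟨⟨x - (z + height T z • outerNormal T z), ?_⟩, by simp⟩
  rw [Submodule.mem_orthogonal_singleton_iff_inner_right, ← sub_sub, inner_sub_right,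
    hT.inner_outerNormal_sub hd hz, hx0, hT.bary_self hz, inner_smul_right,
    real_inner_self_eq_norm_sq, hT.norm_outerNormal hd hz, height]
  simp

omit hT in
lemma isCompact_facePatch (T : Finset (Euc d)) (z : Euc d) : IsCompact (facePatch T z) := by
  set p := z + height T z • outerNormal T z
  have hι : Isometry (fun y : (Submodule.span ℝ {outerNormal T z})ᗮ => p + (y : Euc d)) :=
    (IsometryEquiv.addLeft p).isometry.comp isometry_subtype_coe
  exact hι.isClosedEmbedding.isCompact_preimage (isCompact_face T z)

lemma integral_face (hd : 1 ≤ d) {z : Euc d} (hz : z ∈ T) (ψ : Euc d → ℝ) :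
    ∫ x in face T z, ψ x ∂(Measure.euclideanHausdorffMeasure (d - 1)) =
      ∫ y in facePatch T z, ψ (z + (height T z • outerNormal T z + (y : Euc d))) := by
  rw [integral_hyperplane (hT.norm_outerNormal hd hz) (z + height T z • outerNormal T z) ψ _
    (hT.face_subset_range hd hz)]
  refine setIntegral_congr_fun (isCompact_facePatch T z).measurableSet fun y _ => ?_
  simp only [add_assoc]

lemma measure_face_lt_top (hd : 1 ≤ d) {z : Euc d} (hz : z ∈ T) :
    Measure.euclideanHausdorffMeasure (d - 1) (face T z) < ⊤ := by
  have hn := hT.norm_outerNormal hd hz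
  set p := z + height T z • outerNormal T z
  have hι : Isometry (fun y : (Submodule.span ℝ {outerNormal T z})ᗮ => p + (y : Euc d)) :=
    (IsometryEquiv.addLeft p).isometry.comp isometry_subtype_coe
  have h := hι.euclideanHausdorffMeasure_preimage (d := d - 1) (face T z)
  rw [inter_eq_self_of_subset_left (hT.face_subset_range hd hz), ← finrank_orthogonal_unit hn,
    InnerProductSpace.euclideanHausdorffMeasure_eq_volume, finrank_orthogonal_unit hn] at h
  rw [← h]
  exact (isCompact_facePatch T z).measure_lt_top

/-- The cone formula: integration over a simplex by slices parallel to a face. -/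
lemma integral_hull_eq_cone (hd : 1 ≤ d) {z : Euc d} (hz : z ∈ T) {g : Euc d → ℝ}
    (hg : Continuous g) :
    ∫ x in convexHull ℝ (T : Set (Euc d)), g x = height T z * ∫ t in (0 : ℝ)..1,
      t ^ (d - 1) * ∫ y in facePatch T z,
        g (z + t • (height T z • outerNormal T z + (y : Euc d))) := by
  have hn := hT.norm_outerNormal hd hz
  have hh := hT.height_pos hd hz
  obtain ⟨hmp, hemb⟩ := measurePreserving_normal_coords hn z
  set h := height T z
  set n := outerNormal T z
  set K := convexHull ℝ (T : Set (Euc d))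
  have hK : MeasurableSet K := (isCompact_hull T).measurableSet
  have hP : MeasurableSet (facePatch T z) := (isCompact_facePatch T z).measurableSet
  have hintg : Integrable (K.indicator g) :=
    (integrable_indicator_iff hK).2 (hg.continuousOn.integrableOn_compact (isCompact_hull T))
  rw [← integral_indicator hK, ← hmp.integral_comp hemb, Measure.volume_eq_prod, integral_prod]
  rotate_left
  · exact (hmp.integrable_comp_emb hemb).2 hintg
  -- The slice at signed distance s from the apex is the fixed patch scaled by s/h, in dimension d -
  -- 1; hence the Jacobian (s/h)^(d-1). The value s = 0 is a null set.
  have inner_eq : ∀ s : ℝ, s ≠ 0 →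
      ∫ y : (Submodule.span ℝ {n})ᗮ, K.indicator g (z + (s • n + (y : Euc d))) =
      (Ioc 0 h).indicator (fun s => (s / h) ^ (d - 1) *
        ∫ y in facePatch T z, g (z + (s / h) • (h • n + (y : Euc d)))) s := by
    intro s hs
    have hsh : s / h ≠ 0 := div_ne_zero hs hh.ne'
    have e : ∀ y : (Submodule.span ℝ {n})ᗮ, K.indicator g (z + (s • n + (y : Euc d))) =
        (fun y' : (Submodule.span ℝ {n})ᗮ =>
          K.indicator g (z + (s / h) • (h • n + (y' : Euc d)))) ((s / h)⁻¹ • y) := by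
      intro y
      congr 2
      rw [smul_add, smul_smul, div_mul_cancel₀ _ hh.ne', Submodule.coe_smul, smul_smul,
        mul_inv_cancel₀ hsh, one_smul]
    rw [integral_congr_ae (Eventually.of_forall e), Measure.integral_comp_smul volume
      (fun y' : (Submodule.span ℝ {n})ᗮ =>
        K.indicator g (z + (s / h) • (h • n + (y' : Euc d)))), finrank_orthogonal_unit hn]
    have e2 : ∀ y : (Submodule.span ℝ {n})ᗮ,
        K.indicator g (z + (s / h) • (h • n + (y : Euc d))) =
        (Ioc 0 h).indicator (fun s => (facePatch T z).indicator
          (fun y => g (z + (s / h) • (h • n + (y : Euc d)))) y) s := by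
      intro y
      have := hT.cone_mem_hull_iff hd hz hsh y
      have hiff : s / h ∈ Ioc (0 : ℝ) 1 ↔ s ∈ Ioc 0 h := by
        simp only [mem_Ioc, div_pos_iff_of_pos_right hh, div_le_one hh]
      rw [hiff] at this
      by_cases h1 : s ∈ Ioc 0 h
      · by_cases h2 : y ∈ facePatch T z
        · rw [indicator_of_mem (this.2 ⟨h1, h2⟩), indicator_of_mem h1, indicator_of_mem h2]
        · rw [indicator_of_notMem (fun h' => h2 (this.1 h').2), indicator_of_mem h1,
            indicator_of_notMem h2]
      · rw [indicator_of_notMem (fun h' => h1 (this.1 h').1), indicator_of_notMem h1]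
    simp_rw [e2]
    by_cases h1 : s ∈ Ioc 0 h
    · simp only [indicator_of_mem h1]
      rw [integral_indicator hP, smul_eq_mul]
      congr 1
      have : 0 < s / h := div_pos h1.1 hh
      rw [inv_pow, inv_inv, abs_of_pos (pow_pos this _)]
    · simp only [indicator_of_notMem h1]
      simp
  have hae : ∀ᵐ s : ℝ, s ≠ 0 := by simp [ae_iff, measure_singleton]
  rw [integral_congr_ae (hae.mono fun s hs => inner_eq s hs), integral_indicator measurableSet_Ioc,
    ← intervalIntegral.integral_of_le hh.le]
  -- The substitution t = s/h produces the factor `height T z`.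
  have := intervalIntegral.integral_comp_div (a := 0) (b := h) (fun t => t ^ (d - 1) *
    ∫ y in facePatch T z, g (z + t • (h • n + (y : Euc d)))) hh.ne'
  rw [this, zero_div, div_self hh.ne', smul_eq_mul]

/-- The divergence theorem for the fields `ψ(x) (x - z)`, `z` a vertex. -/
lemma integral_div_radial (hd : 1 ≤ d) {z : Euc d} (hz : z ∈ T) {ψ : Euc d → ℝ}
    (hψ : ContDiff ℝ 1 ψ) :
    ∫ x in convexHull ℝ (T : Set (Euc d)), (fderiv ℝ ψ x (x - z) + d * ψ x) =
      height T z * ∫ x in face T z, ψ x ∂(Measure.euclideanHausdorffMeasure (d - 1)) := by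
  have hc : Continuous fun x => fderiv ℝ ψ x (x - z) + d * ψ x :=
    ((hψ.continuous_fderiv one_ne_zero).clm_apply (by fun_prop)).add
      (continuous_const.mul hψ.continuous)
  rw [hT.integral_hull_eq_cone hd hz hc, hT.integral_face hd hz]
  congr 1
  simp_rw [← integral_const_mul]
  rw [intervalIntegral.integral_of_le zero_le_one, integral_integral_swap]
  · refine setIntegral_congr_fun (isCompact_facePatch T z).measurableSet fun y _ => ?_
    rw [← intervalIntegral.integral_of_le zero_le_one]
    -- After the order of integration is exchanged, the integrand along the ray z + t w is the exact
    -- derivative of t^d ψ(z + t w). The value at t = 0 drops since d ≥ 1, and the value at t = 1 is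
    -- ψ on the face.
    set w := height T z • outerNormal T z + (y : Euc d)
    have hder : ∀ t ∈ uIcc (0 : ℝ) 1, HasDerivAt (fun t : ℝ => t ^ d * ψ (z + t • w))
        (t ^ (d - 1) * (fderiv ℝ ψ (z + t • w) (z + t • w - z) + d * ψ (z + t • w))) t := by
      intro t _
      have h1 : HasDerivAt (fun t : ℝ => z + t • w) w t := by
        simpa using ((hasDerivAt_id t).smul_const w).const_add z
      have h2 := ((hψ.differentiable one_ne_zero (z + t • w)).hasFDerivAt).comp_hasDerivAt t h1
      have h3 := (hasDerivAt_pow d t).mul h2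
      refine h3.congr_deriv ?_
      obtain ⟨m, rfl⟩ : ∃ m, d = m + 1 := ⟨d - 1, by omega⟩
      simp only [Function.comp, add_sub_cancel_left, map_smul, smul_eq_mul, Nat.add_sub_cancel]
      push_cast
      ring
    rw [intervalIntegral.integral_eq_sub_of_hasDerivAt hder]
    · have : (0 : ℝ) ^ d = 0 := zero_pow (by omega)
      simp [this]
    · apply Continuous.intervalIntegrable
      have : Continuous fun t : ℝ => z + t • w := by fun_prop
      exact (continuous_pow _).mul (hc.comp this)
  · have hcont : Continuous fun q : ℝ × (Submodule.span ℝ {outerNormal T z})ᗮ =>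
        q.1 ^ (d - 1) * (fderiv ℝ ψ (z + q.1 • (height T z • outerNormal T z + (q.2 : Euc d)))
          (z + q.1 • (height T z • outerNormal T z + (q.2 : Euc d)) - z) +
          d * ψ (z + q.1 • (height T z • outerNormal T z + (q.2 : Euc d)))) := by
      have : Continuous fun q : ℝ × (Submodule.span ℝ {outerNormal T z})ᗮ =>
        z + q.1 • (height T z • outerNormal T z + (q.2 : Euc d)) := by fun_prop
      exact (continuous_fst.pow _).mul (hc.comp this)
    have hI := hcont.continuousOn.integrableOn_compact (μ := (volume : Measure ℝ).prod volume)
      (isCompact_Icc (a := (0 : ℝ)) (b := 1) |>.prod (isCompact_facePatch T z))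
    rw [IntegrableOn, ← Measure.prod_restrict] at hI
    refine hI.mono_measure ?_
    gcongr
    exact Ioc_subset_Icc_self

lemma integrableOn_face (hd : 1 ≤ d) {z : Euc d} (hz : z ∈ T) {ψ : Euc d → ℝ}
    (hψ : Continuous ψ) :
    IntegrableOn ψ (face T z) (Measure.euclideanHausdorffMeasure (d - 1)) := by
  have hK := isCompact_face T z
  obtain ⟨C, hC⟩ := hK.exists_bound_of_continuousOn hψ.continuousOn
  refine Measure.integrableOn_of_bounded (M := C) (hT.measure_face_lt_top hd hz).ne
    hψ.aestronglyMeasurable ?_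
  exact (ae_restrict_iff' hK.measurableSet).2 (Eventually.of_forall hC)

/-- The divergence theorem for the fields `ψ v` with a constant vector `v`. -/
lemma integral_fderiv_apply (hd : 1 ≤ d) (v : Euc d) {ψ : Euc d → ℝ} (hψ : ContDiff ℝ 1 ψ) :
    ∫ x in convexHull ℝ (T : Set (Euc d)), fderiv ℝ ψ x v = ∑ z ∈ T, inner ℝ (outerNormal T z) v *
      ∫ x in face T z, ψ x ∂(Measure.euclideanHausdorffMeasure (d - 1)) := by
  -- A constant field is the combination -∑ (∇λ_z · v)(x - z) of radial fields. The terms d ψ may be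
  -- added freely because the weights sum to zero.
  have e : ∀ x, fderiv ℝ ψ x v = ∑ z ∈ T, -inner ℝ (bgrad T z) v *
      (fderiv ℝ ψ x (x - z) + d * ψ x) := by
    intro x
    have h1 : v = ∑ z ∈ T, (-inner ℝ (bgrad T z) v) • (x - z) := by
      simp only [smul_sub, Finset.sum_sub_distrib, neg_smul, Finset.sum_neg_distrib,
        hT.sum_bgrad_smul, ← Finset.sum_smul, hT.sum_bgrad_inner]
      simp
    conv_lhs => rw [h1]
    simp only [map_sum, map_smul, smul_eq_mul, mul_add, Finset.sum_add_distrib, ← Finset.sum_mul,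
      Finset.sum_neg_distrib, hT.sum_bgrad_inner]
    simp
  simp_rw [e]
  rw [integral_finsetSum]
  · refine Finset.sum_congr rfl fun z hz => ?_
    rw [integral_const_mul, hT.integral_div_radial hd hz hψ, hT.outerNormal_eq hd hz, height,
      inner_neg_left, inner_smul_left]
    simp
    ring
  · intro z _
    refine Integrable.const_mul ?_ _
    have hc : Continuous fun x => fderiv ℝ ψ x (x - z) + d * ψ x :=
      ((hψ.continuous_fderiv one_ne_zero).clm_apply (by fun_prop)).add
        (continuous_const.mul hψ.continuous)
    exact hc.continuousOn.integrableOn_compact (isCompact_hull T)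

/-- The divergence theorem on a simplex. -/
lemma integral_divergence (hd : 1 ≤ d) {F : Fin d → Euc d → ℝ} (hF : ∀ i, ContDiff ℝ 1 (F i)) :
    ∫ x in convexHull ℝ (T : Set (Euc d)), ∑ i, fderiv ℝ (F i) x (EuclideanSpace.single i 1) =
      ∑ z ∈ T, ∫ x in face T z, inner ℝ (outerNormal T z) (WithLp.toLp 2 fun i => F i x)
        ∂(Measure.euclideanHausdorffMeasure (d - 1)) := by
  rw [integral_finsetSum]
  · simp_rw [hT.integral_fderiv_apply hd _ (hF _)]
    rw [Finset.sum_comm]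
    refine Finset.sum_congr rfl fun z hz => ?_
    simp_rw [← integral_const_mul]
    rw [← integral_finsetSum]
    · congr 1
      ext x
      simp [PiLp.inner_apply, mul_comm]
    · exact fun i _ => (hT.integrableOn_face hd hz (hF i).continuous).const_mul _
  · intro i _
    have hc : Continuous fun x => fderiv ℝ (F i) x (EuclideanSpace.single i 1) :=
      ((hF i).continuous_fderiv one_ne_zero).clm_apply continuous_const
    exact hc.continuousOn.integrableOn_compact (isCompact_hull T)

end IsSimplex

/-! ### Lipschitz domains -/

/-- A set that avoids the frontier is covered by two disjoint open sets, Ω and its exterior. -/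
lemma subset_of_inter_frontier_eq_empty {A Ω : Set (Euc d)} (hΩ : IsOpen Ω)
    (hA : IsPreconnected A) (h1 : (A ∩ Ω).Nonempty) (h2 : ∀ y ∈ A, y ∉ frontier Ω) : A ⊆ Ω := by
  refine IsPreconnected.subset_left_of_subset_union hΩ isClosed_closure.isOpen_compl
    (disjoint_compl_right.mono_left subset_closure) (fun y hy => ?_) h1 hA
  by_contra h
  rw [mem_union, not_or, mem_compl_iff, not_not] at h
  exact h2 y hy (by rw [hΩ.frontier_eq]; exact ⟨h.2, h.1⟩)

namespace IsLipschitzDomain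

/-- Near a boundary point, the domain is the set where a Lipschitz function `ρ` is positive, which
decreases with unit speed in a direction `e`. -/
lemma exists_local_graph {Ω : Set (Euc d)} (hΩ : IsLipschitzDomain Ω) {x : Euc d}
    (hx : x ∈ frontier Ω) : ∃ (e : Euc d) (L : ℝ) (ρ : Euc d → ℝ), ‖e‖ = 1 ∧ 0 ≤ L ∧
      (∀ y y', |ρ y - ρ y'| ≤ L * ‖y - y'‖) ∧ Continuous ρ ∧ (∀ y t, ρ (y + t • e) = ρ y - t) ∧
      ρ x = 0 ∧ ∀ᶠ y in 𝓝 x, y ∈ Ω ↔ 0 < ρ y := by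
  obtain ⟨e, K, γ, he, hγ, hU⟩ := hΩ.locally_below_graph x hx
  -- The vertical distance below the graph. Its Lipschitz constant 2K + 1 uses the crude bound 2 for
  -- the horizontal projection.
  set ρ : Euc d → ℝ := fun y => γ (y - inner ℝ e y • e) - inner ℝ e y with hρ
  have hU' : ∀ᶠ y in 𝓝 x, y ∈ Ω ↔ 0 < ρ y := by
    filter_upwards [hU] with y hy
    rw [hy, hρ]
    simp
  have hL : ∀ y y', |ρ y - ρ y'| ≤ ((K : ℝ) * 2 + 1) * ‖y - y'‖ := by
    intro y y'
    have h1 : |inner ℝ e (y - y')| ≤ ‖y - y'‖ := by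
      simpa [he] using abs_real_inner_le_norm e (y - y')
    have h2 := hγ.dist_le_mul (y - inner ℝ e y • e) (y' - inner ℝ e y' • e)
    rw [Real.dist_eq, dist_eq_norm] at h2
    have h3 : ‖(y - inner ℝ e y • e) - (y' - inner ℝ e y' • e)‖ ≤ 2 * ‖y - y'‖ := by
      have : (y - inner ℝ e y • e) - (y' - inner ℝ e y' • e) =
          (y - y') - inner ℝ e (y - y') • e := by
        rw [inner_sub_right, sub_smul]
        abel
      rw [this]
      refine (norm_sub_le _ _).trans ?_
      rw [norm_smul, he, mul_one, Real.norm_eq_abs]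
      linarith
    have h4 : ρ y - ρ y' = (γ (y - inner ℝ e y • e) - γ (y' - inner ℝ e y' • e)) -
        inner ℝ e (y - y') := by
      simp only [hρ, inner_sub_right]
      ring
    rw [h4]
    refine (abs_sub _ _).trans ?_
    have h5 := mul_le_mul_of_nonneg_left h3 K.coe_nonneg
    linarith
  have hc : Continuous ρ := by
    have := hγ.continuous
    fun_prop
  refine ⟨e, K * 2 + 1, ρ, he, by positivity, hL, hc, ?_, ?_, hU'⟩
  · intro y t
    have h1 : inner ℝ e (y + t • e) = inner ℝ e y + t := by
      rw [inner_add_right, inner_smul_right, real_inner_self_eq_norm_sq, he]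
      ring
    simp only [hρ, h1]
    have : y + t • e - (inner ℝ e y + t) • e = y - inner ℝ e y • e := by
      rw [add_smul]
      abel
    rw [this]
    ring
  · apply le_antisymm
    · have hxΩ : x ∉ Ω := by
        rw [hΩ.isOpen.frontier_eq] at hx
        exact hx.2
      rw [hU'.self_of_nhds] at hxΩ
      exact not_lt.1 hxΩ
    · have hfr := mem_closure_iff_frequently.1 (frontier_subset_closure hx)
      have hfr' : ∃ᶠ y in 𝓝 x, ρ y ∈ Ici (0 : ℝ) :=
        (hfr.and_eventually hU').mono fun y hy => (hy.2.1 hy.1).le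
      exact isClosed_Ici.mem_of_frequently_of_tendsto hfr' hc.continuousAt

lemma tendsto_add_smul (x e : Euc d) : Tendsto (fun t : ℝ => x + t • e) (𝓝 0) (𝓝 x) := by
  have : Continuous fun t : ℝ => x + t • e := by fun_prop
  simpa using this.tendsto 0

/-- A Lipschitz domain lies on one side of its boundary: a boundary point shifted by t e with small
t > 0 has ρ < 0 in a whole neighbourhood, which therefore contains no points of Ω. -/
lemma interior_closure {Ω : Set (Euc d)} (hΩ : IsLipschitzDomain Ω) :
    interior (closure Ω) = Ω := by
  apply Subset.antisymm
  · intro x hx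
    by_contra hxΩ
    have hxf : x ∈ frontier Ω := by
      rw [hΩ.isOpen.frontier_eq]
      exact ⟨interior_subset hx, hxΩ⟩
    obtain ⟨e, L, ρ, he, hL0, hL, hc, hρe, hρx, hU⟩ := hΩ.exists_local_graph hxf
    have h1 : ∀ᶠ t : ℝ in 𝓝 0, x + t • e ∈ interior (closure Ω) ∧
        ∀ᶠ y in 𝓝 (x + t • e), y ∈ Ω ↔ 0 < ρ y :=
      (tendsto_add_smul x e).eventually
        ((isOpen_interior.eventually_mem hx).and (eventually_eventually_nhds.2 hU))
    have h2 : ∃ᶠ t : ℝ in 𝓝 0, 0 < t :=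
      frequently_gt_nhds (0 : ℝ)
    obtain ⟨t, ht0, ht1, ht2⟩ := (h2.and_eventually h1).exists
    have h3 : ∀ᶠ y in 𝓝 (x + t • e), ρ y < 0 := by
      apply hc.continuousAt.eventually_lt_const
      rw [hρe, hρx]
      linarith
    have h4 := mem_closure_iff_frequently.1 (interior_subset ht1)
    obtain ⟨y, hy1, hy2, hy3⟩ := (h4.and_eventually (ht2.and h3)).exists
    have := hy2.1 hy1
    linarith
  · exact hΩ.isOpen.subset_interior_iff.2 subset_closure

/-- If `S ⊆ Ω` and `∂Ω ⊆ ∂S` then `S` and `Ω` agree near `∂Ω`. -/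
lemma eventually_mem_iff {Ω S : Set (Euc d)} (hΩ : IsLipschitzDomain Ω)
    (hS : IsLipschitzDomain S) (hSΩ : S ⊆ Ω) (hΓ : frontier Ω ⊆ frontier S) {x : Euc d}
    (hx : x ∈ frontier Ω) : ∀ᶠ y in 𝓝 x, y ∈ S ↔ y ∈ Ω := by
  obtain ⟨e, L, ρ, he, hL0, hL, hc, hρe, hρx, hU⟩ := hS.exists_local_graph (hΓ hx)
  obtain ⟨r, hr, hB⟩ := Metric.eventually_nhds_iff_ball.1 hU
  have hclosure : ∀ y ∈ Metric.ball x r, 0 ≤ ρ y → y ∈ closure S := by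
    intro y hy h0
    rw [mem_closure_iff_frequently]
    have h2 : ∃ᶠ t : ℝ in 𝓝 0, t < 0 :=
      frequently_lt_nhds (0 : ℝ)
    have h1 := (tendsto_add_smul y e).eventually (Metric.isOpen_ball.mem_nhds hy)
    refine (tendsto_add_smul y e).frequently ((h2.and_eventually h1).mono fun t ht => ?_)
    rw [hB _ ht.2, hρe]
    linarith [ht.1]
  -- Such points are exterior to S, and ∂Ω ⊆ ∂S. So the exterior side of the chart of S misses ∂Ω,
  -- and a connected part of it lies entirely inside or entirely outside Ω.
  have hneg : ∀ y ∈ Metric.ball x r, ρ y < 0 → y ∉ frontier Ω := by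
    intro y hy h0 hyΩ
    have h1 := mem_closure_iff_frequently.1 (frontier_subset_closure (hΓ hyΩ))
    have h2 : ∀ᶠ y' in 𝓝 y, ρ y' < 0 := hc.continuousAt.eventually_lt_const h0
    obtain ⟨y', h3, h4, h5⟩ :=
      (h1.and_eventually (h2.and (Metric.isOpen_ball.mem_nhds hy))).exists
    have := (hB y' h5).1 h3
    linarith
  -- two points close to `x` with `ρ < 0` are joined inside `{ρ < 0}`
  obtain ⟨δ, hδ, hδr⟩ : ∃ δ > 0, (2 * L + 4) * δ < r := by
    refine ⟨r / (2 * (2 * L + 4)), by positivity, ?_⟩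
    have : (2 * L + 4) * (r / (2 * (2 * L + 4))) = r / 2 := by
      field_simp
    rw [this]
    linarith
  have hjoin : ∀ y ∈ Metric.ball x δ, ∀ w ∈ Metric.ball x δ, ρ y < 0 → ρ w < 0 → y ∈ Ω → w ∈ Ω := by
    intro y hy w hw hy0 hw0 hyΩ
    rw [Metric.mem_ball, dist_eq_norm] at hy hw
    -- The path goes up from y by R, across to the point above w, and down. On the crossing ρ has
    -- grown by at most L‖w - y‖ ≤ 2Lδ, which the rise by R more than compensates; the path stays
    -- within (2L + 2)δ < r of x.
    set R := 2 * L * δ + δ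
    have hR : 0 ≤ R := by positivity
    have hup : ∀ p, ‖p - x‖ < δ → ∀ t ∈ Icc (0 : ℝ) R, p + t • e ∈ Metric.ball x r := by
      intro p hp t ht
      rw [Metric.mem_ball, dist_eq_norm]
      have e1 : p + t • e - x = (p - x) + t • e := by abel
      rw [e1]
      refine (norm_add_le _ _).trans_lt ?_
      rw [norm_smul, he, mul_one, Real.norm_eq_abs, abs_of_nonneg ht.1]
      have h2 : R = 2 * L * δ + δ := rfl
      nlinarith [ht.2]
    have hvert : ∀ p, ‖p - x‖ < δ → ρ p < 0 →
        (∀ q ∈ (fun t : ℝ => p + t • e) '' Icc 0 R, q ∉ frontier Ω) := by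
      rintro p hp hp0 q ⟨t, ht, rfl⟩
      refine hneg _ (hup p hp t ht) ?_
      rw [hρe]
      linarith [ht.1]
    have hconn : ∀ p, IsPreconnected ((fun t : ℝ => p + t • e) '' Icc 0 R) := fun p =>
      isPreconnected_Icc.image _ (by fun_prop)
    have s1 : y + R • e ∈ Ω :=
      subset_of_inter_frontier_eq_empty hΩ.isOpen (hconn y)
        ⟨y, ⟨0, ⟨le_rfl, hR⟩, by simp⟩, hyΩ⟩ (hvert y hy hy0) ⟨R, ⟨hR, le_rfl⟩, rfl⟩
    have s2 : w + R • e ∈ Ω := by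
      have hc2 : IsPreconnected ((fun t : ℝ => (y + R • e) + t • (w - y)) '' Icc 0 1) :=
        isPreconnected_Icc.image _ (by fun_prop)
      refine subset_of_inter_frontier_eq_empty hΩ.isOpen hc2
        ⟨y + R • e, ⟨0, ⟨le_rfl, zero_le_one⟩, by simp⟩, s1⟩ ?_ ⟨1, ⟨zero_le_one, le_rfl⟩, ?_⟩
      · rintro q ⟨t, ht, rfl⟩
        have hp : ‖(y + t • (w - y)) - x‖ < δ := by
          have e1 : (y + t • (w - y)) - x = (1 - t) • (y - x) + t • (w - x) := by
            module
          rw [e1]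
          refine (norm_add_le _ _).trans_lt ?_
          rw [norm_smul, norm_smul, Real.norm_eq_abs, Real.norm_eq_abs, abs_of_nonneg ht.1,
            abs_of_nonneg (by linarith [ht.2])]
          rcases ht.1.eq_or_lt with h | h
          · rw [← h]
            linarith
          · nlinarith [ht.2]
        have e2 : y + R • e + t • (w - y) = (y + t • (w - y)) + R • e := by abel
        simp only [e2]
        refine hneg _ (hup _ hp R ⟨hR, le_rfl⟩) ?_
        rw [hρe]
        have h3 := hL (y + t • (w - y)) y
        rw [add_sub_cancel_left, norm_smul, Real.norm_eq_abs, abs_of_nonneg ht.1] at h3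
        have h4 : ‖w - y‖ ≤ 2 * δ := by
          have : w - y = (w - x) - (y - x) := by abel
          rw [this]
          exact (norm_sub_le _ _).trans (by linarith)
        have h5 : L * (t * ‖w - y‖) ≤ 2 * L * δ := by
          have : t * ‖w - y‖ ≤ 2 * δ := by nlinarith [norm_nonneg (w - y), ht.2, ht.1]
          nlinarith
        have h6 := (abs_le.1 h3).2
        have h7 : R = 2 * L * δ + δ := rfl
        linarith
      · simp only [one_smul]
        abel
    exact subset_of_inter_frontier_eq_empty hΩ.isOpen (hconn w)
      ⟨w + R • e, ⟨R, ⟨hR, le_rfl⟩, rfl⟩, s2⟩ (hvert w hw hw0) ⟨0, ⟨le_rfl, hR⟩, by simp⟩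
  have hδr' : Metric.ball x δ ⊆ Metric.ball x r := by
    apply Metric.ball_subset_ball
    nlinarith
  -- there are exterior points of `Ω` near `x`
  obtain ⟨w, hw, hwΩ⟩ : ∃ w ∈ Metric.ball x δ, w ∉ closure Ω := by
    by_contra! h
    have : x ∈ interior (closure Ω) :=
      mem_interior.2 ⟨_, h, Metric.isOpen_ball, Metric.mem_ball_self hδ⟩
    rw [hΩ.interior_closure] at this
    rw [hΩ.isOpen.frontier_eq] at hx
    exact hx.2 this
  -- The exterior point w of Ω lies on the negative side, so by `hjoin` no nearby point of that side
  -- belongs to Ω.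
  have hw0 : ρ w < 0 := by
    by_contra! h
    exact hwΩ (closure_mono hSΩ (hclosure w (hδr' hw) h))
  filter_upwards [Metric.ball_mem_nhds x hδ] with y hy
  refine ⟨fun h => hSΩ h, fun hyΩ => ?_⟩
  rw [hB y (hδr' hy)]
  by_contra! h0
  -- The case ρ y = 0 is not covered by `hjoin`; a small upward shift keeps the point in the open
  -- set Ω and makes ρ negative.
  have h1 : ∀ᶠ t : ℝ in 𝓝 0, y + t • e ∈ Ω ∧ y + t • e ∈ Metric.ball x δ :=
    (tendsto_add_smul y e).eventually
      ((hΩ.isOpen.eventually_mem hyΩ).and (Metric.isOpen_ball.eventually_mem hy))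
  have h2 : ∃ᶠ t : ℝ in 𝓝 0, 0 < t :=
    frequently_gt_nhds (0 : ℝ)
  obtain ⟨t, ht0, ht1, ht2⟩ := (h2.and_eventually h1).exists
  refine hwΩ (subset_closure (hjoin _ ht2 w hw ?_ hw0 ht1))
  rw [hρe]
  linarith

lemma eventually_frontier {Ω S : Set (Euc d)} (hΩ : IsLipschitzDomain Ω)
    (hS : IsLipschitzDomain S) (hSΩ : S ⊆ Ω) (hΓ : frontier Ω ⊆ frontier S) {x : Euc d}
    (hx : x ∈ frontier Ω) : ∀ᶠ y in 𝓝 x, y ∈ frontier S → y ∈ frontier Ω := by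
  filter_upwards [eventually_eventually_nhds.2 (hΩ.eventually_mem_iff hS hSΩ hΓ hx)] with y hy h
  rw [hS.isOpen.frontier_eq] at h
  rw [hΩ.isOpen.frontier_eq]
  refine ⟨closure_mono hSΩ h.1, fun h' => h.2 (hy.self_of_nhds.2 h')⟩

/-- By `eventually_frontier`, Γ is relatively open in ∂S, so its complement there is closed. -/
lemma isClosed_frontier_diff {Ω S : Set (Euc d)} (hΩ : IsLipschitzDomain Ω)
    (hS : IsLipschitzDomain S) (hSΩ : S ⊆ Ω) (hΓ : frontier Ω ⊆ frontier S) :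
    IsClosed (frontier S \ frontier Ω) := by
  rw [← isOpen_compl_iff, isOpen_iff_mem_nhds]
  intro x hx
  by_cases h : x ∈ frontier S
  · have hxΩ : x ∈ frontier Ω := by
      by_contra h'
      exact hx ⟨h, h'⟩
    filter_upwards [hΩ.eventually_frontier hS hSΩ hΓ hxΩ] with y hy hy'
    exact hy'.2 (hy hy'.1)
  · filter_upwards [isClosed_frontier.isOpen_compl.mem_nhds h] with y hy hy'
    exact hy hy'.1

/-- Γ and Γᶜ are disjoint closed sets covering ∂S. In particular no boundary face, and no boundary
subsimplex, meets both. -/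
lemma subset_frontier_of_preconnected {Ω S A : Set (Euc d)} (hΩ : IsLipschitzDomain Ω)
    (hS : IsLipschitzDomain S) (hSΩ : S ⊆ Ω) (hΓ : frontier Ω ⊆ frontier S)
    (hA : IsPreconnected A) (hAS : A ⊆ frontier S) {x : Euc d} (hxA : x ∈ A)
    (hx : x ∈ frontier Ω) : A ⊆ frontier Ω := by
  rcases isPreconnected_iff_subset_of_disjoint_closed.1 hA (frontier Ω) (frontier S \ frontier Ω)
    isClosed_frontier (hΩ.isClosed_frontier_diff hS hSΩ hΓ)
    (fun y hy => by by_cases h : y ∈ frontier Ω; exacts [Or.inl h, Or.inr ⟨hAS hy, h⟩])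
    (by ext y; simp) with h | h
  · exact h
  · exact absurd hx (h hxA).2

/-- Relatively open parts of the boundary have positive surface measure. -/
lemma surf_pos {Ω U : Set (Euc d)} (hΩ : IsLipschitzDomain Ω) {x : Euc d} (hx : x ∈ frontier Ω)
    (hU : U ∈ 𝓝 x) : surf Ω U ≠ 0 := by
  obtain ⟨e, L, ρ, he, hL0, hL, hc, hρe, hρx, hloc⟩ := hΩ.exists_local_graph hx
  set N := (Submodule.span ℝ {e})ᗮ
  obtain ⟨V, hVU, hV, hxV⟩ := mem_nhds_iff.1 (inter_mem hU hloc)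
  have hfr : ∀ y ∈ V, ρ y = 0 → y ∈ frontier Ω := by
    intro y hy h0
    rw [hΩ.isOpen.frontier_eq]
    constructor
    · rw [mem_closure_iff_frequently]
      have h2 : ∃ᶠ t : ℝ in 𝓝 0, t < 0 :=
        frequently_lt_nhds (0 : ℝ)
      have h1 := (tendsto_add_smul y e).eventually (hV.mem_nhds hy)
      refine (tendsto_add_smul y e).frequently ((h2.and_eventually h1).mono fun t ht => ?_)
      have := (hVU ht.2).2
      simp only [mem_ofPred_eq] at this
      rw [this, hρe, h0]
      linarith [ht.1]
    · have := (hVU hy).2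
      simp only [mem_ofPred_eq] at this
      rw [this, h0]
      exact lt_irrefl _
  set f : N → Euc d := fun v => x + ((v : Euc d) + ρ (x + v) • e)
  have hf : Continuous f := by fun_prop
  have hf0 : f 0 = x := by simp [f, hρx]
  have hW : ∀ᶠ v in 𝓝 (0 : N), f v ∈ V := by
    apply hf.continuousAt.eventually
    rw [hf0]
    exact hV.mem_nhds hxV
  obtain ⟨δ, hδ, hball⟩ := Metric.eventually_nhds_iff_ball.1 hW
  -- The projection along e is 1-Lipschitz and maps the graph patch onto a ball of dimension d - 1;
  -- a Lipschitz image of a Hausdorff null set would be null, which the ball is not.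
  set π : Euc d → N := fun y => N.orthogonalProjectionOnto (y - x)
  have hπ : LipschitzWith 1 π := by
    refine LipschitzWith.of_dist_le_mul fun y y' => ?_
    rw [dist_eq_norm, dist_eq_norm, ← map_sub]
    have := N.norm_orthogonalProjectionOnto_apply_le ((y - x) - (y' - x))
    simpa using this
  have himg : Metric.ball (0 : N) δ ⊆ π '' (U ∩ frontier Ω) := by
    intro v hv
    refine ⟨f v, ⟨(hVU (hball v hv)).1, hfr _ (hball v hv) ?_⟩, ?_⟩
    · simp only [f]
      rw [← add_assoc, hρe]
      ring
    · simp only [π, f, add_sub_cancel_left, map_add, map_smul]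
      rw [Submodule.orthogonalProjectionOnto_mem_subspace_eq_self,
        Submodule.orthogonalProjectionOnto_orthogonalComplement_singleton_eq_zero, smul_zero,
        add_zero]
  intro h0
  have h1 : Measure.euclideanHausdorffMeasure (d - 1) (U ∩ frontier Ω) = 0 := by
    rw [surf] at h0
    exact (Measure.restrict_apply' isClosed_frontier.measurableSet).symm.trans h0
  have h2 : (Measure.hausdorffMeasure ((d - 1 : ℕ) : ℝ)) (U ∩ frontier Ω) = 0 := by
    rw [Measure.euclideanHausdorffMeasure_def, Measure.smul_apply] at h1
    rw [ENNReal.smul_def, smul_eq_mul, mul_eq_zero] at h1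
    rcases h1 with h | h
    · exact absurd (by exact_mod_cast h)
        (Measure.addHaarScalarFactor_volume_hausdorffMeasure_ne_zero (d - 1))
    · exact h
  have h3 := hπ.hausdorffMeasure_image_le (d := ((d - 1 : ℕ) : ℝ)) (by positivity) (U ∩ frontier Ω)
  rw [h2, mul_zero, nonpos_iff_eq_zero] at h3
  have h4 : Measure.euclideanHausdorffMeasure (d - 1) (Metric.ball (0 : N) δ) = 0 := by
    rw [Measure.euclideanHausdorffMeasure_def, Measure.smul_apply, measure_mono_null himg h3,
      smul_zero]
  rw [← finrank_orthogonal_unit he, InnerProductSpace.euclideanHausdorffMeasure_eq_volume] at h4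
  exact (Metric.measure_ball_pos volume (0 : N) hδ).ne' h4

end IsLipschitzDomain

/-! ### Simplices: affine combinations and centres -/

lemma bary_of_notMem {T : Finset (Euc d)} {z : Euc d} (hz : z ∉ T) (x : Euc d) :
    bary T z x = 0 := by
  simp [bary, hz]

lemma bary_sum_smul (T : Finset (Euc d)) (z : Euc d) {ι : Type*} (s : Finset ι) (w : ι → ℝ)
    (p : ι → Euc d) (hw : ∑ i ∈ s, w i = 1) :
    bary T z (∑ i ∈ s, w i • p i) = ∑ i ∈ s, w i * bary T z (p i) := by
  have e : ∀ x, bary T z x = bary T z 0 + inner ℝ (bgrad T z) x := fun x => by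
    simpa using bary_add T z 0 x
  rw [e]
  simp_rw [e (p _), mul_add, Finset.sum_add_distrib, ← Finset.sum_mul, hw, inner_sum,
    inner_smul_right, one_mul]

namespace IsSimplex

variable {T T' : Finset (Euc d)}

lemma bary_eq_sum (hT : IsSimplex T) (T' : Finset (Euc d)) (z x : Euc d) :
    bary T' z x = ∑ a ∈ T, bary T a x * bary T' z a := by
  conv_lhs => rw [← hT.sum_bary_smul x]
  rw [bary_sum_smul _ _ _ _ _ (hT.sum_bary x)]

lemma bary_combination (hT : IsSimplex T) {A : Finset (Euc d)} (hA : A ⊆ T) {w : Euc d → ℝ}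
    (hw : ∑ a ∈ A, w a = 1) {z : Euc d} (hz : z ∈ T) (hw0 : z ∉ A → w z = 0) :
    bary T z (∑ a ∈ A, w a • a) = w z := by
  classical
  rw [bary_sum_smul _ _ _ _ _ hw]
  by_cases h : z ∈ A
  · rw [Finset.sum_eq_single_of_mem z h, hT.bary_self hz, mul_one]
    intro b hb hbz
    rw [hT.bary_ne hz (hA hb) hbz.symm, mul_zero]
  · rw [hw0 h]
    refine Finset.sum_eq_zero fun b hb => ?_
    rw [hT.bary_ne hz (hA hb) (fun h' => h (h' ▸ hb)), mul_zero]

lemma exists_center (hT : IsSimplex T) : ∃ x, ∀ z ∈ T, 0 < bary T z x := by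
  have h : (0 : ℝ) < d + 1 := by positivity
  refine ⟨∑ a ∈ T, ((d : ℝ) + 1)⁻¹ • a, fun z hz => ?_⟩
  rw [hT.bary_combination (w := fun _ => ((d : ℝ) + 1)⁻¹) (Finset.Subset.refl T) ?_ hz
    (fun h' => absurd hz h')]
  · positivity
  · rw [Finset.sum_const, hT.card_eq]
    simp
    field_simp

lemma exists_face_center (hT : IsSimplex T) (hd : 1 ≤ d) {z : Euc d} (hz : z ∈ T) :
    ∃ x ∈ face T z, bary T z x = 0 ∧ ∀ a ∈ T, a ≠ z → 0 < bary T a x := by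
  classical
  have h : (0 : ℝ) < d := by exact_mod_cast hd
  have hsum : ∑ a ∈ T.erase z, (if a = z then (0 : ℝ) else (d : ℝ)⁻¹) = 1 := by
    rw [Finset.sum_congr rfl (g := fun _ => (d : ℝ)⁻¹)
      (fun a ha => if_neg (Finset.ne_of_mem_erase ha)), Finset.sum_const,
      Finset.card_erase_of_mem hz, hT.card_eq]
    simp
    field_simp
  have hb : ∀ a ∈ T, bary T a (∑ a ∈ T.erase z, (if a = z then (0 : ℝ) else (d : ℝ)⁻¹) • a) =
      if a = z then (0 : ℝ) else (d : ℝ)⁻¹ := by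
    intro a ha
    refine hT.bary_combination (w := fun a => if a = z then (0 : ℝ) else (d : ℝ)⁻¹)
      (Finset.erase_subset _ _) hsum ha (fun h' => ?_)
    have : a = z := by
      by_contra h''
      exact h' (Finset.mem_erase.2 ⟨h'', ha⟩)
    simp [this]
  refine ⟨∑ a ∈ T.erase z, (if a = z then (0 : ℝ) else (d : ℝ)⁻¹) • a, ?_, ?_, ?_⟩
  · rw [hT.mem_face_iff hz, hT.mem_hull_iff, hb z hz]
    refine ⟨fun a ha => ?_, by simp⟩
    rw [hb a ha]
    split_ifs
    · rfl
    · positivity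
  · rw [hb z hz]
    simp
  · intro a ha haz
    rw [hb a ha, if_neg haz]
    positivity

end IsSimplex

namespace Triangulation

variable {S : Set (Euc d)} (𝒯 : Triangulation S)

/-! ### Local structure of a conforming triangulation -/

lemma isSimplex (T : 𝒯.elements) : IsSimplex (T : Finset (Euc d)) :=
  ⟨𝒯.card_eq T T.2, 𝒯.affineIndependent T T.2⟩

lemma isCompact_cell (T : 𝒯.elements) : IsCompact (𝒯.cell T) := IsSimplex.isCompact_hull _

lemma mem_cell_iff (T : 𝒯.elements) {x : Euc d} :
    x ∈ 𝒯.cell T ↔ ∀ z ∈ (T : Finset (Euc d)), 0 ≤ bary T z x :=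
  (𝒯.isSimplex T).mem_hull_iff

lemma cell_subset (T : 𝒯.elements) : 𝒯.cell T ⊆ closure S := by
  rw [← 𝒯.cover]
  exact fun x hx => mem_biUnion T.2 hx

lemma exists_mem_cell {x : Euc d} (hx : x ∈ closure S) : ∃ T, x ∈ 𝒯.cell T := by
  rw [← 𝒯.cover] at hx
  obtain ⟨T, hT, hx⟩ := mem_iUnion₂.1 hx
  exact ⟨⟨T, hT⟩, hx⟩

include 𝒯 in
lemma isCompact_closure : IsCompact (closure S) := by
  rw [← 𝒯.cover]
  exact 𝒯.elements.isCompact_biUnion fun T _ => IsSimplex.isCompact_hull T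

lemma face_subset_cell (T : 𝒯.elements) (z : Euc d) : face (T : Finset (Euc d)) z ⊆ 𝒯.cell T :=
  IsSimplex.face_subset z

/-- Barycentric coordinates of different elements agree at common points. -/
lemma bary_eq_bary {T T' : 𝒯.elements} {x : Euc d} (hx : x ∈ 𝒯.cell T) (hx' : x ∈ 𝒯.cell T')
    (z : Euc d) : bary (T : Finset (Euc d)) z x = bary (T' : Finset (Euc d)) z x := by
  classical
  -- By conformity x lies in the hull of the common vertices, so in either element only common
  -- vertices carry weight.
  have h : x ∈ convexHull ℝ (((T : Finset (Euc d)) : Set (Euc d)) ∩ (T' : Finset (Euc d))) := by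
    rw [← 𝒯.conforming T T.2 T' T'.2]
    exact ⟨hx, hx'⟩
  have h1 := ((𝒯.isSimplex T).mem_subhull_iff inter_subset_left).1 h
  have h2 := ((𝒯.isSimplex T').mem_subhull_iff inter_subset_right).1 h
  by_cases hz : z ∈ (T : Finset (Euc d))
  · by_cases hz' : z ∈ (T' : Finset (Euc d))
    · rw [(𝒯.isSimplex T).bary_eq_sum T' z x, Finset.sum_eq_single_of_mem z hz,
        (𝒯.isSimplex T').bary_self hz', mul_one]
      intro a ha haz
      by_cases ha' : a ∈ (T' : Finset (Euc d))
      · rw [(𝒯.isSimplex T').bary_ne hz' ha' haz.symm, mul_zero]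
      · rw [h1.2 a ha (fun h => ha' h.2), zero_mul]
    · rw [bary_of_notMem hz', h1.2 z hz (fun h => hz' h.2)]
  · rw [bary_of_notMem hz]
    by_cases hz' : z ∈ (T' : Finset (Euc d))
    · rw [h2.2 z hz' (fun h => hz h.1)]
    · rw [bary_of_notMem hz']

lemma mem_of_bary_ne_zero {T T' : 𝒯.elements} {x z : Euc d} (hx : x ∈ 𝒯.cell T)
    (hx' : x ∈ 𝒯.cell T') (h : bary (T : Finset (Euc d)) z x ≠ 0) :
    z ∈ (T' : Finset (Euc d)) := by
  rw [𝒯.bary_eq_bary hx hx'] at h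
  by_contra hz
  exact h (bary_of_notMem hz x)

/-- Points close to `x` only lie in elements which contain `x`. -/
lemma eventually_mem_cell (x : Euc d) :
    ∀ᶠ y in 𝓝 x, ∀ T, y ∈ 𝒯.cell T → x ∈ 𝒯.cell T := by
  rw [eventually_all]
  intro T
  by_cases h : x ∈ 𝒯.cell T
  · exact Eventually.of_forall fun _ _ => h
  · filter_upwards [(𝒯.isCompact_cell T).isClosed.isOpen_compl.mem_nhds h] with y hy hy'
    exact absurd hy' hy

lemma tendsto_add_nhds (x : Euc d) : Tendsto (fun v : Euc d => x + v) (𝓝 0) (𝓝 x) := by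
  have : Continuous fun v : Euc d => x + v := by fun_prop
  simpa using this.tendsto 0

lemma mem_interior_of_eventually_add {A : Set (Euc d)} {x : Euc d}
    (h : ∀ᶠ v in 𝓝 (0 : Euc d), x + v ∈ A) : x ∈ interior A := by
  rw [mem_interior_iff_mem_nhds]
  have h1 : Tendsto (fun y => y - x) (𝓝 x) (𝓝 0) := by
    have : Continuous fun y : Euc d => y - x := by fun_prop
    simpa using this.tendsto x
  filter_upwards [h1.eventually h] with y hy
  simpa using hy

lemma interior_cell_subset (hS : IsLipschitzDomain S) (T : 𝒯.elements) :
    interior (𝒯.cell T) ⊆ S :=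
  (interior_mono (𝒯.cell_subset T)).trans hS.interior_closure.subset

/-- If a point of an element belongs to `∂S`, then so does the smallest subsimplex containing
it. -/
lemma mem_frontier_of_bary (hS : IsLipschitzDomain S) {T : 𝒯.elements} {x y : Euc d}
    (hx : x ∈ 𝒯.cell T) (hxS : x ∈ frontier S) (hy : y ∈ 𝒯.cell T)
    (hxy : ∀ z ∈ (T : Finset (Euc d)), bary (T : Finset (Euc d)) z x = 0 →
      bary (T : Finset (Euc d)) z y = 0) : y ∈ frontier S := by
  rw [hS.isOpen.frontier_eq]
  refine ⟨𝒯.cell_subset T hy, fun hyS => ?_⟩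
  -- move `y` slightly towards `x`
  obtain ⟨y', hy'S, hyT₁, hy'⟩ : ∃ y' ∈ S, y' ∈ 𝒯.cell T ∧ ∀ z ∈ (T : Finset (Euc d)),
      bary (T : Finset (Euc d)) z x = 0 ↔ bary (T : Finset (Euc d)) z y' = 0 := by
    have h1 : ∀ᶠ t : ℝ in 𝓝 0, y + t • (x - y) ∈ S ∧ t < 1 :=
      ((IsLipschitzDomain.tendsto_add_smul y (x - y)).eventually
        (hS.isOpen.eventually_mem hyS)).and (eventually_lt_nhds zero_lt_one)
    obtain ⟨t, ht0, ht1, ht2⟩ := ((frequently_gt_nhds (0 : ℝ)).and_eventually h1).exists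
    have hb := fun z => bary_lineMap (T : Finset (Euc d)) z y x t
    have hx0 := (𝒯.mem_cell_iff T).1 hx
    have hy0 := (𝒯.mem_cell_iff T).1 hy
    refine ⟨_, ht1, ?_, fun z hz => ?_⟩
    · rw [mem_cell_iff]
      intro z hz
      rw [hb]
      nlinarith [hx0 z hz, hy0 z hz]
    · rw [hb]
      constructor
      · intro h
        rw [h, hxy z hz h]
        ring
      · intro h
        have h3 := hx0 z hz
        have h4 := hy0 z hz
        have h5 : t * bary (T : Finset (Euc d)) z x = 0 := by nlinarith
        exact (mul_eq_zero.1 h5).resolve_left ht0.ne'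
  -- An element T' containing y' + v contains y', hence all vertices that are active at y', hence x.
  -- Coordinates of T' that vanish at x vanish at y' too, so they take the same value at x + v as at
  -- y' + v; the positive ones stay positive. Thus x + v ∈ T', and x would be interior to the
  -- closure of S.
  have hev : ∀ᶠ v in 𝓝 (0 : Euc d), x + v ∈ closure S := by
    have h1 : ∀ᶠ v in 𝓝 (0 : Euc d), y' + v ∈ S ∧ ∀ T, y' + v ∈ 𝒯.cell T → y' ∈ 𝒯.cell T :=
      (tendsto_add_nhds y').eventually
        ((hS.isOpen.eventually_mem hy'S).and (𝒯.eventually_mem_cell y'))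
    have h2 : ∀ᶠ v in 𝓝 (0 : Euc d), ∀ T' : 𝒯.elements, ∀ z ∈ (T' : Finset (Euc d)),
        0 < bary (T' : Finset (Euc d)) z x → 0 < bary (T' : Finset (Euc d)) z (x + v) := by
      rw [eventually_all]
      intro T'
      rw [Finset.eventually_all]
      intro z hz
      by_cases h : 0 < bary (T' : Finset (Euc d)) z x
      · filter_upwards [(tendsto_add_nhds x).eventually
          ((continuous_bary (T' : Finset (Euc d)) z).continuousAt.eventually_const_lt h)] with v hv _
        exact hv
      · exact Eventually.of_forall fun _ h' => absurd h' h
    filter_upwards [h1, h2] with v hv hv2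
    obtain ⟨T', hT'⟩ := 𝒯.exists_mem_cell (subset_closure hv.1)
    have hyT₂ := hv.2 T' hT'
    have hxT' : x ∈ 𝒯.cell T' := by
      have hsub : {z | z ∈ (T : Finset (Euc d)) ∧ bary (T : Finset (Euc d)) z x ≠ 0} ⊆
          ((T' : Finset (Euc d)) : Set (Euc d)) := fun z hz =>
        𝒯.mem_of_bary_ne_zero hyT₁ hyT₂ fun h => hz.2 ((hy' z hz.1).2 h)
      refine convexHull_mono hsub (((𝒯.isSimplex T).mem_subhull_iff ?_).2 ⟨?_, ?_⟩)
      · exact fun z hz => hz.1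
      · exact (𝒯.mem_cell_iff T).1 hx
      · intro z hz h
        by_contra h'
        exact h ⟨hz, h'⟩
    refine 𝒯.cell_subset T' ((𝒯.mem_cell_iff T').2 fun z hz => ?_)
    rcases ((𝒯.mem_cell_iff T').1 hxT' z hz).eq_or_lt with h | h
    · have e1 : bary (T : Finset (Euc d)) z y' = 0 := by
        by_cases hzT : z ∈ (T : Finset (Euc d))
        · rw [← hy' z hzT, 𝒯.bary_eq_bary hx hxT', ← h]
        · exact bary_of_notMem hzT _
      rw [𝒯.bary_eq_bary hyT₁ hyT₂] at e1
      have e2 := (𝒯.mem_cell_iff T').1 hT' z hz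
      rw [bary_add, e1] at e2
      rw [bary_add, ← h]
      exact e2
    · exact (hv2 T' z hz h).le
  have := mem_interior_of_eventually_add hev
  rw [hS.interior_closure] at this
  rw [hS.isOpen.frontier_eq] at hxS
  exact hxS.2 this

/-- If a point of an element belongs to `∂Ω`, then so does the smallest subsimplex containing
it. -/
lemma mem_frontier_outer_of_bary {Ω : Set (Euc d)} (hΩ : IsLipschitzDomain Ω)
    (hS : IsLipschitzDomain S) (hSΩ : S ⊆ Ω) (hΓ : frontier Ω ⊆ frontier S)
    {T : 𝒯.elements} {x y : Euc d} (hx : x ∈ 𝒯.cell T) (hxS : x ∈ frontier S)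
    (hy : y ∈ 𝒯.cell T) (hxy : ∀ z ∈ (T : Finset (Euc d)), bary (T : Finset (Euc d)) z x = 0 →
      bary (T : Finset (Euc d)) z y = 0) : x ∈ frontier Ω ↔ y ∈ frontier Ω := by
  -- Along the segment every coordinate vanishing at x still vanishes, so it is a connected part of
  -- ∂S and cannot pass between Γ and Γᶜ.
  have hseg : segment ℝ x y ⊆ frontier S := by
    intro p hp
    have hpT : p ∈ 𝒯.cell T := (convex_convexHull ℝ _).segment_subset hx hy hp
    refine 𝒯.mem_frontier_of_bary hS hx hxS hpT fun z hz h => ?_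
    obtain ⟨t, -, rfl⟩ := (segment_eq_image' ℝ x y).subset hp
    rw [bary_lineMap, h, hxy z hz h]
    ring
  have hconn : IsPreconnected (segment ℝ x y) := (convex_segment x y).isPreconnected
  constructor
  · intro h
    exact hΩ.subset_frontier_of_preconnected hS hSΩ hΓ hconn hseg (left_mem_segment ℝ x y) h
      (right_mem_segment ℝ x y)
  · intro h
    exact hΩ.subset_frontier_of_preconnected hS hSΩ hΓ hconn hseg (right_mem_segment ℝ x y) h
      (left_mem_segment ℝ x y)

/-! ### Faces -/

/-- `(T, z)` and `(T', z')` describe the same face from two different elements. -/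
structure Shared (T : 𝒯.elements) (z : Euc d) (T' : 𝒯.elements) (z' : Euc d) : Prop where
  ne : T ≠ T'
  mem : z ∈ (T : Finset (Euc d))
  mem' : z' ∈ (T' : Finset (Euc d))
  diff_eq : ((T : Finset (Euc d)) : Set (Euc d)) \ {z} = ((T' : Finset (Euc d)) : Set (Euc d)) \ {z'}

variable {𝒯}

namespace Shared

variable {T T' : 𝒯.elements} {z z' : Euc d} (h : 𝒯.Shared T z T' z')
include h

lemma symm : 𝒯.Shared T' z' T z := ⟨h.ne.symm, h.mem', h.mem, h.diff_eq.symm⟩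

lemma face_eq : face (T : Finset (Euc d)) z = face (T' : Finset (Euc d)) z' := by
  rw [face, face, h.diff_eq]

lemma mem_right {a : Euc d} (ha : a ∈ (T : Finset (Euc d))) (haz : a ≠ z) :
    a ∈ (T' : Finset (Euc d)) ∧ a ≠ z' := by
  have : a ∈ ((T : Finset (Euc d)) : Set (Euc d)) \ {z} := ⟨ha, haz⟩
  rw [h.diff_eq] at this
  exact ⟨this.1, this.2⟩

lemma notMem : z ∉ (T' : Finset (Euc d)) := by
  intro hz
  apply h.ne
  apply Subtype.ext
  refine Finset.eq_of_subset_of_card_le (fun a ha => ?_) ?_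
  · by_cases haz : a = z
    · rw [haz]
      exact hz
    · exact (h.mem_right ha haz).1
  · rw [𝒯.card_eq T T.2, 𝒯.card_eq T' T'.2]

/-- Both coordinates are affine and vanish on the vertices of the common face, so they are
proportional. -/
lemma bary_eq_mul (x : Euc d) : bary (T' : Finset (Euc d)) z' x =
    bary (T' : Finset (Euc d)) z' z * bary (T : Finset (Euc d)) z x := by
  rw [(𝒯.isSimplex T).bary_eq_sum T' z' x, Finset.sum_eq_single_of_mem z h.mem, mul_comm]
  intro a ha haz
  have := h.mem_right ha haz
  rw [(𝒯.isSimplex T').bary_ne h.mem' this.1 this.2.symm, mul_zero]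

/-- The two elements lie on opposite sides of the face. Were the factor positive, a point slightly
moved from the face centre towards z would belong to both; but there λ_z > 0 in T, while z is not a
vertex of T', against `bary_eq_bary`. -/
lemma bary_neg (hd : 1 ≤ d) : bary (T' : Finset (Euc d)) z' z < 0 := by
  have h1 := h.bary_eq_mul z'
  rw [(𝒯.isSimplex T').bary_self h.mem'] at h1
  by_contra! h0
  have hpos : 0 < bary (T' : Finset (Euc d)) z' z :=
    h0.lt_of_ne' (fun h2 => by rw [h2, zero_mul] at h1; exact one_ne_zero h1)
  obtain ⟨x, hxF, hxz, hx⟩ := (𝒯.isSimplex T).exists_face_center hd h.mem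
  have hxT : x ∈ 𝒯.cell T := 𝒯.face_subset_cell T z hxF
  have hxT' : x ∈ 𝒯.cell T' := by
    rw [h.face_eq] at hxF
    exact 𝒯.face_subset_cell T' z' hxF
  have hev : ∀ᶠ t : ℝ in 𝓝 0, (∀ a ∈ (T' : Finset (Euc d)), a ≠ z' →
      0 < bary (T' : Finset (Euc d)) a (x + t • (z - x))) ∧ t < 1 := by
    refine Eventually.and ?_ (eventually_lt_nhds zero_lt_one)
    rw [Finset.eventually_all]
    intro a ha
    rw [eventually_imp_distrib_left]
    intro haz
    have ha' := h.symm.mem_right ha haz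
    have : 0 < bary (T' : Finset (Euc d)) a x := by
      rw [← 𝒯.bary_eq_bary hxT hxT']
      exact hx a ha'.1 ha'.2
    exact (IsLipschitzDomain.tendsto_add_smul x (z - x)).eventually
      ((continuous_bary _ a).continuousAt.eventually_const_lt this)
  obtain ⟨t, ht0, ht1, ht2⟩ := ((frequently_gt_nhds (0 : ℝ)).and_eventually hev).exists
  have hbz : bary (T : Finset (Euc d)) z (x + t • (z - x)) = t := by
    rw [bary_lineMap, hxz, (𝒯.isSimplex T).bary_self h.mem]
    ring
  have m1 : x + t • (z - x) ∈ 𝒯.cell T := by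
    rw [mem_cell_iff]
    intro a ha
    by_cases haz : a = z
    · rw [haz, hbz]
      exact ht0.le
    · rw [bary_lineMap, (𝒯.isSimplex T).bary_ne ha h.mem haz]
      nlinarith [hx a ha haz]
  have m2 : x + t • (z - x) ∈ 𝒯.cell T' := by
    rw [mem_cell_iff]
    intro a ha
    by_cases haz : a = z'
    · rw [haz, h.bary_eq_mul, hbz]
      positivity
    · exact (ht1 a ha haz).le
  have := 𝒯.bary_eq_bary m1 m2 z
  rw [hbz, bary_of_notMem h.notMem] at this
  exact ht0.ne' this

lemma bgrad_eq : bgrad (T' : Finset (Euc d)) z' =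
    bary (T' : Finset (Euc d)) z' z • bgrad (T : Finset (Euc d)) z := by
  refine ext_inner_right ℝ fun v => ?_
  have h1 := h.bary_eq_mul (0 + v)
  have h2 := h.bary_eq_mul 0
  rw [bary_add, bary_add] at h1
  rw [inner_smul_left]
  simp only [conj_trivial]
  linarith

lemma outerNormal_eq (hd : 1 ≤ d) :
    outerNormal (T' : Finset (Euc d)) z' = -outerNormal (T : Finset (Euc d)) z := by
  have hneg := h.bary_neg hd
  rw [(𝒯.isSimplex T').outerNormal_eq hd h.mem', (𝒯.isSimplex T).outerNormal_eq hd h.mem,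
    h.bgrad_eq, norm_smul, Real.norm_eq_abs, abs_of_neg hneg, smul_smul, neg_neg, ← neg_smul]
  congr 1
  have hn := hneg.ne
  rw [mul_inv, inv_neg]
  field_simp

/-- The face centre is interior to the union of the two elements: nearby, the other coordinates stay
positive and the sign of λ_z decides which element contains the point. -/
lemma not_subset_frontier (hd : 1 ≤ d) (hS : IsLipschitzDomain S) :
    ¬ face (T : Finset (Euc d)) z ⊆ frontier S := by
  intro hF
  obtain ⟨x, hxF, hxz, hx⟩ := (𝒯.isSimplex T).exists_face_center hd h.mem
  have hxT : x ∈ 𝒯.cell T := 𝒯.face_subset_cell T z hxF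
  have hxT' : x ∈ 𝒯.cell T' := by
    have := hxF
    rw [h.face_eq] at this
    exact 𝒯.face_subset_cell T' z' this
  have hev1 : ∀ᶠ v in 𝓝 (0 : Euc d), ∀ a ∈ (T : Finset (Euc d)), a ≠ z →
      0 < bary (T : Finset (Euc d)) a (x + v) := by
    rw [Finset.eventually_all]
    intro a ha
    rw [eventually_imp_distrib_left]
    intro haz
    exact (tendsto_add_nhds x).eventually
      ((continuous_bary _ a).continuousAt.eventually_const_lt (hx a ha haz))
  have hev2 : ∀ᶠ v in 𝓝 (0 : Euc d), ∀ a ∈ (T' : Finset (Euc d)), a ≠ z' →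
      0 < bary (T' : Finset (Euc d)) a (x + v) := by
    rw [Finset.eventually_all]
    intro a ha
    rw [eventually_imp_distrib_left]
    intro haz
    have ha' := h.symm.mem_right ha haz
    have : 0 < bary (T' : Finset (Euc d)) a x := by
      rw [← 𝒯.bary_eq_bary hxT hxT']
      exact hx a ha'.1 ha'.2
    exact (tendsto_add_nhds x).eventually
      ((continuous_bary _ a).continuousAt.eventually_const_lt this)
  have hintg : x ∈ interior (closure S) := by
    refine mem_interior_of_eventually_add ?_
    filter_upwards [hev1, hev2] with v h1 h2
    by_cases h0 : 0 ≤ bary (T : Finset (Euc d)) z (x + v)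
    · refine 𝒯.cell_subset T ((𝒯.mem_cell_iff T).2 fun a ha => ?_)
      by_cases haz : a = z
      · rwa [haz]
      · exact (h1 a ha haz).le
    · refine 𝒯.cell_subset T' ((𝒯.mem_cell_iff T').2 fun a ha => ?_)
      by_cases haz : a = z'
      · rw [haz, h.bary_eq_mul]
        exact mul_nonneg_of_nonpos_of_nonpos (h.bary_neg hd).le (not_le.1 h0).le
      · exact (h2 a ha haz).le
  rw [hS.interior_closure] at hintg
  have := hF hxF
  rw [hS.isOpen.frontier_eq] at this
  exact this.2 hintg

/-- A third element on the same face is excluded by signs: the proportionality factors multiply, but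
all three would be negative. -/
lemma unique (hd : 1 ≤ d) {T'' : 𝒯.elements} {z'' : Euc d} (h' : 𝒯.Shared T z T'' z'') :
    T'' = T' ∧ z'' = z' := by
  have hTT : T'' = T' := by
    by_contra hne
    have h3 : 𝒯.Shared T' z' T'' z'' :=
      ⟨Ne.symm hne, h.mem', h'.mem', h.diff_eq.symm.trans h'.diff_eq⟩
    have e1 := h3.bary_eq_mul z
    have n1 := h'.bary_neg hd
    have n2 := h.bary_neg hd
    have n3 := h3.bary_neg hd
    nlinarith
  refine ⟨hTT, ?_⟩
  subst hTT
  by_contra hne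
  have : z'' ∈ ((T'' : Finset (Euc d)) : Set (Euc d)) \ {z'} := ⟨h'.mem', hne⟩
  rw [← h.diff_eq, h'.diff_eq] at this
  exact this.2 rfl

end Shared

/-- A face which is not contained in the boundary is shared with another element. -/
lemma exists_shared (hd : 1 ≤ d) (hS : IsLipschitzDomain S) {T : 𝒯.elements} {z : Euc d}
    (hz : z ∈ (T : Finset (Euc d))) (hF : ¬ face (T : Finset (Euc d)) z ⊆ frontier S) :
    ∃ T' z', 𝒯.Shared T z T' z' := by
  classical
  obtain ⟨x, hxF, hxz, hx⟩ := (𝒯.isSimplex T).exists_face_center hd hz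
  have hxT : x ∈ 𝒯.cell T := 𝒯.face_subset_cell T z hxF
  have hxS : x ∈ S := by
    by_contra hxS
    have hxf : x ∈ frontier S := by
      rw [hS.isOpen.frontier_eq]
      exact ⟨𝒯.cell_subset T hxT, hxS⟩
    refine hF fun y hy => 𝒯.mem_frontier_of_bary hS hxT hxf (𝒯.face_subset_cell T z hy) ?_
    intro a ha h0
    have : a = z := by
      by_contra haz
      exact (hx a ha haz).ne' h0
    rw [this]
    exact (((𝒯.isSimplex T).mem_face_iff hz).1 hy).2
  -- Step from the face centre x away from z, that is with t < 0. The new point is still in S but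
  -- not in T; an element T' containing it also contains x, hence all vertices of the face.
  have hev : ∀ᶠ t : ℝ in 𝓝 0, x + t • (z - x) ∈ S ∧
      ∀ T, x + t • (z - x) ∈ 𝒯.cell T → x ∈ 𝒯.cell T :=
    (IsLipschitzDomain.tendsto_add_smul x (z - x)).eventually
      ((hS.isOpen.eventually_mem hxS).and (𝒯.eventually_mem_cell x))
  obtain ⟨t, ht0, ht1, ht2⟩ := ((frequently_lt_nhds (0 : ℝ)).and_eventually hev).exists
  obtain ⟨T', hT'⟩ := 𝒯.exists_mem_cell (subset_closure ht1)
  have hxT' := ht2 T' hT'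
  have hne : T ≠ T' := by
    rintro rfl
    have := (𝒯.mem_cell_iff T).1 hT' z hz
    rw [bary_lineMap, hxz, (𝒯.isSimplex T).bary_self hz] at this
    linarith
  have hsub : (T : Finset (Euc d)).erase z ⊆ T' := by
    intro a ha
    rw [Finset.mem_erase] at ha
    exact 𝒯.mem_of_bary_ne_zero hxT hxT' (hx a ha.2 ha.1).ne'
  have hcard : ((T' : Finset (Euc d)) \ (T : Finset (Euc d)).erase z).card = 1 := by
    rw [Finset.card_sdiff_of_subset hsub, Finset.card_erase_of_mem hz, 𝒯.card_eq T T.2,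
      𝒯.card_eq T' T'.2]
    omega
  obtain ⟨z', hz'⟩ := Finset.card_eq_one.1 hcard
  have hz'm : z' ∈ (T' : Finset (Euc d)) \ (T : Finset (Euc d)).erase z := by
    rw [hz']
    exact Finset.mem_singleton_self _
  rw [Finset.mem_sdiff] at hz'm
  refine ⟨T', z', hne, hz, hz'm.1, ?_⟩
  ext a
  simp only [Set.mem_sdiff, SetLike.mem_coe, mem_singleton_iff]
  constructor
  · rintro ⟨h1, h2⟩
    have h3 : a ∈ (T : Finset (Euc d)).erase z := Finset.mem_erase.2 ⟨h2, h1⟩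
    exact ⟨hsub h3, fun h => hz'm.2 (h ▸ h3)⟩
  · rintro ⟨h1, h2⟩
    by_contra h3
    have h4 : a ∈ (T' : Finset (Euc d)) \ (T : Finset (Euc d)).erase z := by
      rw [Finset.mem_sdiff, Finset.mem_erase]
      exact ⟨h1, fun h => h3 ⟨h.2, h.1⟩⟩
    rw [hz', Finset.mem_singleton] at h4
    exact h2 h4

open Classical in
/-- In a sum over all faces of all elements, the contributions of interior faces cancel if they
have opposite signs. -/
lemma sum_faces_eq (hd : 1 ≤ d) (hS : IsLipschitzDomain S) (I : 𝒯.elements → Euc d → ℝ)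
    (hI : ∀ T z T' z', 𝒯.Shared T z T' z' → I T z + I T' z' = 0) :
    ∑ T : 𝒯.elements, ∑ z ∈ (T : Finset (Euc d)), I T z =
      ∑ T : 𝒯.elements, ∑ z ∈ (T : Finset (Euc d)),
        if face (T : Finset (Euc d)) z ⊆ frontier S then I T z else 0 := by
  rw [Finset.sum_sigma', Finset.sum_sigma', ← Finset.sum_filter,
    ← Finset.sum_filter_add_sum_filter_not _
      (fun q : (_ : 𝒯.elements) × Euc d => face (q.1 : Finset (Euc d)) q.2 ⊆ frontier S), add_eq_left]
  have hex : ∀ q ∈ Finset.filter (fun q : (_ : 𝒯.elements) × Euc d =>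
      ¬ face (q.1 : Finset (Euc d)) q.2 ⊆ frontier S)
      (Finset.univ.sigma fun T : 𝒯.elements => (T : Finset (Euc d))),
      ∃ r : (_ : 𝒯.elements) × Euc d, 𝒯.Shared q.1 q.2 r.1 r.2 := by
    intro q hq
    rw [Finset.mem_filter, Finset.mem_sigma] at hq
    obtain ⟨T', z', h⟩ := exists_shared hd hS hq.1.2 hq.2
    exact ⟨⟨T', z'⟩, h⟩
  choose! p hp using hex
  -- Passing to the other side of an interior face is an involution without fixed points.
  refine Finset.sum_involution (fun q _ => p q) ?_ ?_ ?_ ?_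
  · exact fun q hq => hI _ _ _ _ (hp q hq)
  · intro q hq _ h
    exact (hp q hq).ne (by rw [h])
  · intro q hq
    rw [Finset.mem_filter, Finset.mem_sigma]
    exact ⟨⟨Finset.mem_univ _, (hp q hq).mem'⟩, (hp q hq).symm.not_subset_frontier hd hS⟩
  · intro q hq
    have hq' : p q ∈ Finset.filter (fun q : (_ : 𝒯.elements) × Euc d =>
        ¬ face (q.1 : Finset (Euc d)) q.2 ⊆ frontier S)
        (Finset.univ.sigma fun T : 𝒯.elements => (T : Finset (Euc d))) := by
      rw [Finset.mem_filter, Finset.mem_sigma]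
      exact ⟨⟨Finset.mem_univ _, (hp q hq).mem'⟩, (hp q hq).symm.not_subset_frontier hd hS⟩
    have := (hp q hq).symm.unique hd (hp _ hq')
    exact Sigma.ext this.1 (heq_of_eq this.2)

end Triangulation

/-! ### Null sets -/

/-- Fewer than d points span an affine subspace of dimension at most d - 2. -/
lemma hausdorff_convexHull_eq_zero {A : Finset (Euc d)} (hA : A.card + 1 ≤ d) :
    Measure.euclideanHausdorffMeasure (d - 1) (convexHull ℝ (A : Set (Euc d))) = 0 := by
  rcases A.eq_empty_or_nonempty with rfl | ⟨a, ha⟩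
  · simp
  set V := vectorSpan ℝ (A : Set (Euc d))
  have hV : Module.finrank ℝ V + 1 ≤ A.card := by
    obtain ⟨k, hk⟩ : ∃ k, A.card = k + 1 :=
      ⟨A.card - 1, by have := Finset.card_pos.2 ⟨a, ha⟩; omega⟩
    have := finrank_vectorSpan_image_finset_le ℝ (id : Euc d → Euc d) A hk
    rw [Finset.image_id] at this
    rw [hk]
    exact Nat.succ_le_succ this
  have hsub : convexHull ℝ (A : Set (Euc d)) ⊆ range fun v : V => a + (v : Euc d) := by
    intro x hx
    have hx' := convexHull_subset_affineSpan (A : Set (Euc d)) hx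
    have : x - a ∈ V := by
      rw [← vsub_eq_sub]
      exact vsub_mem_vectorSpan_of_mem_affineSpan_of_mem_affineSpan hx'
        (subset_affineSpan ℝ _ ha)
    exact ⟨⟨x - a, this⟩, by simp⟩
  have hdim : dimH (range fun v : V => a + (v : Euc d)) < ((d - 1 : ℕ) : NNReal) := by
    have hc : ContDiff ℝ 1 fun v : V => a + (v : Euc d) :=
      contDiff_const.add V.subtypeL.contDiff
    refine hc.dimH_range_le.trans_lt ?_
    have : Module.finrank ℝ V < d - 1 := by omega
    exact_mod_cast this
  have h0 := hausdorffMeasure_of_dimH_lt hdim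
  rw [NNReal.coe_natCast] at h0
  rw [Measure.euclideanHausdorffMeasure_def, Measure.smul_apply]
  rw [measure_mono_null hsub h0, smul_zero]

namespace Triangulation

variable {S : Set (Euc d)} (𝒯 : Triangulation S)

lemma ae_mem_interior_cell (T : 𝒯.elements) :
    ∀ᵐ x : Euc d, x ∈ 𝒯.cell T → x ∈ interior (𝒯.cell T) := by
  have h : volume (frontier (𝒯.cell T)) = 0 := (convex_convexHull ℝ _).addHaar_frontier volume
  filter_upwards [measure_eq_zero_iff_ae_notMem.1 h] with x hx hxT
  by_contra hxi
  exact hx ⟨subset_closure hxT, hxi⟩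

include 𝒯 in
lemma ae_mem_of_mem_closure (hS : IsLipschitzDomain S) : ∀ᵐ x : Euc d, x ∈ closure S → x ∈ S := by
  filter_upwards [ae_all_iff.2 𝒯.ae_mem_interior_cell] with x hx hxS
  obtain ⟨T, hT⟩ := 𝒯.exists_mem_cell hxS
  exact 𝒯.interior_cell_subset hS T (hx T hT)

lemma eq_of_mem_interior {T T' : 𝒯.elements} {x : Euc d} (hx : x ∈ interior (𝒯.cell T))
    (hx' : x ∈ 𝒯.cell T') : T = T' := by
  apply Subtype.ext
  refine Finset.eq_of_subset_of_card_le (fun z hz => ?_)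
    (by rw [𝒯.card_eq T T.2, 𝒯.card_eq T' T'.2])
  exact 𝒯.mem_of_bary_ne_zero (interior_subset hx) hx'
    ((𝒯.isSimplex T).mem_interior_hull_iff.1 hx z hz).ne'

lemma ae_disjoint_cell {T T' : 𝒯.elements} (h : T ≠ T') :
    AEDisjoint volume (𝒯.cell T) (𝒯.cell T') := by
  rw [AEDisjoint, measure_eq_zero_iff_ae_notMem]
  filter_upwards [𝒯.ae_mem_interior_cell T] with x hx hx'
  exact h (𝒯.eq_of_mem_interior (hx hx'.1) hx'.2)

lemma closure_eq_iUnion : closure S = ⋃ T, 𝒯.cell T :=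
  Subset.antisymm (fun _ hx => mem_iUnion.2 (𝒯.exists_mem_cell hx))
    (iUnion_subset fun T => 𝒯.cell_subset T)

include 𝒯 in
lemma closure_ae_eq (hS : IsLipschitzDomain S) : closure S =ᵐ[volume] S := by
  filter_upwards [𝒯.ae_mem_of_mem_closure hS] with x hx
  exact propext ⟨hx, fun h => subset_closure h⟩

include 𝒯 in
lemma integrableOn_closure (hS : IsLipschitzDomain S) {g : Euc d → ℝ}
    (hg : IntegrableOn g S) : IntegrableOn g (closure S) :=
  hg.congr_set_ae (𝒯.closure_ae_eq hS)

lemma sum_integral_cell (hS : IsLipschitzDomain S) {g : Euc d → ℝ} (hg : IntegrableOn g S) :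
    ∑ T, ∫ x in 𝒯.cell T, g x = ∫ x in S, g x := by
  rw [← setIntegral_congr_set (𝒯.closure_ae_eq hS), 𝒯.closure_eq_iUnion,
    integral_iUnion_ae (fun T => (𝒯.isCompact_cell T).measurableSet.nullMeasurableSet)
      (fun T T' h => 𝒯.ae_disjoint_cell h), tsum_fintype]
  rw [← 𝒯.closure_eq_iUnion]
  exact 𝒯.integrableOn_closure hS hg

/-! ### The surface measure -/

section Surface

variable {Ω : Set (Euc d)}

lemma face_subset_or_disjoint (hΩ : IsLipschitzDomain Ω) (hS : IsLipschitzDomain S) (hSΩ : S ⊆ Ω)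
    (hΓ : frontier Ω ⊆ frontier S) {T : 𝒯.elements} {z : Euc d}
    (hF : face (T : Finset (Euc d)) z ⊆ frontier S) :
    face (T : Finset (Euc d)) z ⊆ frontier Ω ∨
      face (T : Finset (Euc d)) z ⊆ frontier S \ frontier Ω := by
  by_cases h : ∃ x ∈ face (T : Finset (Euc d)) z, x ∈ frontier Ω
  · obtain ⟨x, hx, hxΩ⟩ := h
    exact Or.inl (hΩ.subset_frontier_of_preconnected hS hSΩ hΓ
      (convex_convexHull ℝ _).isPreconnected hF hx hxΩ)
  · push Not at h
    exact Or.inr fun x hx => ⟨hF hx, h x hx⟩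

/-- Almost every boundary point lies on a boundary face. -/
lemma ae_exists_face (hΩ : IsLipschitzDomain Ω) (hS : IsLipschitzDomain S)
    (hSΩ : S ⊆ Ω) (hΓ : frontier Ω ⊆ frontier S) :
    ∀ᵐ x ∂(surf Ω), ∃ T : 𝒯.elements, ∃ z ∈ (T : Finset (Euc d)),
      face (T : Finset (Euc d)) z ⊆ frontier Ω ∧ x ∈ face (T : Finset (Euc d)) z := by
  classical
  have hnull : ∀ᵐ x ∂(surf Ω), ∀ T : 𝒯.elements, ∀ A ∈ (T : Finset (Euc d)).powerset,
      A.card + 1 ≤ d → x ∉ convexHull ℝ (A : Set (Euc d)) := by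
    rw [ae_all_iff]
    intro T
    rw [Finset.eventually_all]
    intro A _
    rw [eventually_imp_distrib_left]
    intro hA
    exact measure_eq_zero_iff_ae_notMem.1
      (Measure.restrict_le_self.absolutelyContinuous (hausdorff_convexHull_eq_zero hA))
  have hmem : ∀ᵐ x ∂(surf Ω), x ∈ frontier Ω := ae_restrict_mem isClosed_frontier.measurableSet
  filter_upwards [hnull, hmem] with x hx hxΩ
  obtain ⟨T, hT⟩ := 𝒯.exists_mem_cell (frontier_subset_closure (hΓ hxΩ))
  have hsimp := 𝒯.isSimplex T
  -- The active vertices of x. Fewer than d of them occur only on a null set, and all d + 1 would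
  -- make x interior to the cell; so there are exactly d, and they span a face, which lies in Γ
  -- because x does.
  set A := (T : Finset (Euc d)).filter fun z => bary (T : Finset (Euc d)) z x ≠ 0
  have hAT : A ⊆ (T : Finset (Euc d)) := Finset.filter_subset _ _
  have hxA : x ∈ convexHull ℝ (A : Set (Euc d)) := by
    refine (hsimp.mem_subhull_iff (by exact_mod_cast hAT)).2 ⟨hsimp.mem_hull_iff.1 hT, ?_⟩
    intro z hz hzA
    by_contra h
    exact hzA (Finset.mem_coe.2 (Finset.mem_filter.2 ⟨hz, h⟩))
  have hcard : d ≤ A.card := by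
    by_contra h
    exact hx T A (Finset.mem_powerset.2 hAT) (by omega) hxA
  have hne : A ≠ T := by
    intro hA
    have : x ∈ interior (𝒯.cell T) := by
      refine hsimp.mem_interior_hull_iff.2 fun z hz => ?_
      refine (hsimp.mem_hull_iff.1 hT z hz).lt_of_ne' ?_
      rw [← hA] at hz
      exact (Finset.mem_filter.1 hz).2
    have h1 := 𝒯.interior_cell_subset hS T this
    have h2 := hΓ hxΩ
    rw [hS.isOpen.frontier_eq] at h2
    exact h2.2 h1
  obtain ⟨z, hz, hzA⟩ : ∃ z ∈ (T : Finset (Euc d)), z ∉ A := by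
    by_contra! h
    exact hne (Finset.Subset.antisymm hAT h)
  have hAe : A = (T : Finset (Euc d)).erase z := by
    refine Finset.eq_of_subset_of_card_le (fun a ha => ?_) ?_
    · exact Finset.mem_erase.2 ⟨fun h => hzA (h ▸ ha), hAT ha⟩
    · rw [Finset.card_erase_of_mem hz, hsimp.card_eq]
      omega
  have hxF : x ∈ face (T : Finset (Euc d)) z := by
    rw [face]
    rw [hAe] at hxA
    simpa using hxA
  refine ⟨T, z, hz, ?_, hxF⟩
  intro y hy
  refine (𝒯.mem_frontier_outer_of_bary hΩ hS hSΩ hΓ hT (hΓ hxΩ) (𝒯.face_subset_cell T z hy)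
    fun a ha h0 => ?_).1 hxΩ
  have : a = z := by
    by_contra h
    have : a ∈ A := by
      rw [hAe]
      exact Finset.mem_erase.2 ⟨h, ha⟩
    exact (Finset.mem_filter.1 this).2 h0
  rw [this]
  exact ((hsimp.mem_face_iff hz).1 hy).2

lemma surf_lt_top (hd : 1 ≤ d) (hΩ : IsLipschitzDomain Ω) (hS : IsLipschitzDomain S)
    (𝒯 : Triangulation S) (hSΩ : S ⊆ Ω) (hΓ : frontier Ω ⊆ frontier S) : surf Ω univ < ⊤ := by
  have hsub : univ ≤ᵐ[surf Ω] ⋃ T : 𝒯.elements, ⋃ z ∈ (T : Finset (Euc d)),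
      face (T : Finset (Euc d)) z := by
    filter_upwards [𝒯.ae_exists_face hΩ hS hSΩ hΓ] with x ⟨T, z, hz, _, hx⟩ _
    exact mem_iUnion.2 ⟨T, mem_biUnion hz hx⟩
  refine (measure_mono_ae hsub).trans_lt ?_
  refine (measure_iUnion_fintype_le _ _).trans_lt ?_
  refine ENNReal.sum_lt_top.2 fun T _ => ?_
  refine (measure_biUnion_finset_le _ _).trans_lt ?_
  refine ENNReal.sum_lt_top.2 fun z hz => ?_
  exact (Measure.restrict_le_self _).trans_lt ((𝒯.isSimplex T).measure_face_lt_top hd hz)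

lemma isFiniteMeasure_surf (hd : 1 ≤ d) (hΩ : IsLipschitzDomain Ω) (hS : IsLipschitzDomain S)
    (𝒯 : Triangulation S) (hSΩ : S ⊆ Ω) (hΓ : frontier Ω ⊆ frontier S) :
    IsFiniteMeasure (surf Ω) :=
  ⟨surf_lt_top hd hΩ hS 𝒯 hSΩ hΓ⟩

/-- A boundary face either lies in Γ, where the two measures agree, or misses Γ, and then the
integrand vanishes on it. -/
lemma integral_face_indicator (hΩ : IsLipschitzDomain Ω)
    (hS : IsLipschitzDomain S) (hSΩ : S ⊆ Ω) (hΓ : frontier Ω ⊆ frontier S)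
    {T : 𝒯.elements} {z : Euc d}
    (hF : face (T : Finset (Euc d)) z ⊆ frontier S) {N : Euc d → ℝ}
    (hN : ∀ x ∈ face (T : Finset (Euc d)) z ∩ (frontier S \ frontier Ω), N x = 0) :
    ∫ x in face (T : Finset (Euc d)) z, N x ∂(Measure.euclideanHausdorffMeasure (d - 1)) =
      ∫ x, (face (T : Finset (Euc d)) z).indicator N x ∂(surf Ω) := by
  have hm : MeasurableSet (face (T : Finset (Euc d)) z) :=
    (IsSimplex.isCompact_face _ z).measurableSet
  rw [integral_indicator hm, surf, Measure.restrict_restrict hm]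
  rcases 𝒯.face_subset_or_disjoint hΩ hS hSΩ hΓ hF with h | h
  · rw [inter_eq_self_of_subset_left h]
  · have e : face (T : Finset (Euc d)) z ∩ frontier Ω = ∅ := by
      ext x
      simp only [mem_inter_iff, mem_empty_iff_false, iff_false, not_and]
      exact fun hx => (h hx).2
    rw [e, Measure.restrict_empty, integral_zero_measure]
    exact setIntegral_eq_zero_of_forall_eq_zero fun x hx => hN x ⟨hx, h hx⟩

open Classical in
/-- Green's formula on the triangulated set `S` for piecewise `C¹` fields whose normal component
does not jump and vanishes on `∂S \ ∂Ω`. -/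
lemma green (hd : 1 ≤ d) (hΩ : IsLipschitzDomain Ω) (hS : IsLipschitzDomain S)
    (hSΩ : S ⊆ Ω) (hΓ : frontier Ω ⊆ frontier S)
    {F : 𝒯.elements → Fin d → Euc d → ℝ} (hF : ∀ T i, ContDiff ℝ 1 (F T i))
    (hjump : ∀ T z T' z', 𝒯.Shared T z T' z' → ∀ x ∈ face (T : Finset (Euc d)) z,
      inner ℝ (outerNormal (T : Finset (Euc d)) z) (WithLp.toLp 2 fun i => F T i x) =
      inner ℝ (outerNormal (T : Finset (Euc d)) z) (WithLp.toLp 2 fun i => F T' i x))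
    (hzero : ∀ T : 𝒯.elements, ∀ z ∈ (T : Finset (Euc d)),
      face (T : Finset (Euc d)) z ⊆ frontier S →
      ∀ x ∈ face (T : Finset (Euc d)) z ∩ (frontier S \ frontier Ω),
        inner ℝ (outerNormal (T : Finset (Euc d)) z) (WithLp.toLp 2 fun i => F T i x) = 0) :
    ∑ T, ∫ x in 𝒯.cell T, ∑ i, fderiv ℝ (F T i) x (EuclideanSpace.single i 1) =
      ∫ x, (∑ T : 𝒯.elements, ∑ z ∈ (T : Finset (Euc d)),
        if face (T : Finset (Euc d)) z ⊆ frontier S ∧ x ∈ face (T : Finset (Euc d)) z then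
          inner ℝ (outerNormal (T : Finset (Euc d)) z) (WithLp.toLp 2 fun i => F T i x)
        else 0) ∂(surf Ω) := by
  set N : 𝒯.elements → Euc d → Euc d → ℝ := fun T z x =>
    inner ℝ (outerNormal (T : Finset (Euc d)) z) (WithLp.toLp 2 fun i => F T i x)
  have hNc : ∀ T z, Continuous (N T z) := by
    intro T z
    refine continuous_const.inner ?_
    exact (PiLp.continuous_toLp 2 _).comp (continuous_pi fun i => (hF T i).continuous)
  have h1 : ∑ T, ∫ x in 𝒯.cell T, ∑ i, fderiv ℝ (F T i) x (EuclideanSpace.single i 1) =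
      ∑ T : 𝒯.elements, ∑ z ∈ (T : Finset (Euc d)), ∫ x in face (T : Finset (Euc d)) z, N T z x
        ∂(Measure.euclideanHausdorffMeasure (d - 1)) :=
    Finset.sum_congr rfl fun T _ => (𝒯.isSimplex T).integral_divergence hd (hF T)
  rw [h1, sum_faces_eq hd hS]
  · have hintg : ∀ T : 𝒯.elements, ∀ z ∈ (T : Finset (Euc d)), Integrable (fun x =>
        if face (T : Finset (Euc d)) z ⊆ frontier S ∧ x ∈ face (T : Finset (Euc d)) z then
          N T z x else 0) (surf Ω) := by
      intro T z hz
      by_cases hb : face (T : Finset (Euc d)) z ⊆ frontier S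
      · simp only [hb, true_and]
        have hm : MeasurableSet (face (T : Finset (Euc d)) z) :=
          (IsSimplex.isCompact_face _ z).measurableSet
        have := (integrable_indicator_iff hm).2
          ((𝒯.isSimplex T).integrableOn_face hd hz (hNc T z))
        exact this.mono_measure Measure.restrict_le_self
      · simp [hb]
    rw [integral_finsetSum _ fun T _ => integrable_finsetSum _ fun z hz => hintg T z hz]
    refine Finset.sum_congr rfl fun T _ => ?_
    rw [integral_finsetSum _ fun z hz => hintg T z hz]
    refine Finset.sum_congr rfl fun z hz => ?_
    by_cases hb : face (T : Finset (Euc d)) z ⊆ frontier S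
    · simp only [hb, true_and, if_true]
      exact 𝒯.integral_face_indicator hΩ hS hSΩ hΓ hb (hzero T z hz hb)
    · simp [hb]
  · intro T z T' z' h
    rw [← h.face_eq, ← integral_add]
    · refine setIntegral_eq_zero_of_forall_eq_zero fun x hx => ?_
      simp only [N]
      rw [h.outerNormal_eq hd, inner_neg_left, hjump T z T' z' h x hx, add_neg_cancel]
    · exact (𝒯.isSimplex T).integrableOn_face hd h.mem (hNc T z)
    · rw [h.face_eq]
      exact (𝒯.isSimplex T').integrableOn_face hd h.mem' (hNc T' z')

end Surface

end Triangulation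

/-! ### Polynomials as functions -/

@[simp] lemma pval_add (P Q : Poly d) (x : Euc d) : pval (P + Q) x = pval P x + pval Q x := by
  simp [pval]

@[simp] lemma pval_sub (P Q : Poly d) (x : Euc d) : pval (P - Q) x = pval P x - pval Q x := by
  simp [pval]

@[simp] lemma pval_mul (P Q : Poly d) (x : Euc d) : pval (P * Q) x = pval P x * pval Q x := by
  simp [pval]

@[simp] lemma pval_smul (c : ℝ) (P : Poly d) (x : Euc d) : pval (c • P) x = c * pval P x := by
  simp [pval]

@[simp] lemma pval_C (c : ℝ) (x : Euc d) : pval (MvPolynomial.C c : Poly d) x = c := by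
  simp [pval]

@[simp] lemma pval_X (i : Fin d) (x : Euc d) : pval (MvPolynomial.X i : Poly d) x = x i := by
  simp [pval]

@[simp] lemma pval_one (x : Euc d) : pval (1 : Poly d) x = 1 := by
  simp [pval]

@[simp] lemma pval_zero (x : Euc d) : pval (0 : Poly d) x = 0 := by
  simp [pval]

lemma pval_sum {ι : Type*} (s : Finset ι) (P : ι → Poly d) (x : Euc d) :
    pval (∑ i ∈ s, P i) x = ∑ i ∈ s, pval (P i) x := by
  simp [pval]

lemma pval_prod {ι : Type*} (s : Finset ι) (P : ι → Poly d) (x : Euc d) :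
    pval (∏ i ∈ s, P i) x = ∏ i ∈ s, pval (P i) x := by
  simp [pval]

@[simp] lemma pval_pow (P : Poly d) (n : ℕ) (x : Euc d) : pval (P ^ n) x = pval P x ^ n := by
  simp [pval]

@[simp] lemma vval_apply (σ : Fin d → Poly d) (x : Euc d) (i : Fin d) :
    vval σ x i = pval (σ i) x := rfl

@[simp] lemma vval_add (σ τ : Fin d → Poly d) (x : Euc d) :
    vval (σ + τ) x = vval σ x + vval τ x := by
  ext i
  simp

@[simp] lemma vval_smul (c : ℝ) (σ : Fin d → Poly d) (x : Euc d) :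
    vval (c • σ) x = c • vval σ x := by
  ext i
  simp

@[simp] lemma vval_zero (x : Euc d) : vval (0 : Fin d → Poly d) x = 0 := by
  ext i
  simp

lemma contDiff_pval (P : Poly d) : ContDiff ℝ ∞ (pval P) := by
  induction P using MvPolynomial.induction_on with
  | C a =>
    have : pval (MvPolynomial.C a : Poly d) = fun _ => a := by ext; simp
    rw [this]
    exact contDiff_const
  | add P Q hP hQ =>
    have : pval (P + Q) = fun x => pval P x + pval Q x := by ext; simp
    rw [this]
    exact hP.add hQ
  | mul_X P i hP =>
    have : pval (P * MvPolynomial.X i) = fun x => pval P x * x i := by ext; simp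
    rw [this]
    exact hP.mul (EuclideanSpace.proj (𝕜 := ℝ) i).contDiff

lemma continuous_pval (P : Poly d) : Continuous (pval P) := (contDiff_pval P).continuous

lemma differentiable_pval (P : Poly d) : Differentiable ℝ (pval P) :=
  (contDiff_pval P).differentiable (by simp)

lemma continuous_vval (σ : Fin d → Poly d) : Continuous (vval σ) :=
  (PiLp.continuous_toLp 2 _).comp (continuous_pi fun i => continuous_pval (σ i))

lemma fderiv_pval (P : Poly d) (x v : Euc d) :
    fderiv ℝ (pval P) x v = inner ℝ (vval (pgrad P) x) v := by
  have key : fderiv ℝ (pval P) x v = ∑ i, pval (MvPolynomial.pderiv i P) x * v i := by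
    induction P using MvPolynomial.induction_on with
    | C a =>
      have : pval (MvPolynomial.C a : Poly d) = fun _ => a := by ext; simp
      rw [this]
      simp
    | add P Q hP hQ =>
      have : pval (P + Q) = fun x => pval P x + pval Q x := by ext; simp
      rw [this, fderiv_fun_add (differentiable_pval P x) (differentiable_pval Q x)]
      simp [hP, hQ, add_mul, Finset.sum_add_distrib]
    | mul_X P i hP =>
      have : pval (P * MvPolynomial.X i) = fun x => pval P x * EuclideanSpace.proj (𝕜 := ℝ) i x := by
        ext; simp
      rw [this, fderiv_fun_mul (differentiable_pval P x)
        (EuclideanSpace.proj (𝕜 := ℝ) i).differentiableAt]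
      simp only [ContinuousLinearMap.fderiv, add_apply, smul_apply, hP, Derivation.leibniz,
        smul_eq_mul, MvPolynomial.pderiv_X, pval_add, pval_mul, pval_X, add_mul,
        Finset.sum_add_distrib]
      congr 1
      · rw [Finset.sum_eq_single i]
        · simp
        · intro j _ hj
          simp [hj.symm]
        · simp
      · simp only [PiLp.proj_apply, Finset.mul_sum]
        exact Finset.sum_congr rfl fun j _ => by ring
  rw [key, PiLp.inner_apply]
  simp [pgrad, mul_comm]

lemma fderiv_pval_single (P : Poly d) (x : Euc d) (i : Fin d) :
    fderiv ℝ (pval P) x (EuclideanSpace.single i 1) = pval (MvPolynomial.pderiv i P) x := by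
  rw [fderiv_pval]
  simp [EuclideanSpace.inner_single_right, pgrad]

/-- A polynomial which vanishes on a nonempty open set is zero. -/
lemma poly_eq_zero_of_isOpen {P : Poly d} {U : Set (Euc d)} (hU : IsOpen U) (hne : U.Nonempty)
    (h : ∀ x ∈ U, pval P x = 0) : P = 0 := by
  obtain ⟨x, hx⟩ := hne
  have hV : IsOpen ((WithLp.toLp 2 : (Fin d → ℝ) → Euc d) ⁻¹' U) :=
    hU.preimage (PiLp.continuous_toLp 2 _)
  have hxV : (WithLp.ofLp x : Fin d → ℝ) ∈ (WithLp.toLp 2 : (Fin d → ℝ) → Euc d) ⁻¹' U := by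
    simpa using hx
  obtain ⟨ε, hε, hball⟩ := Metric.isOpen_iff.1 hV _ hxV
  refine MvPolynomial.funext_set (fun i => Metric.ball (x i) ε)
    (fun i => ?_) fun y hy => ?_
  · exact infinite_of_mem_nhds _ (Metric.ball_mem_nhds _ hε)
  · rw [map_zero]
    refine h (WithLp.toLp 2 y) (hball ?_)
    rw [Metric.mem_ball, dist_pi_lt_iff hε]
    exact fun i => hy i (mem_univ i)

/-- A monomial either does not contain the variable and is killed, or loses one degree. For q = 0
the truncated bound 0 is correct, as the derivative vanishes. -/
lemma totalDegree_pderiv_le {q : ℕ} {P : Poly d} (hP : P.totalDegree ≤ q) (i : Fin d) :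
    (MvPolynomial.pderiv i P).totalDegree ≤ q - 1 := by
  conv_lhs => rw [P.as_sum, map_sum]
  refine (MvPolynomial.totalDegree_finsetSum _ _).trans (Finset.sup_le fun s hs => ?_)
  rw [MvPolynomial.pderiv_monomial]
  by_cases h : s i = 0
  · simp [h]
  · have h0 := MvPolynomial.totalDegree_monomial_le (s - Finsupp.single i 1)
      (MvPolynomial.coeff s P * (s i : ℝ))
    have h1 : (s.sum fun _ e => e) ≤ q := (MvPolynomial.le_totalDegree hs).trans hP
    have h2 : s = (s - Finsupp.single i 1) + Finsupp.single i 1 := by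
      ext j
      by_cases hj : i = j
      · subst hj
        simp
        omega
      · simp [hj]
    rw [h2, Finsupp.sum_add_index' (by simp) (by simp), Finsupp.sum_single_index rfl] at h1
    refine h0.trans (Nat.le_sub_of_add_le h1)

lemma eq_C_of_pgrad_eq_zero {P : Poly d} (h : ∀ i, MvPolynomial.pderiv i P = 0) :
    ∃ c, P = MvPolynomial.C c := by
  refine ⟨pval P 0, MvPolynomial.funext fun x => ?_⟩
  have hz : ∀ x, fderiv ℝ (pval P) x = 0 := fun x => by
    ext v
    rw [fderiv_pval, PiLp.inner_apply]
    simp [pgrad, h]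
  have := is_const_of_fderiv_eq_zero (differentiable_pval P) hz (WithLp.toLp 2 x) 0
  simpa [pval] using this

/-- The barycentric coordinate as a polynomial. -/
def baryPoly (T : Finset (Euc d)) (z : Euc d) : Poly d :=
  MvPolynomial.C (bary T z 0) + ∑ i, MvPolynomial.C (bgrad T z i) * MvPolynomial.X i

@[simp] lemma pval_baryPoly (T : Finset (Euc d)) (z x : Euc d) :
    pval (baryPoly T z) x = bary T z x := by
  have := bary_add T z 0 x
  rw [zero_add] at this
  rw [this, PiLp.inner_apply, baryPoly, pval_add, pval_sum]
  simp [mul_comm]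

lemma totalDegree_baryPoly_le (T : Finset (Euc d)) (z : Euc d) :
    (baryPoly T z).totalDegree ≤ 1 := by
  refine (MvPolynomial.totalDegree_add _ _).trans (max_le (by simp) ?_)
  refine (MvPolynomial.totalDegree_finsetSum _ _).trans (Finset.sup_le fun i _ => ?_)
  refine (MvPolynomial.totalDegree_mul _ _).trans ?_
  simp

namespace Triangulation

variable {S : Set (Euc d)} (𝒯 : Triangulation S)

/-! ### The bilinear forms -/

lemma integrableOn_cell (T : 𝒯.elements) {g : Euc d → ℝ} (hg : Continuous g) :
    IntegrableOn g (𝒯.cell T) :=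
  hg.continuousOn.integrableOn_compact (𝒯.isCompact_cell T)

lemma interior_cell_nonempty (T : 𝒯.elements) : (interior (𝒯.cell T)).Nonempty := by
  obtain ⟨x, hx⟩ := (𝒯.isSimplex T).exists_center
  exact ⟨x, (𝒯.isSimplex T).mem_interior_hull_iff.2 hx⟩

lemma cell_subset_closure_interior (T : 𝒯.elements) : 𝒯.cell T ⊆ closure (interior (𝒯.cell T)) := by
  have h : Convex ℝ (𝒯.cell T) := convex_convexHull ℝ _
  rw [h.closure_interior_eq_closure_of_nonempty_interior (𝒯.interior_cell_nonempty T)]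
  exact subset_closure

lemma eq_zero_of_integral_cell_eq_zero (T : 𝒯.elements) {g : Euc d → ℝ} (hg : Continuous g)
    (h0 : ∀ x ∈ 𝒯.cell T, 0 ≤ g x) (h : ∫ x in 𝒯.cell T, g x = 0) :
    ∀ x ∈ interior (𝒯.cell T), g x = 0 := by
  have hm : MeasurableSet (𝒯.cell T) := (𝒯.isCompact_cell T).measurableSet
  have h1 := (setIntegral_eq_zero_iff_of_nonneg_ae
    ((ae_restrict_iff' hm).2 (Eventually.of_forall h0)) (𝒯.integrableOn_cell T hg)).1 h
  have h2 : g =ᵐ[volume.restrict (interior (𝒯.cell T))] fun _ => (0 : ℝ) :=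
    ae_mono (Measure.restrict_mono interior_subset le_rfl) h1
  exact Measure.eqOn_open_of_ae_eq h2 isOpen_interior hg.continuousOn continuousOn_const

lemma inner₁_add_left (a b c : 𝒯.PwPoly) : 𝒯.inner₁ (a + b) c = 𝒯.inner₁ a c + 𝒯.inner₁ b c := by
  simp only [inner₁, ← Finset.sum_add_distrib]
  refine Finset.sum_congr rfl fun T _ => ?_
  rw [← integral_add]
  · simp [add_mul]
  · exact 𝒯.integrableOn_cell T ((continuous_pval _).mul (continuous_pval _))
  · exact 𝒯.integrableOn_cell T ((continuous_pval _).mul (continuous_pval _))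

lemma inner₁_smul_left (r : ℝ) (a c : 𝒯.PwPoly) : 𝒯.inner₁ (r • a) c = r * 𝒯.inner₁ a c := by
  simp only [inner₁, Finset.mul_sum]
  refine Finset.sum_congr rfl fun T _ => ?_
  rw [← integral_const_mul]
  simp [mul_assoc]

lemma inner₁_comm (a b : 𝒯.PwPoly) : 𝒯.inner₁ a b = 𝒯.inner₁ b a := by
  simp only [inner₁, mul_comm]

lemma continuous_inner_vval (σ τ : Fin d → Poly d) :
    Continuous fun x => inner ℝ (vval σ x) (vval τ x) :=
  (continuous_vval σ).inner (continuous_vval τ)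

lemma inner₂_add_left (a b c : 𝒯.PwVec) : 𝒯.inner₂ (a + b) c = 𝒯.inner₂ a c + 𝒯.inner₂ b c := by
  simp only [inner₂, ← Finset.sum_add_distrib]
  refine Finset.sum_congr rfl fun T _ => ?_
  rw [← integral_add]
  · simp [inner_add_left]
  · exact 𝒯.integrableOn_cell T (continuous_inner_vval _ _)
  · exact 𝒯.integrableOn_cell T (continuous_inner_vval _ _)

lemma inner₂_smul_left (r : ℝ) (a c : 𝒯.PwVec) : 𝒯.inner₂ (r • a) c = r * 𝒯.inner₂ a c := by
  simp only [inner₂, Finset.mul_sum]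
  refine Finset.sum_congr rfl fun T _ => ?_
  rw [← integral_const_mul]
  simp [inner_smul_left]

lemma inner₂_comm (a b : 𝒯.PwVec) : 𝒯.inner₂ a b = 𝒯.inner₂ b a := by
  simp only [inner₂]
  refine Finset.sum_congr rfl fun T _ => ?_
  simp only [real_inner_comm]

/-- `inner₁` as a bilinear map. -/
def form₁ : 𝒯.PwPoly →ₗ[ℝ] 𝒯.PwPoly →ₗ[ℝ] ℝ :=
  LinearMap.mk₂ ℝ 𝒯.inner₁ 𝒯.inner₁_add_left 𝒯.inner₁_smul_left
    (fun a b c => by rw [inner₁_comm, inner₁_add_left, inner₁_comm, 𝒯.inner₁_comm c])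
    (fun r a c => by rw [inner₁_comm, inner₁_smul_left, inner₁_comm, smul_eq_mul])

/-- `inner₂` as a bilinear map. -/
def form₂ : 𝒯.PwVec →ₗ[ℝ] 𝒯.PwVec →ₗ[ℝ] ℝ :=
  LinearMap.mk₂ ℝ 𝒯.inner₂ 𝒯.inner₂_add_left 𝒯.inner₂_smul_left
    (fun a b c => by rw [inner₂_comm, inner₂_add_left, inner₂_comm, 𝒯.inner₂_comm c])
    (fun r a c => by rw [inner₂_comm, inner₂_smul_left, inner₂_comm, smul_eq_mul])

@[simp] lemma form₁_apply (a b : 𝒯.PwPoly) : 𝒯.form₁ a b = 𝒯.inner₁ a b := rfl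

@[simp] lemma form₂_apply (a b : 𝒯.PwVec) : 𝒯.form₂ a b = 𝒯.inner₂ a b := rfl

/-- The piecewise gradient as a linear map. -/
def gradL : 𝒯.PwPoly →ₗ[ℝ] 𝒯.PwVec where
  toFun := 𝒯.grad
  map_add' a b := by
    ext1 T
    ext1 i
    simp [grad, pgrad]
  map_smul' r a := by
    ext1 T
    ext1 i
    simp [grad, pgrad]

/-- The piecewise divergence as a linear map. -/
def divL : 𝒯.PwVec →ₗ[ℝ] 𝒯.PwPoly where
  toFun := 𝒯.div
  map_add' a b := by
    ext1 T
    simp [div, pdiv, Finset.sum_add_distrib]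
  map_smul' r a := by
    ext1 T
    simp [div, pdiv, Finset.smul_sum]

@[simp] lemma divL_apply (a : 𝒯.PwVec) : 𝒯.divL a = 𝒯.div a := rfl

lemma inner₂_self_nonneg (σ : 𝒯.PwVec) : 0 ≤ 𝒯.inner₂ σ σ :=
  Finset.sum_nonneg fun _ _ => integral_nonneg fun _ => real_inner_self_nonneg

lemma norm₂_sq (σ : 𝒯.PwVec) : 𝒯.norm₂ σ ^ 2 = 𝒯.inner₂ σ σ :=
  Real.sq_sqrt (𝒯.inner₂_self_nonneg σ)

lemma eq_zero_of_inner₂_self {σ : 𝒯.PwVec} (h : 𝒯.inner₂ σ σ = 0) : σ = 0 := by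
  have h1 : ∀ T ∈ Finset.univ, ∫ x in 𝒯.cell T, inner ℝ (vval (σ T) x) (vval (σ T) x) = 0 :=
    (Finset.sum_eq_zero_iff_of_nonneg
      fun T _ => integral_nonneg fun _ => real_inner_self_nonneg).1 h
  ext1 T
  ext1 i
  refine poly_eq_zero_of_isOpen isOpen_interior (𝒯.interior_cell_nonempty T) fun x hx => ?_
  have := 𝒯.eq_zero_of_integral_cell_eq_zero T (continuous_inner_vval _ _)
    (fun _ _ => real_inner_self_nonneg) (h1 T (Finset.mem_univ T)) x hx
  rw [inner_self_eq_zero] at this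
  rw [← vval_apply, this]
  rfl

/-- `P^q(𝒯)` as a subspace. -/
def PSub (q : ℕ) : Submodule ℝ 𝒯.PwPoly where
  carrier := 𝒯.P q
  add_mem' ha hb T := (MvPolynomial.totalDegree_add _ _).trans (max_le (ha T) (hb T))
  zero_mem' T := by simp
  smul_mem' r a ha T := (MvPolynomial.totalDegree_smul_le r (a T)).trans (ha T)

lemma finiteDimensional_pi {ι : Type*} [Finite ι] {V : Submodule ℝ (ι → Poly d)} {q : ℕ}
    (hV : ∀ a ∈ V, ∀ i, (a i).totalDegree ≤ q) : FiniteDimensional ℝ V := by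
  let f : V →ₗ[ℝ] (ι → MvPolynomial.restrictTotalDegree (Fin d) ℝ q) :=
    { toFun := fun a i => ⟨a.1 i, (MvPolynomial.mem_restrictTotalDegree _ _ _).2 (hV a a.2 i)⟩
      map_add' := fun a b => rfl
      map_smul' := fun r a => rfl }
  refine FiniteDimensional.of_injective f fun a b h => ?_
  apply Subtype.ext
  funext i
  have := congrFun h i
  exact congrArg Subtype.val this

instance (q : ℕ) : FiniteDimensional ℝ (𝒯.PSub q) := finiteDimensional_pi fun _ ha i => ha i

end Triangulation

/-- Solvability of a finite-dimensional linear problem whose homogeneous version is uniquely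
solvable. -/
lemma exists_forall_form_eq {M : Type*} [AddCommGroup M] [Module ℝ M] (V : Submodule ℝ M)
    [FiniteDimensional ℝ V] (B : M →ₗ[ℝ] M →ₗ[ℝ] ℝ)
    (hB : ∀ v ∈ V, (∀ w ∈ V, B v w = 0) → v = 0) (l : V →ₗ[ℝ] ℝ) :
    ∃ v ∈ V, ∀ w : V, B v w = l w := by
  let f : V →ₗ[ℝ] Module.Dual ℝ V := (B.domRestrict₁₂ V V)
  have hinj : Function.Injective f := by
    rw [← LinearMap.ker_eq_bot, LinearMap.ker_eq_bot']
    intro v hv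
    apply Subtype.ext
    refine hB v v.2 fun w hw => ?_
    exact LinearMap.congr_fun hv ⟨w, hw⟩
  have hsurj : Function.Surjective f :=
    (LinearMap.injective_iff_surjective_of_finrank_eq_finrank
      (Subspace.dual_finrank_eq (K := ℝ) (V := V)).symm).1 hinj
  obtain ⟨v, hv⟩ := hsurj l
  exact ⟨v, v.2, fun w => LinearMap.congr_fun hv w⟩

/-! ### Homogenised polynomials -/

/-- For `P` of degree at most `p`, the polynomial `s^p P(m/s)`. -/
def homog (p : ℕ) (P : Poly d) (s : Poly d) (m : Fin d → Poly d) : Poly d :=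
  ∑ α ∈ P.support, MvPolynomial.C (P.coeff α) * (s ^ (p - α.degree) * ∏ i, m i ^ α i)

lemma totalDegree_homog_le {p : ℕ} {P s : Poly d} {m : Fin d → Poly d} (hP : P.totalDegree ≤ p)
    (hs : s.totalDegree ≤ 1) (hm : ∀ i, (m i).totalDegree ≤ 1) :
    (homog p P s m).totalDegree ≤ p := by
  refine (MvPolynomial.totalDegree_finsetSum _ _).trans (Finset.sup_le fun α hα => ?_)
  have hdeg : α.degree ≤ p := by
    have := (MvPolynomial.le_totalDegree hα).trans hP
    rwa [Finsupp.degree]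
  refine (MvPolynomial.totalDegree_mul _ _).trans ?_
  rw [MvPolynomial.totalDegree_C, zero_add]
  refine (MvPolynomial.totalDegree_mul _ _).trans ?_
  have h1 : (s ^ (p - α.degree)).totalDegree ≤ p - α.degree :=
    (MvPolynomial.totalDegree_pow _ _).trans
      ((Nat.mul_le_mul_left _ hs).trans (by rw [mul_one]))
  have h2 : (∏ i, m i ^ α i).totalDegree ≤ α.degree := by
    refine (MvPolynomial.totalDegree_finsetProd _ _).trans ?_
    rw [Finsupp.degree_eq_sum]
    refine Finset.sum_le_sum fun i _ => ?_
    exact (MvPolynomial.totalDegree_pow _ _).trans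
      ((Nat.mul_le_mul_left _ (hm i)).trans (by rw [mul_one]))
  omega

lemma pval_homog {p : ℕ} {P s : Poly d} {m : Fin d → Poly d} (hP : P.totalDegree ≤ p) {x : Euc d}
    (hs : pval s x ≠ 0) : pval (homog p P s m) x =
      pval s x ^ p * pval P ((pval s x)⁻¹ • vval m x) := by
  rw [homog, pval_sum]
  have e0 : pval P ((pval s x)⁻¹ • vval m x) = ∑ α ∈ P.support, P.coeff α *
      ∏ i, ((pval s x)⁻¹ • vval m x) i ^ α i := MvPolynomial.eval_eq' _ _
  rw [e0, Finset.mul_sum]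
  refine Finset.sum_congr rfl fun α hα => ?_
  have hdeg : α.degree ≤ p := by
    have := (MvPolynomial.le_totalDegree hα).trans hP
    rwa [Finsupp.degree]
  simp only [pval_mul, pval_C, pval_pow, pval_prod, PiLp.smul_apply, vval_apply, smul_eq_mul,
    mul_pow, Finset.prod_mul_distrib]
  have e : ∏ i, (pval s x)⁻¹ ^ α i = (pval s x)⁻¹ ^ α.degree := by
    rw [Finset.prod_pow_eq_pow_sum, Finsupp.degree_eq_sum]
  rw [e, pow_sub₀ _ hs hdeg, inv_pow]
  ring

/-- The constant term carries s^p with p ≥ 1, and every other term a factor m i. -/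
lemma pval_homog_eq_zero {p : ℕ} (hp : 1 ≤ p) {P s : Poly d} {m : Fin d → Poly d} {x : Euc d}
    (hs : pval s x = 0) (hm : ∀ i, pval (m i) x = 0) : pval (homog p P s m) x = 0 := by
  rw [homog, pval_sum]
  refine Finset.sum_eq_zero fun α _ => ?_
  simp only [pval_mul, pval_C, pval_pow, pval_prod, hs, hm]
  by_cases hα : α = 0
  · simp [hα, zero_pow (by omega : p ≠ 0)]
  · obtain ⟨i, hi⟩ : ∃ i, α i ≠ 0 := by
      by_contra! h
      exact hα (Finsupp.ext h)
    have : ∏ i, (0 : ℝ) ^ α i = 0 := Finset.prod_eq_zero (Finset.mem_univ i) (zero_pow hi)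
    rw [this]
    ring

namespace Triangulation

variable {S : Set (Euc d)} (𝒯 : Triangulation S)

/-! ### Lifting Lagrange boundary data -/

open Classical in
/-- The vertices of an element which do not belong to `∂Ω`. -/
def innerVerts (Ω : Set (Euc d)) (T : 𝒯.elements) : Finset (Euc d) :=
  (T : Finset (Euc d)).filter (· ∉ frontier Ω)

/-- The sum of the barycentric coordinates of the vertices off `∂Ω`. -/
def massPoly (Ω : Set (Euc d)) (T : 𝒯.elements) : Poly d :=
  ∑ z ∈ 𝒯.innerVerts Ω T, baryPoly T z

/-- The sum of `bary T z • z` over the vertices `z` off `∂Ω`. -/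
def momentPoly (Ω : Set (Euc d)) (T : 𝒯.elements) (i : Fin d) : Poly d :=
  ∑ z ∈ 𝒯.innerVerts Ω T, MvPolynomial.C (z i) * baryPoly T z

/-- The part of `φ` which belongs to `∂Ω`. -/
def lift (Ω : Set (Euc d)) (p : ℕ) (φ : 𝒯.PwPoly) : 𝒯.PwPoly := fun T =>
  -- The subtracted term is s^p φ(m/s), where m/s is the projection of x from the Γ-vertices onto
  -- the subsimplex of the vertices off Γ. The factor s^p makes it a polynomial of degree at most p,
  -- and it vanishes where s = 0.
  φ T - homog p (φ T) (𝒯.massPoly Ω T) (𝒯.momentPoly Ω T)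

lemma pval_massPoly (Ω : Set (Euc d)) (T : 𝒯.elements) (x : Euc d) :
    pval (𝒯.massPoly Ω T) x = ∑ z ∈ 𝒯.innerVerts Ω T, bary (T : Finset (Euc d)) z x := by
  simp [massPoly, pval_sum]

lemma vval_momentPoly (Ω : Set (Euc d)) (T : 𝒯.elements) (x : Euc d) :
    vval (𝒯.momentPoly Ω T) x = ∑ z ∈ 𝒯.innerVerts Ω T, bary (T : Finset (Euc d)) z x • z := by
  ext i
  simp [momentPoly, pval_sum, mul_comm]

lemma mem_innerVerts {Ω : Set (Euc d)} {T : 𝒯.elements} {z : Euc d} :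
    z ∈ 𝒯.innerVerts Ω T ↔ z ∈ (T : Finset (Euc d)) ∧ z ∉ frontier Ω := by
  simp [innerVerts]

/-- Sums over the vertices off `∂Ω`, weighted with barycentric coordinates, do not depend on the
element. -/
lemma sum_innerVerts_eq {Ω : Set (Euc d)} {T T' : 𝒯.elements} {x : Euc d} (hx : x ∈ 𝒯.cell T)
    (hx' : x ∈ 𝒯.cell T') {E : Type*} [AddCommGroup E] [Module ℝ E] (f : Euc d → E) :
    ∑ z ∈ 𝒯.innerVerts Ω T, bary (T : Finset (Euc d)) z x • f z =
      ∑ z ∈ 𝒯.innerVerts Ω T', bary (T' : Finset (Euc d)) z x • f z := by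
  classical
  have h1 : ∑ z ∈ 𝒯.innerVerts Ω T, bary (T : Finset (Euc d)) z x • f z =
      ∑ z ∈ 𝒯.innerVerts Ω T ∪ 𝒯.innerVerts Ω T', bary (T : Finset (Euc d)) z x • f z := by
    refine Finset.sum_subset Finset.subset_union_left fun z hz hz' => ?_
    rcases Finset.mem_union.1 hz with h | h
    · exact absurd h hz'
    · rw [bary_of_notMem (fun h' => hz' (𝒯.mem_innerVerts.2 ⟨h', (𝒯.mem_innerVerts.1 h).2⟩)),
        zero_smul]
  have h2 : ∑ z ∈ 𝒯.innerVerts Ω T', bary (T' : Finset (Euc d)) z x • f z =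
      ∑ z ∈ 𝒯.innerVerts Ω T ∪ 𝒯.innerVerts Ω T', bary (T' : Finset (Euc d)) z x • f z := by
    refine Finset.sum_subset Finset.subset_union_right fun z hz hz' => ?_
    rcases Finset.mem_union.1 hz with h | h
    · rw [bary_of_notMem (fun h' => hz' (𝒯.mem_innerVerts.2 ⟨h', (𝒯.mem_innerVerts.1 h).2⟩)),
        zero_smul]
    · exact absurd h hz'
  rw [h1, h2]
  exact Finset.sum_congr rfl fun z _ => by rw [𝒯.bary_eq_bary hx hx']

lemma bary_eq_zero_of_mass {Ω : Set (Euc d)} {T : 𝒯.elements} {x : Euc d} (hx : x ∈ 𝒯.cell T)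
    (h : pval (𝒯.massPoly Ω T) x = 0) :
    ∀ z ∈ 𝒯.innerVerts Ω T, bary (T : Finset (Euc d)) z x = 0 := by
  rw [pval_massPoly] at h
  refine (Finset.sum_eq_zero_iff_of_nonneg fun z hz => ?_).1 h
  exact (𝒯.mem_cell_iff T).1 hx z (𝒯.mem_innerVerts.1 hz).1

lemma pval_lift_of_mass_eq_zero {Ω : Set (Euc d)} {p : ℕ} (hp : 1 ≤ p) (φ : 𝒯.PwPoly)
    {T : 𝒯.elements} {x : Euc d} (hx : x ∈ 𝒯.cell T) (h : pval (𝒯.massPoly Ω T) x = 0) :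
    pval (𝒯.lift Ω p φ T) x = pval (φ T) x := by
  rw [lift, pval_sub, pval_homog_eq_zero hp h, sub_zero]
  intro i
  rw [← vval_apply, vval_momentPoly, Finset.sum_eq_zero fun z hz => ?_]
  · rfl
  · rw [𝒯.bary_eq_zero_of_mass hx h z hz, zero_smul]

lemma vertex_mem_frontier_iff {Ω : Set (Euc d)} (hΩ : IsLipschitzDomain Ω)
    (hS : IsLipschitzDomain S) (hSΩ : S ⊆ Ω) (hΓ : frontier Ω ⊆ frontier S) {T : 𝒯.elements}
    {x z : Euc d} (hx : x ∈ 𝒯.cell T) (hxS : x ∈ frontier S) (hz : z ∈ (T : Finset (Euc d)))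
    (h : bary (T : Finset (Euc d)) z x ≠ 0) : x ∈ frontier Ω ↔ z ∈ frontier Ω := by
  refine 𝒯.mem_frontier_outer_of_bary hΩ hS hSΩ hΓ hx hxS (subset_convexHull ℝ _ hz) ?_
  intro a ha h0
  exact (𝒯.isSimplex T).bary_ne ha hz (fun h' => h (h' ▸ h0))

lemma pval_lift_of_mem_frontier {Ω : Set (Euc d)} (hΩ : IsLipschitzDomain Ω)
    (hS : IsLipschitzDomain S) (hSΩ : S ⊆ Ω) (hΓ : frontier Ω ⊆ frontier S) {p : ℕ} (hp : 1 ≤ p)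
    (φ : 𝒯.PwPoly) {T : 𝒯.elements} {x : Euc d} (hx : x ∈ 𝒯.cell T) (hxΩ : x ∈ frontier Ω) :
    pval (𝒯.lift Ω p φ T) x = pval (φ T) x := by
  refine 𝒯.pval_lift_of_mass_eq_zero hp φ hx ?_
  rw [pval_massPoly]
  refine Finset.sum_eq_zero fun z hz => ?_
  rw [mem_innerVerts] at hz
  by_contra h
  exact hz.2 ((𝒯.vertex_mem_frontier_iff hΩ hS hSΩ hΓ hx (hΓ hxΩ) hz.1 h).1 hxΩ)

/-- At a point of Γᶜ every active vertex is off Γ. Hence the mass is 1 and the moment is x itself,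
and `lift` subtracts exactly φ(x). -/
lemma vanishesOn_lift {Ω : Set (Euc d)} (hΩ : IsLipschitzDomain Ω)
    (hS : IsLipschitzDomain S) (hSΩ : S ⊆ Ω) (hΓ : frontier Ω ⊆ frontier S) {p : ℕ}
    {φ : 𝒯.PwPoly} (hφ : φ ∈ 𝒯.P p) :
    𝒯.VanishesOn (𝒯.lift Ω p φ) (frontier S \ frontier Ω) := by
  rintro T x ⟨hx, hxS, hxΩ⟩
  have hz : ∀ z ∈ (T : Finset (Euc d)), z ∉ 𝒯.innerVerts Ω T →
      bary (T : Finset (Euc d)) z x = 0 := by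
    intro z hz hz'
    by_contra h
    refine hz' (𝒯.mem_innerVerts.2 ⟨hz, fun hzΩ => hxΩ ?_⟩)
    exact (𝒯.vertex_mem_frontier_iff hΩ hS hSΩ hΓ hx hxS hz h).2 hzΩ
  have hsub : 𝒯.innerVerts Ω T ⊆ (T : Finset (Euc d)) :=
    fun z hz => (𝒯.mem_innerVerts.1 hz).1
  have e1 : pval (𝒯.massPoly Ω T) x = 1 := by
    rw [pval_massPoly, ← (𝒯.isSimplex T).sum_bary x]
    exact Finset.sum_subset hsub hz
  have e2 : vval (𝒯.momentPoly Ω T) x = x := by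
    rw [vval_momentPoly]
    conv_rhs => rw [← (𝒯.isSimplex T).sum_bary_smul x]
    exact Finset.sum_subset hsub fun z h1 h2 => by rw [hz z h1 h2, zero_smul]
  rw [lift, pval_sub, pval_homog (hφ T) (by rw [e1]; exact one_ne_zero), e1, e2]
  simp

/-- Mass and moment at a common point do not depend on the element, and neither does the value of φ
at the projected point, which lies in both cells. -/
lemma lift_mem_Lagrange {Ω : Set (Euc d)} {p : ℕ} (hp : 1 ≤ p) {φ : 𝒯.PwPoly}
    (hφ : φ ∈ 𝒯.Lagrange p) : 𝒯.lift Ω p φ ∈ 𝒯.Lagrange p := by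
  obtain ⟨hdeg, hcont⟩ := hφ
  refine ⟨fun T => ?_, fun T T' x hx => ?_⟩
  · refine (MvPolynomial.totalDegree_sub _ _).trans (max_le (hdeg T) ?_)
    refine totalDegree_homog_le (hdeg T) ?_ fun i => ?_
    · exact (MvPolynomial.totalDegree_finsetSum _ _).trans
        (Finset.sup_le fun z _ => totalDegree_baryPoly_le _ _)
    · refine (MvPolynomial.totalDegree_finsetSum _ _).trans (Finset.sup_le fun z _ => ?_)
      refine (MvPolynomial.totalDegree_mul _ _).trans ?_
      rw [MvPolynomial.totalDegree_C, zero_add]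
      exact totalDegree_baryPoly_le _ _
  · have e1 : pval (𝒯.massPoly Ω T) x = pval (𝒯.massPoly Ω T') x := by
      rw [pval_massPoly, pval_massPoly]
      simpa using 𝒯.sum_innerVerts_eq (Ω := Ω) hx.1 hx.2 fun _ => (1 : ℝ)
    have e2 : vval (𝒯.momentPoly Ω T) x = vval (𝒯.momentPoly Ω T') x := by
      rw [vval_momentPoly, vval_momentPoly]
      exact 𝒯.sum_innerVerts_eq (Ω := Ω) hx.1 hx.2 id
    by_cases h : pval (𝒯.massPoly Ω T) x = 0
    · rw [𝒯.pval_lift_of_mass_eq_zero hp φ hx.1 h,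
        𝒯.pval_lift_of_mass_eq_zero hp φ hx.2 (e1 ▸ h), hcont T T' x hx]
    -- The projected point is a convex combination of vertices of the cell, so the continuity of φ
    -- may be used there.
    · have key : ∀ T₁ : 𝒯.elements, x ∈ 𝒯.cell T₁ → pval (𝒯.massPoly Ω T₁) x ≠ 0 →
          (pval (𝒯.massPoly Ω T₁) x)⁻¹ • vval (𝒯.momentPoly Ω T₁) x ∈ 𝒯.cell T₁ := by
        intro T₁ hx₁ h₁
        rw [vval_momentPoly, Finset.smul_sum]
        simp_rw [smul_smul]
        have hpos : 0 ≤ pval (𝒯.massPoly Ω T₁) x := by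
          rw [pval_massPoly]
          exact Finset.sum_nonneg fun z hz =>
            (𝒯.mem_cell_iff T₁).1 hx₁ z (𝒯.mem_innerVerts.1 hz).1
        refine (convex_convexHull ℝ _).sum_mem (fun z hz => ?_) ?_ fun z hz => ?_
        · exact mul_nonneg (inv_nonneg.2 hpos)
            ((𝒯.mem_cell_iff T₁).1 hx₁ z (𝒯.mem_innerVerts.1 hz).1)
        · rw [← Finset.mul_sum, ← pval_massPoly, inv_mul_cancel₀ h₁]
        · exact subset_convexHull ℝ _ (𝒯.mem_innerVerts.1 hz).1
      rw [lift, lift, pval_sub, pval_sub, pval_homog (hdeg T) h, pval_homog (hdeg T') (e1 ▸ h),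
        hcont T T' x hx, ← e1, ← e2]
      congr 2
      refine hcont T T' _ ⟨key T hx.1 h, ?_⟩
      rw [e1, e2]
      exact key T' hx.2 (e1 ▸ h)

/-! ### The discrete Dirichlet problem -/

/-- `S^p_0(𝒯)` as a subspace. -/
def Lagrange₀Sub (p : ℕ) : Submodule ℝ 𝒯.PwPoly where
  carrier := 𝒯.Lagrange₀ p
  add_mem' := by
    rintro a b ⟨⟨ha1, ha2⟩, ha3⟩ ⟨⟨hb1, hb2⟩, hb3⟩
    refine ⟨⟨(𝒯.PSub p).add_mem ha1 hb1, fun T T' x hx => ?_⟩, fun T x hx => ?_⟩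
    · simp [ha2 T T' x hx, hb2 T T' x hx]
    · simp [ha3 T x hx, hb3 T x hx]
  zero_mem' := ⟨⟨(𝒯.PSub p).zero_mem, fun T T' x _ => by simp⟩, fun T x _ => by simp⟩
  smul_mem' := by
    rintro r a ⟨⟨ha1, ha2⟩, ha3⟩
    refine ⟨⟨(𝒯.PSub p).smul_mem r ha1, fun T T' x hx => ?_⟩, fun T x hx => ?_⟩
    · simp [ha2 T T' x hx]
    · simp [ha3 T x hx]

instance (p : ℕ) : FiniteDimensional ℝ (𝒯.Lagrange₀Sub p) :=
  finiteDimensional_pi fun _ ha i => ha.1.1 i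

include 𝒯 in
lemma frontier_nonempty (hd : 1 ≤ d) (hS : IsLipschitzDomain S) : (frontier S).Nonempty := by
  rw [nonempty_frontier_iff]
  refine ⟨hS.isConnected.nonempty, fun h => ?_⟩
  have hc := 𝒯.isCompact_closure
  rw [h, closure_univ] at hc
  have : Nonempty (Fin d) := ⟨⟨0, hd⟩⟩
  exact noncompact_univ (Euc d) hc

/-- A Lagrange function on `S` with vanishing boundary values and gradient is zero. -/
lemma eq_zero_of_grad_eq_zero (hd : 1 ≤ d) (hS : IsLipschitzDomain S) {p : ℕ} {δ : 𝒯.PwPoly}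
    (hδ : δ ∈ 𝒯.Lagrange₀ p) (h : 𝒯.grad δ = 0) : δ = 0 := by
  have hC : ∀ T, ∃ c, δ T = MvPolynomial.C c := fun T =>
    eq_C_of_pgrad_eq_zero fun i => congrFun (congrFun h T) i
  choose c hc using hC
  obtain ⟨x₀, hx₀⟩ := 𝒯.frontier_nonempty hd hS
  obtain ⟨T₀, hT₀⟩ := 𝒯.exists_mem_cell (frontier_subset_closure hx₀)
  have hc₀ : c T₀ = 0 := by
    have := hδ.2 T₀ x₀ ⟨hT₀, hx₀⟩
    rwa [hc, pval_C] at this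
  have hconn : IsPreconnected (closure S) := hS.isConnected.isPreconnected.closure
  have hclosed : ∀ A : Set 𝒯.elements, IsClosed (⋃ T ∈ A, 𝒯.cell T) := fun A =>
    (toFinite A).isClosed_biUnion fun T _ => (𝒯.isCompact_cell T).isClosed
  have hcz : ∀ T, c T = 0 := by
    intro T₁
    by_contra hT₁
    -- The cells with constant zero and those with nonzero constant form two closed sets covering
    -- the connected closure of S, so they meet, where continuity gives a contradiction.
    obtain ⟨x₁, hx₁⟩ := 𝒯.interior_cell_nonempty T₁
    obtain ⟨x, -, hx1, hx2⟩ := isPreconnected_closed_iff.1 hconn _ _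
      (hclosed {T | c T = 0}) (hclosed {T | c T ≠ 0}) (fun x hx => by
        obtain ⟨T, hT⟩ := 𝒯.exists_mem_cell hx
        by_cases hcT : c T = 0
        · exact Or.inl (mem_biUnion hcT hT)
        · exact Or.inr (mem_biUnion hcT hT))
      ⟨x₀, frontier_subset_closure hx₀, mem_biUnion hc₀ hT₀⟩
      ⟨x₁, 𝒯.cell_subset T₁ (interior_subset hx₁), mem_biUnion hT₁ (interior_subset hx₁)⟩
    obtain ⟨T, hcT, hT⟩ := mem_iUnion₂.1 hx1
    obtain ⟨T', hcT', hT'⟩ := mem_iUnion₂.1 hx2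
    have := hδ.1.2 T T' x ⟨hT, hT'⟩
    rw [hc, hc, pval_C, pval_C] at this
    exact hcT' (this ▸ hcT)
  ext1 T
  rw [hc, hcz, map_zero]
  rfl

/-- Lagrange functions which vanish almost everywhere on `∂Ω` vanish there. -/
lemma vanishesOn_of_ae {Ω : Set (Euc d)} (hΩ : IsLipschitzDomain Ω)
    (hΓ : frontier Ω ⊆ frontier S) {p : ℕ} {δ : 𝒯.PwPoly} (hδ : δ ∈ 𝒯.Lagrange p)
    (h : ∀ᵐ x ∂(surf Ω), ∀ T, x ∈ 𝒯.cell T → pval (δ T) x = 0) :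
    𝒯.VanishesOn δ (frontier Ω) := by
  rintro T x ⟨hx, hxΩ⟩
  by_contra hne
  -- If a piece were nonzero at x, every piece would be nonzero near x by continuity, on a part of Γ
  -- of positive measure.
  have hU : ∀ᶠ y in 𝓝 x, ∀ T', y ∈ 𝒯.cell T' → pval (δ T') y ≠ 0 := by
    have h1 : ∀ᶠ y in 𝓝 x, ∀ T', pval (δ T') x ≠ 0 → pval (δ T') y ≠ 0 := by
      rw [eventually_all]
      intro T'
      rw [eventually_imp_distrib_left]
      intro h'
      exact (continuous_pval _).continuousAt.eventually_ne h'
    filter_upwards [h1, 𝒯.eventually_mem_cell x] with y hy1 hy2 T' hT'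
    refine hy1 T' ?_
    rw [← hδ.2 T T' x ⟨hx, hy2 T' hT'⟩]
    exact hne
  refine hΩ.surf_pos hxΩ hU ?_
  rw [measure_eq_zero_iff_ae_notMem]
  have hmem : ∀ᵐ x ∂(surf Ω), x ∈ frontier Ω := ae_restrict_mem isClosed_frontier.measurableSet
  filter_upwards [h, hmem] with y hy1 hy2 hyU
  obtain ⟨T', hT'⟩ := 𝒯.exists_mem_cell (frontier_subset_closure (hΓ hy2))
  exact hyU T' hT' (hy1 T' hT')

/-- Writing w = `lift` + v with v ∈ S^p_0 leaves a problem whose form, the gradient product, is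
definite. For uniqueness the difference of two solutions must be in S^p_0; it vanishes only almost
everywhere on Γ at first, which `vanishesOn_of_ae` upgrades. -/
theorem existsUnique_dirichlet (hd : 1 ≤ d) {Ω : Set (Euc d)} (hΩ : IsLipschitzDomain Ω)
    (hS : IsLipschitzDomain S) (hSΩ : S ⊆ Ω) (hΓ : frontier Ω ⊆ frontier S) {p : ℕ} (hp : 1 ≤ p)
    {f : HHalf Ω} (hf : f ∈ 𝒯.LagrangeTraces Ω p) :
    ∃! w : 𝒯.PwPoly, 𝒯.IsDirichletSolution p (f : L2Bdry Ω) w := by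
  obtain ⟨φ, hφ, hφf⟩ := hf
  have hmem : ∀ᵐ x ∂(surf Ω), x ∈ frontier Ω := ae_restrict_mem isClosed_frontier.measurableSet
  set w₀ := 𝒯.lift Ω p φ
  let B : 𝒯.PwPoly →ₗ[ℝ] 𝒯.PwPoly →ₗ[ℝ] ℝ := 𝒯.form₂.compl₁₂ 𝒯.gradL 𝒯.gradL
  have hB : ∀ a b, B a b = 𝒯.inner₂ (𝒯.grad a) (𝒯.grad b) := fun a b => rfl
  have hdef : ∀ v ∈ 𝒯.Lagrange₀Sub p, (∀ w ∈ 𝒯.Lagrange₀Sub p, B v w = 0) → v = 0 :=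
    fun v hv h => 𝒯.eq_zero_of_grad_eq_zero hd hS hv (𝒯.eq_zero_of_inner₂_self (h v hv))
  obtain ⟨v, hv, hvw⟩ := exists_forall_form_eq (𝒯.Lagrange₀Sub p) B hdef
    (-(B w₀).domRestrict (𝒯.Lagrange₀Sub p))
  have hw₀ := 𝒯.lift_mem_Lagrange (Ω := Ω) hp hφ
  refine ⟨w₀ + v, ⟨⟨(𝒯.PSub p).add_mem hw₀.1 hv.1.1, fun T T' x hx => ?_⟩, ?_, ?_, ?_⟩, ?_⟩
  · simp only [Pi.add_apply, pval_add]
    rw [hw₀.2 T T' x hx, hv.1.2 T T' x hx]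
  · filter_upwards [hφf, hmem] with x hx hxΩ T hT
    simp only [Pi.add_apply, pval_add]
    rw [𝒯.pval_lift_of_mem_frontier hΩ hS hSΩ hΓ hp φ hT hxΩ, hv.2 T x ⟨hT, hΓ hxΩ⟩, add_zero,
      hx T hT]
  · rintro T x ⟨hx, hx'⟩
    simp only [Pi.add_apply, pval_add]
    rw [𝒯.vanishesOn_lift hΩ hS hSΩ hΓ hφ.1 T x ⟨hx, hx'⟩, hv.2 T x ⟨hx, hx'.1⟩, add_zero]
  · intro ψ hψ
    rw [← hB, map_add, LinearMap.add_apply]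
    have := hvw ⟨ψ, hψ⟩
    simp only [LinearMap.neg_apply, LinearMap.domRestrict_apply] at this
    rw [this, add_neg_cancel]
  · intro w' hw'
    have hδ : w' - (w₀ + v) ∈ 𝒯.Lagrange₀ p := by
      have hL : w' - (w₀ + v) ∈ 𝒯.Lagrange p := by
        refine ⟨(𝒯.PSub p).sub_mem hw'.mem.1 ((𝒯.PSub p).add_mem hw₀.1 hv.1.1),
          fun T T' x hx => ?_⟩
        simp only [Pi.add_apply, Pi.sub_apply, pval_add, pval_sub]
        rw [hw₀.2 T T' x hx, hv.1.2 T T' x hx, hw'.mem.2 T T' x hx]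
      have hΓ0 : 𝒯.VanishesOn (w' - (w₀ + v)) (frontier Ω) := by
        refine 𝒯.vanishesOn_of_ae hΩ hΓ hL ?_
        filter_upwards [hφf, hmem, hw'.eq_on] with x hx hxΩ hx' T hT
        simp only [Pi.add_apply, Pi.sub_apply, pval_add, pval_sub]
        rw [𝒯.pval_lift_of_mem_frontier hΩ hS hSΩ hΓ hp φ hT hxΩ, hv.2 T x ⟨hT, hΓ hxΩ⟩,
          ← hx T hT, ← hx' T hT]
        ring
      refine ⟨hL, fun T x hx => ?_⟩
      by_cases hxΩ : x ∈ frontier Ω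
      · exact hΓ0 T x ⟨hx.1, hxΩ⟩
      · simp only [Pi.add_apply, Pi.sub_apply, pval_add, pval_sub]
        rw [𝒯.vanishesOn_lift hΩ hS hSΩ hΓ hφ.1 T x ⟨hx.1, hx.2, hxΩ⟩, hv.2 T x hx,
          hw'.zero_on T x ⟨hx.1, hx.2, hxΩ⟩]
        ring
    have h0 : w' - (w₀ + v) = 0 := by
      refine 𝒯.eq_zero_of_grad_eq_zero hd hS hδ (𝒯.eq_zero_of_inner₂_self ?_)
      rw [← hB, B.map_sub, LinearMap.sub_apply, B.map_add, LinearMap.add_apply]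
      have h1 := hw'.galerkin _ hδ
      have h2 := hvw ⟨_, hδ⟩
      simp only [LinearMap.neg_apply, LinearMap.domRestrict_apply] at h2
      rw [hB w', h1, h2]
      ring
    exact sub_eq_zero.1 h0

end Triangulation

/-- At most d points span a proper affine subspace. Used in `strongly_connected` to choose a segment
in general position. -/
lemma volume_affineSpan_eq_zero {A : Finset (Euc d)} (hA : A.card ≤ d) :
    volume (affineSpan ℝ (A : Set (Euc d)) : Set (Euc d)) = 0 := by
  refine Measure.addHaar_affineSubspace _ _ fun h => ?_
  rcases A.eq_empty_or_nonempty with rfl | ⟨a, ha⟩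
  · simp at h
  have h1 : vectorSpan ℝ (A : Set (Euc d)) = ⊤ := by
    rw [← direction_affineSpan, h, AffineSubspace.direction_top]
  obtain ⟨k, hk⟩ : ∃ k, A.card = k + 1 :=
    ⟨A.card - 1, by have := Finset.card_pos.2 ⟨a, ha⟩; omega⟩
  have := finrank_vectorSpan_image_finset_le ℝ (id : Euc d → Euc d) A hk
  rw [Finset.image_id, h1, finrank_top, finrank_euclideanSpace_fin] at this
  omega

/-! ### Polynomial fields on a single simplex. -/

/-- The polynomial field `x ↦ x - z`. -/
def radial (z : Euc d) : Fin d → Poly d := fun i => MvPolynomial.X i - MvPolynomial.C (z i)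

@[simp] lemma vval_radial (z x : Euc d) : vval (radial z) x = x - z := by
  ext i
  simp [radial]

lemma pdiv_radial (z : Euc d) : pdiv (radial z) = MvPolynomial.C (d : ℝ) := by
  simp [pdiv, radial]

lemma pdiv_smul (c : ℝ) (σ : Fin d → Poly d) : pdiv (c • σ) = c • pdiv σ := by
  simp [pdiv, Finset.smul_sum]

namespace IsSimplex

variable {T : Finset (Euc d)} (hT : IsSimplex T)
include hT

/-- Integration by parts for polynomials on a simplex. -/
lemma integral_pdiv_mul (hd : 1 ≤ d) (β : Fin d → Poly d) (P : Poly d) :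
    ∫ x in convexHull ℝ (T : Set (Euc d)),
      (pval (pdiv β) x * pval P x + inner ℝ (vval β x) (vval (pgrad P) x)) =
      ∑ z ∈ T, ∫ x in face T z, inner ℝ (outerNormal T z) (vval β x) * pval P x
        ∂(Measure.euclideanHausdorffMeasure (d - 1)) := by
  have h := hT.integral_divergence hd (F := fun i => pval (β i * P))
    (fun i => (contDiff_pval _).of_le (by exact_mod_cast le_top))
  convert h using 2
  · ext x
    simp only [fderiv_pval_single, pdiv, pval_sum, Derivation.leibniz, smul_eq_mul, pval_add,
      pval_mul, PiLp.inner_apply, vval_apply, pgrad, Finset.sum_add_distrib, Finset.sum_mul]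
    rw [add_comm]
    congr 1
    · exact Finset.sum_congr rfl fun i _ => by simp [mul_comm]
    · exact Finset.sum_congr rfl fun i _ => by ring
  · congr 1
    ext x
    simp only [PiLp.inner_apply, vval_apply, pval_mul, Finset.sum_mul]
    exact Finset.sum_congr rfl fun i _ => by simp; ring

/-- Every vertex z ≠ a lies in the face opposite a, so x - z is tangential there. Thus `radial z`
has flux only through the face opposite z, and a constant one. -/
lemma inner_outerNormal_radial (hd : 1 ≤ d) {a z x : Euc d} (ha : a ∈ T) (hz : z ∈ T)
    (hx : bary T a x = 0) :
    inner ℝ (outerNormal T a) (x - z) = if a = z then height T z else 0 := by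
  rw [hT.inner_outerNormal_sub hd ha, hx, sub_zero]
  split_ifs with h
  · subst h
    rw [hT.bary_self ha, mul_one, height]
  · rw [hT.bary_ne ha hz h, mul_zero]

lemma volume_hull (hd : 1 ≤ d) {z : Euc d} (hz : z ∈ T) :
    d * volume.real (convexHull ℝ (T : Set (Euc d))) =
      height T z * (Measure.euclideanHausdorffMeasure (d - 1)).real (face T z) := by
  have := hT.integral_div_radial hd hz (ψ := fun _ => 1) contDiff_const
  simpa [mul_comm] using this

lemma volume_hull_pos : 0 < volume.real (convexHull ℝ (T : Set (Euc d))) := by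
  obtain ⟨x, hx⟩ := hT.exists_center
  refine ENNReal.toReal_pos ?_ (isCompact_hull T).measure_lt_top.ne
  refine (Measure.measure_pos_of_nonempty_interior volume ⟨x, ?_⟩).ne'
  exact hT.mem_interior_hull_iff.2 hx

/-- A polynomial which is orthogonal to the divergences of all normal-free Raviart–Thomas fields
of a simplex has zero gradient. -/
lemma pgrad_eq_zero_of_bubble (hd : 1 ≤ d) {q : ℕ} {P : Poly d} (hP : P.totalDegree ≤ q)
    (h : ∀ β : Fin d → Poly d, (∃ (a : Fin d → Poly d) (b : Poly d),
      (∀ i, (a i).totalDegree ≤ q) ∧ b.totalDegree ≤ q ∧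
        ∀ i, β i = a i + b * MvPolynomial.X i) →
      (∀ z ∈ T, ∀ x ∈ face T z, inner ℝ (outerNormal T z) (vval β x) = 0) →
      ∫ x in convexHull ℝ (T : Set (Euc d)), pval (pdiv β) x * pval P x = 0) (i : Fin d) :
    MvPolynomial.pderiv i P = 0 := by
  -- For q = 0 the polynomial P is constant; for q ≥ 1 the truncated degree q - 1 below is genuine.
  rcases Nat.eq_zero_or_pos q with rfl | hq
  · rw [Nat.le_zero, MvPolynomial.totalDegree_eq_zero_iff_eq_C] at hP
    rw [hP]
    simp
  obtain ⟨z₀, hz₀⟩ := hT.nonempty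
  -- The test field is β = ∑ λ_z (∇P · (z₀ - z)) (x - z). The factor λ_z kills the only face flux of
  -- x - z. As ∑ λ_z (x - z) = 0, replacing z₀ by x does not change β, so that β · ∇P = ∑ λ_z (∇P ·
  -- (x - z))²; the fixed z₀ keeps the scalar coefficients of degree at most 1 + (q - 1) = q, as
  -- Raviart–Thomas fields require.
  set s : Euc d → Poly d := fun z =>
    ∑ j, MvPolynomial.C (z₀ j - z j) * MvPolynomial.pderiv j P with hs
  have hs_deg : ∀ z, (s z).totalDegree ≤ q - 1 := by
    intro z
    refine (MvPolynomial.totalDegree_finsetSum _ _).trans (Finset.sup_le fun j _ => ?_)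
    refine (MvPolynomial.totalDegree_mul _ _).trans ?_
    rw [MvPolynomial.totalDegree_C, zero_add]
    exact totalDegree_pderiv_le hP j
  have hs_val : ∀ z x, pval (s z) x = inner ℝ (vval (pgrad P) x) (z₀ - z) := by
    intro z x
    rw [hs, pval_sum, PiLp.inner_apply]
    exact Finset.sum_congr rfl fun j _ => by simp [pgrad]
  set β : Fin d → Poly d := ∑ z ∈ T, fun i => (baryPoly T z * s z) * radial z i with hβ
  have hβ_val : ∀ x, vval β x = ∑ z ∈ T, (bary T z x * pval (s z) x) • (x - z) := by
    intro x
    ext i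
    simp [hβ, pval_sum, radial]
  have hbs : ∀ z, (baryPoly T z * s z).totalDegree ≤ q := by
    intro z
    refine (MvPolynomial.totalDegree_mul _ _).trans ?_
    have h1 := totalDegree_baryPoly_le T z
    have h2 := hs_deg z
    omega
  have hintg := h β ⟨fun i => -∑ z ∈ T, (baryPoly T z * s z) * MvPolynomial.C (z i),
    ∑ z ∈ T, baryPoly T z * s z, ?_, ?_, ?_⟩ ?_
  rotate_left
  · intro i
    rw [MvPolynomial.totalDegree_neg]
    refine (MvPolynomial.totalDegree_finsetSum _ _).trans (Finset.sup_le fun z _ => ?_)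
    refine (MvPolynomial.totalDegree_mul _ _).trans ?_
    rw [MvPolynomial.totalDegree_C, add_zero]
    exact hbs z
  · exact (MvPolynomial.totalDegree_finsetSum _ _).trans (Finset.sup_le fun z _ => hbs z)
  · intro i
    rw [hβ, Finset.sum_apply, Finset.sum_mul, neg_add_eq_sub, ← Finset.sum_sub_distrib]
    exact Finset.sum_congr rfl fun z _ => by rw [radial]; ring
  · intro a ha x hx
    have hxa := ((hT.mem_face_iff ha).1 hx).2
    rw [hβ_val, inner_sum]
    refine Finset.sum_eq_zero fun z hz => ?_
    rw [inner_smul_right, hT.inner_outerNormal_radial hd ha hz hxa]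
    split_ifs with haz
    · rw [← haz, hxa]
      ring
    · ring
  have hparts := hT.integral_pdiv_mul hd β P
  have hbd : ∑ z ∈ T, ∫ x in face T z, inner ℝ (outerNormal T z) (vval β x) * pval P x
      ∂(Measure.euclideanHausdorffMeasure (d - 1)) = 0 := by
    refine Finset.sum_eq_zero fun a ha => setIntegral_eq_zero_of_forall_eq_zero fun x hx => ?_
    have hxa := ((hT.mem_face_iff ha).1 hx).2
    rw [hβ_val, inner_sum, Finset.sum_eq_zero, zero_mul]
    intro z hz
    rw [inner_smul_right, hT.inner_outerNormal_radial hd ha hz hxa]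
    split_ifs with haz
    · rw [← haz, hxa]
      ring
    · ring
  have hcont : Continuous fun x => inner ℝ (vval β x) (vval (pgrad P) x) :=
    (continuous_vval _).inner (continuous_vval _)
  have hK := isCompact_hull T
  rw [hbd, integral_add, hintg, zero_add] at hparts
  rotate_left
  · exact ((continuous_pval _).mul (continuous_pval _)).continuousOn.integrableOn_compact hK
  · exact hcont.continuousOn.integrableOn_compact hK
  -- the integrand is a weighted sum of squares
  have hsq : ∀ x, inner ℝ (vval β x) (vval (pgrad P) x) =
      ∑ z ∈ T, bary T z x * inner ℝ (vval (pgrad P) x) (x - z) ^ 2 := by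
    intro x
    set G := vval (pgrad P) x
    have h0 : ∑ z ∈ T, bary T z x * inner ℝ G (x - z) = 0 := by
      have : ∑ z ∈ T, bary T z x • (x - z) = 0 := by
        simp only [smul_sub, Finset.sum_sub_distrib, ← Finset.sum_smul, hT.sum_bary,
          hT.sum_bary_smul, one_smul, sub_self]
      have h1 := congrArg (fun v => inner ℝ G v) this
      simpa only [inner_sum, inner_smul_right, inner_zero_right] using h1
    rw [hβ_val, sum_inner]
    have h2 : ∀ z ∈ T, inner ℝ ((bary T z x * pval (s z) x) • (x - z)) G =
        bary T z x * inner ℝ G (x - z) ^ 2 -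
          inner ℝ G (x - z₀) * (bary T z x * inner ℝ G (x - z)) := by
      intro z _
      rw [inner_smul_left, real_inner_comm, hs_val]
      have : z₀ - z = (x - z) - (x - z₀) := by abel
      rw [this, inner_sub_right]
      simp only [conj_trivial]
      ring
    rw [Finset.sum_congr rfl h2, Finset.sum_sub_distrib, ← Finset.mul_sum, h0, mul_zero, sub_zero]
  have hnn : ∀ x ∈ convexHull ℝ (T : Set (Euc d)),
      0 ≤ inner ℝ (vval β x) (vval (pgrad P) x) := by
    intro x hx
    rw [hsq]
    exact Finset.sum_nonneg fun z hz => mul_nonneg (hT.mem_hull_iff.1 hx z hz) (sq_nonneg _)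
  have hae := (setIntegral_eq_zero_iff_of_nonneg_ae
    ((ae_restrict_iff' hK.measurableSet).2 (Eventually.of_forall hnn))
    (hcont.continuousOn.integrableOn_compact hK)).1 hparts
  have hzero : EqOn (fun x => inner ℝ (vval β x) (vval (pgrad P) x)) (fun _ => (0 : ℝ))
      (interior (convexHull ℝ (T : Set (Euc d)))) :=
    Measure.eqOn_open_of_ae_eq
      (ae_mono (Measure.restrict_mono interior_subset le_rfl) hae) isOpen_interior
      hcont.continuousOn continuousOn_const
  obtain ⟨x₀, hx₀⟩ := hT.exists_center
  refine poly_eq_zero_of_isOpen isOpen_interior ⟨x₀, hT.mem_interior_hull_iff.2 hx₀⟩ fun x hx => ?_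
  have hxpos := hT.mem_interior_hull_iff.1 hx
  have h1 := hzero hx
  simp only at h1
  rw [hsq, Finset.sum_eq_zero_iff_of_nonneg
    (fun z hz => mul_nonneg (hxpos z hz).le (sq_nonneg _))] at h1
  -- In the interior all weights λ_z are positive, so ∇P is orthogonal to every x - z, and these
  -- vectors span the space.
  have h2 : ∀ z ∈ T, inner ℝ (vval (pgrad P) x) (x - z) = 0 := fun z hz =>
    pow_eq_zero_iff (two_ne_zero) |>.1 ((mul_eq_zero.1 (h1 z hz)).resolve_left (hxpos z hz).ne')
  set G := vval (pgrad P) x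
  have hG : inner ℝ G G = 0 := by
    have e : G = ∑ z ∈ T, -inner ℝ (bgrad T z) G • (x - z) := by
      simp only [neg_smul, smul_sub, Finset.sum_sub_distrib, Finset.sum_neg_distrib,
        ← Finset.sum_smul, hT.sum_bgrad_inner, hT.sum_bgrad_smul]
      simp
    have h3 : inner ℝ G (∑ z ∈ T, -inner ℝ (bgrad T z) G • (x - z)) = 0 := by
      rw [inner_sum]
      exact Finset.sum_eq_zero fun z hz => by rw [inner_smul_right, h2 z hz, mul_zero]
    rwa [← e] at h3
  rw [inner_self_eq_zero] at hG
  have : G i = 0 := by rw [hG]; rfl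
  exact this

end IsSimplex

namespace Triangulation

variable {S : Set (Euc d)} (𝒯 : Triangulation S)

/-! ### Strong connectivity -/

lemma shared_of_card_inter {T T' : 𝒯.elements} (hne : T ≠ T') [DecidableEq (Euc d)]
    (h : d ≤ ((T : Finset (Euc d)) ∩ (T' : Finset (Euc d))).card) :
    ∃ z z', 𝒯.Shared T z T' z' := by
  have hcard : ∀ A B : 𝒯.elements, A ≠ B →
      d ≤ ((A : Finset (Euc d)) ∩ (B : Finset (Euc d))).card →
      ∃ z ∈ (A : Finset (Euc d)), (A : Finset (Euc d)) ∩ (B : Finset (Euc d)) =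
        (A : Finset (Euc d)).erase z := by
    intro A B hAB hc
    obtain ⟨z, hz, hzB⟩ : ∃ z ∈ (A : Finset (Euc d)), z ∉ (B : Finset (Euc d)) := by
      by_contra! hsub
      exact hAB (Subtype.ext (Finset.eq_of_subset_of_card_le hsub
        (by rw [𝒯.card_eq A A.2, 𝒯.card_eq B B.2])))
    refine ⟨z, hz, Finset.eq_of_subset_of_card_le (fun a ha => ?_) ?_⟩
    · rw [Finset.mem_inter] at ha
      exact Finset.mem_erase.2 ⟨fun h' => hzB (h' ▸ ha.2), ha.1⟩
    · rw [Finset.card_erase_of_mem hz, 𝒯.card_eq A A.2]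
      omega
  obtain ⟨z, hz, e⟩ := hcard T T' hne h
  obtain ⟨z', hz', e'⟩ := hcard T' T hne.symm (by rwa [Finset.inter_comm])
  refine ⟨z, z', hne, hz, hz', ?_⟩
  have : (T : Finset (Euc d)).erase z = (T' : Finset (Euc d)).erase z' := by
    rw [← e, ← e', Finset.inter_comm]
  simpa using congrArg (fun A : Finset (Euc d) => (A : Set (Euc d))) this

/-- Any two elements are joined by a chain of elements with common faces. -/
lemma strongly_connected (hS : IsLipschitzDomain S) {A : Set 𝒯.elements}
    (hA : A.Nonempty) (hAs : ∀ T z T' z', 𝒯.Shared T z T' z' → T ∈ A → T' ∈ A) (T : 𝒯.elements) :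
    T ∈ A := by
  classical
  by_contra hTB
  obtain ⟨T₀, hT₀⟩ := hA
  have hclosed : ∀ A : Set 𝒯.elements, IsClosed (⋃ T ∈ A, 𝒯.cell T) := fun A =>
    (toFinite A).isClosed_biUnion fun T _ => (𝒯.isCompact_cell T).isClosed
  have hcov : closure S ⊆ (⋃ T ∈ A, 𝒯.cell T) ∪ ⋃ T ∈ Aᶜ, 𝒯.cell T := by
    intro x hx
    obtain ⟨T, hT⟩ := 𝒯.exists_mem_cell hx
    by_cases h : T ∈ A
    · exact Or.inl (mem_biUnion h hT)
    · exact Or.inr (mem_biUnion h hT)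
  have hintg : ∀ T, ∃ x ∈ S, x ∈ 𝒯.cell T := fun T => by
    obtain ⟨x, hx⟩ := 𝒯.interior_cell_nonempty T
    exact ⟨x, 𝒯.interior_cell_subset hS T hx, interior_subset hx⟩
  obtain ⟨x₀, hx₀S, hx₀⟩ := hintg T₀
  obtain ⟨x₁, hx₁S, hx₁⟩ := hintg T
  obtain ⟨x, hxS, hxA, hxB⟩ := isPreconnected_closed_iff.1 hS.isConnected.isPreconnected _ _
    (hclosed A) (hclosed Aᶜ) (subset_closure.trans hcov)
    ⟨x₀, hx₀S, mem_biUnion hT₀ hx₀⟩ ⟨x₁, hx₁S, mem_biUnion hTB hx₁⟩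
  obtain ⟨TA, hTA, hxTA⟩ := mem_iUnion₂.1 hxA
  obtain ⟨TB, hTB, hxTB⟩ := mem_iUnion₂.1 hxB
  obtain ⟨r, hr, hball⟩ := Metric.isOpen_iff.1 hS.isOpen x hxS
  obtain ⟨a, ha, haT⟩ := mem_closure_iff.1 (𝒯.cell_subset_closure_interior TA hxTA)
    (Metric.ball x r) Metric.isOpen_ball (Metric.mem_ball_self hr)
  have hne : (Metric.ball x r ∩ interior (𝒯.cell TB)).Nonempty :=
    mem_closure_iff.1 (𝒯.cell_subset_closure_interior TB hxTB)
      (Metric.ball x r) Metric.isOpen_ball (Metric.mem_ball_self hr)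
  have hopen : IsOpen (Metric.ball x r ∩ interior (𝒯.cell TB)) :=
    Metric.isOpen_ball.inter isOpen_interior
  -- With fewer than d common vertices, these and a are at most d points, whose affine span is null.
  -- A generic b near x avoids all such spans, so the segment from a to b can change from cells of A
  -- to the others only where two cells share d vertices, that is a face.
  have hbad : ∀ᵐ b : Euc d, ∀ T T' : 𝒯.elements,
      ((T : Finset (Euc d)) ∩ (T' : Finset (Euc d))).card + 1 ≤ d →
      b ∉ affineSpan ℝ ((insert a ((T : Finset (Euc d)) ∩ (T' : Finset (Euc d))) :
        Finset (Euc d)) : Set (Euc d)) := by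
    rw [ae_all_iff]
    intro T
    rw [ae_all_iff]
    intro T'
    rw [eventually_imp_distrib_left]
    intro hc
    exact measure_eq_zero_iff_ae_notMem.1
      (volume_affineSpan_eq_zero ((Finset.card_insert_le _ _).trans hc))
  obtain ⟨b, hb, hbT⟩ : ∃ b ∈ Metric.ball x r ∩ interior (𝒯.cell TB), ∀ T T' : 𝒯.elements,
      ((T : Finset (Euc d)) ∩ (T' : Finset (Euc d))).card + 1 ≤ d →
      b ∉ affineSpan ℝ ((insert a ((T : Finset (Euc d)) ∩ (T' : Finset (Euc d))) :
        Finset (Euc d)) : Set (Euc d)) := by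
    by_contra! hcon
    refine (hopen.measure_pos volume hne).ne' ?_
    rw [measure_eq_zero_iff_ae_notMem]
    filter_upwards [hbad] with b hb hb'
    obtain ⟨T, T', h1, h2⟩ := hcon b hb'
    exact hb T T' h1 h2
  have hseg : segment ℝ a b ⊆ S :=
    ((convex_ball x r).segment_subset ha hb.1).trans hball
  obtain ⟨y, hy, hyA, hyB⟩ := isPreconnected_closed_iff.1
    (convex_segment a b).isPreconnected _ _ (hclosed A) (hclosed Aᶜ)
    ((hseg.trans subset_closure).trans hcov)
    ⟨a, left_mem_segment ℝ a b, mem_biUnion hTA (interior_subset haT)⟩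
    ⟨b, right_mem_segment ℝ a b, mem_biUnion hTB (interior_subset hb.2)⟩
  obtain ⟨T₁, hT₁, hyT₁⟩ := mem_iUnion₂.1 hyA
  obtain ⟨T₂, hT₂, hyT₂⟩ := mem_iUnion₂.1 hyB
  have hne12 : T₁ ≠ T₂ := fun h => hT₂ (h ▸ hT₁)
  by_cases hc : ((T₁ : Finset (Euc d)) ∩ (T₂ : Finset (Euc d))).card + 1 ≤ d
  · refine hbT T₁ T₂ hc ?_
    obtain ⟨t, ht, rfl⟩ := (segment_eq_image' ℝ a b).subset hy
    -- The point a is interior to a cell, so it cannot be where two different cells meet.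
    have ht0 : t ≠ 0 := by
      rintro rfl
      simp only [zero_smul, add_zero] at hyT₁ hyT₂
      exact hne12 ((𝒯.eq_of_mem_interior haT hyT₁).symm.trans (𝒯.eq_of_mem_interior haT hyT₂))
    have hyW : a + t • (b - a) ∈ affineSpan ℝ
        ((insert a ((T₁ : Finset (Euc d)) ∩ (T₂ : Finset (Euc d))) :
          Finset (Euc d)) : Set (Euc d)) := by
      have h1 : a + t • (b - a) ∈ convexHull ℝ
          (((T₁ : Finset (Euc d)) : Set (Euc d)) ∩ (T₂ : Finset (Euc d))) := by
        rw [← 𝒯.conforming T₁ T₁.2 T₂ T₂.2]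
        exact ⟨hyT₁, hyT₂⟩
      refine affineSpan_mono ℝ ?_ (convexHull_subset_affineSpan _ h1)
      intro w hw
      simp only [Finset.coe_insert, Finset.coe_inter]
      exact Or.inr hw
    have haW : a ∈ affineSpan ℝ
        ((insert a ((T₁ : Finset (Euc d)) ∩ (T₂ : Finset (Euc d))) :
          Finset (Euc d)) : Set (Euc d)) :=
      subset_affineSpan ℝ _ (by simp)
    -- b = a + t⁻¹(y - a) lies on the line through two points of the span, against the choice of b.
    have := AffineMap.lineMap_mem t⁻¹ haW hyW
    rw [AffineMap.lineMap_apply] at this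
    simpa [smul_smul, inv_mul_cancel₀ ht0] using this
  · obtain ⟨z, z', h⟩ := 𝒯.shared_of_card_inter hne12 (by omega)
    exact hT₂ (hAs _ _ _ _ h hT₁)

/-- A bounded domain has a nonempty boundary, which has positive surface measure by `surf_pos`; so
the almost-everywhere covering by faces cannot be empty. -/
lemma exists_outer_face (hd : 1 ≤ d) {Ω : Set (Euc d)} (hΩ : IsLipschitzDomain Ω)
    (hΩb : Bornology.IsBounded Ω) (hS : IsLipschitzDomain S) (hSΩ : S ⊆ Ω)
    (hΓ : frontier Ω ⊆ frontier S) :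
    ∃ T : 𝒯.elements, ∃ z ∈ (T : Finset (Euc d)), face (T : Finset (Euc d)) z ⊆ frontier Ω := by
  have hne : (frontier Ω).Nonempty := by
    rw [nonempty_frontier_iff]
    refine ⟨hΩ.isConnected.nonempty, fun h => ?_⟩
    have : Nonempty (Fin d) := ⟨⟨0, hd⟩⟩
    rw [h] at hΩb
    exact NormedSpace.unbounded_univ ℝ (Euc d) hΩb
  obtain ⟨x, hx⟩ := hne
  by_contra! hcon
  refine hΩ.surf_pos hx univ_mem ?_
  rw [measure_eq_zero_iff_ae_notMem]
  filter_upwards [𝒯.ae_exists_face hΩ hS hSΩ hΓ] with y ⟨T, z, hz, h, _⟩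
  exact absurd h (hcon T z hz)

/-! ### The Raviart–Thomas space -/

/-- The local Raviart–Thomas space. -/
def IsRT (q : ℕ) (β : Fin d → Poly d) : Prop :=
  ∃ (a : Fin d → Poly d) (b : Poly d), (∀ i, (a i).totalDegree ≤ q) ∧
    b.totalDegree ≤ q ∧ ∀ i, β i = a i + b * MvPolynomial.X i

lemma IsRT.add {q : ℕ} {β γ : Fin d → Poly d} (hβ : IsRT q β) (hγ : IsRT q γ) :
    IsRT q (β + γ) := by
  obtain ⟨a, b, h1, h2, h3⟩ := hβ
  obtain ⟨a', b', h1', h2', h3'⟩ := hγ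
  refine ⟨a + a', b + b', fun i => ?_, ?_, fun i => ?_⟩
  · exact (MvPolynomial.totalDegree_add _ _).trans (max_le (h1 i) (h1' i))
  · exact (MvPolynomial.totalDegree_add _ _).trans (max_le h2 h2')
  · simp only [Pi.add_apply, h3, h3']
    ring

lemma IsRT.smul {q : ℕ} {β : Fin d → Poly d} (r : ℝ) (hβ : IsRT q β) : IsRT q (r • β) := by
  obtain ⟨a, b, h1, h2, h3⟩ := hβ
  refine ⟨r • a, r • b, fun i => ?_, ?_, fun i => ?_⟩
  · exact (MvPolynomial.totalDegree_smul_le r _).trans (h1 i)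
  · exact (MvPolynomial.totalDegree_smul_le r _).trans h2
  · simp only [Pi.smul_apply, h3, smul_add, smul_mul_assoc]

lemma isRT_zero (q : ℕ) : IsRT q (0 : Fin d → Poly d) :=
  ⟨0, 0, fun i => by simp, by simp, fun i => by simp⟩

lemma isRT_radial (q : ℕ) (z : Euc d) : IsRT q (radial z) := by
  refine ⟨fun i => -MvPolynomial.C (z i), 1, fun i => ?_, by simp, fun i => ?_⟩
  · rw [MvPolynomial.totalDegree_neg, MvPolynomial.totalDegree_C]
    exact Nat.zero_le _
  · rw [radial]
    ring

lemma IsRT.totalDegree_le {q : ℕ} {β : Fin d → Poly d} (hβ : IsRT q β) (i : Fin d) :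
    (β i).totalDegree ≤ q + 1 := by
  obtain ⟨a, b, h1, h2, h3⟩ := hβ
  rw [h3]
  refine (MvPolynomial.totalDegree_add _ _).trans (max_le ((h1 i).trans (Nat.le_succ q)) ?_)
  refine (MvPolynomial.totalDegree_mul _ _).trans ?_
  rw [MvPolynomial.totalDegree_X]
  omega

/-- The components have degree at most q + 1 and differentiation removes one. This inclusion makes
div τ_h an admissible test function. -/
lemma IsRT.totalDegree_pdiv_le {q : ℕ} {β : Fin d → Poly d} (hβ : IsRT q β) :
    (pdiv β).totalDegree ≤ q :=
  (MvPolynomial.totalDegree_finsetSum _ _).trans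
    (Finset.sup_le fun i _ => totalDegree_pderiv_le (hβ.totalDegree_le i) i)

/-- `RT^q_{Γᶜ}(𝒯)` as a subspace. -/
def RT₀Sub (Ω : Set (Euc d)) (q : ℕ) : Submodule ℝ 𝒯.PwVec where
  carrier := 𝒯.RT₀ Ω q
  add_mem' := by
    rintro σ τ ⟨⟨h1, h2⟩, h3⟩ ⟨⟨k1, k2⟩, k3⟩
    refine ⟨⟨fun T => IsRT.add (h1 T) (k1 T), fun T T' hT z hz z' hz' e x hx => ?_⟩,
      fun T z hz hF x hx => ?_⟩
    · have e1 := h2 T T' hT z hz z' hz' e x hx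
      have e2 := k2 T T' hT z hz z' hz' e x hx
      simp only [Pi.add_apply, vval_add]
      rw [add_sub_add_comm, inner_add_right, e1, e2, add_zero]
    · simp only [Pi.add_apply, vval_add]
      rw [inner_add_right, h3 T z hz hF x hx, k3 T z hz hF x hx, add_zero]
  zero_mem' := by
    refine ⟨⟨fun T => isRT_zero q, fun T T' hT z hz z' hz' e x hx => ?_⟩,
      fun T z hz hF x hx => ?_⟩ <;> simp
  smul_mem' := by
    rintro r σ ⟨⟨h1, h2⟩, h3⟩
    refine ⟨⟨fun T => IsRT.smul r (h1 T), fun T T' hT z hz z' hz' e x hx => ?_⟩,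
      fun T z hz hF x hx => ?_⟩
    · have e1 := h2 T T' hT z hz z' hz' e x hx
      simp only [Pi.smul_apply, vval_smul]
      rw [← smul_sub, inner_smul_right, e1, mul_zero]
    · simp only [Pi.smul_apply, vval_smul]
      rw [inner_smul_right, h3 T z hz hF x hx, mul_zero]

instance (Ω : Set (Euc d)) (q : ℕ) : FiniteDimensional ℝ (𝒯.RT₀Sub Ω q) := by
  let f : 𝒯.PwVec →ₗ[ℝ] (𝒯.elements × Fin d → Poly d) :=
    { toFun := fun σ i => σ i.1 i.2
      map_add' := fun _ _ => rfl
      map_smul' := fun _ _ => rfl }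
  have hf : Function.Injective f := fun σ τ h => by
    ext1 T
    ext1 i
    exact congrFun h (T, i)
  have : FiniteDimensional ℝ ((𝒯.RT₀Sub Ω q).map f) := by
    refine finiteDimensional_pi (q := q + 1) ?_
    rintro _ ⟨σ, hσ, rfl⟩ i
    exact IsRT.totalDegree_le (hσ.1.1 i.1) i.2
  exact Module.Finite.equiv ((𝒯.RT₀Sub Ω q).equivMapOfInjective f hf).symm

/-- Fields with constant normal components on the faces. -/
lemma mem_RT₀_of_flux (hd : 1 ≤ d) {Ω : Set (Euc d)} {q : ℕ} {σ : 𝒯.PwVec}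
    (h1 : ∀ T, IsRT q (σ T)) (c : 𝒯.elements → Euc d → ℝ)
    (hc : ∀ T : 𝒯.elements, ∀ z ∈ (T : Finset (Euc d)), ∀ x ∈ face (T : Finset (Euc d)) z,
      inner ℝ (outerNormal (T : Finset (Euc d)) z) (vval (σ T) x) = c T z)
    (h2 : ∀ T z T' z', 𝒯.Shared T z T' z' → c T z + c T' z' = 0)
    (h3 : ∀ T : 𝒯.elements, ∀ z ∈ (T : Finset (Euc d)), face (T : Finset (Euc d)) z ⊆ frontier S →
      (∃ x ∈ face (T : Finset (Euc d)) z, x ∉ frontier Ω) → c T z = 0) : σ ∈ 𝒯.RT₀ Ω q := by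
  refine ⟨⟨h1, fun T T' hT z hz z' hz' e x hx => ?_⟩, fun T z hz hF x hx => ?_⟩
  · have hsh : 𝒯.Shared T z T' z' := ⟨hT, hz, hz', e⟩
    have e2 := hc T' z' hz' x (by rw [← hsh.face_eq]; exact hx)
    rw [hsh.outerNormal_eq hd, inner_neg_left] at e2
    rw [inner_sub_right, hc T z hz x hx]
    linarith [h2 T z T' z' hsh]
  · rw [hc T z hz x hx.1, h3 T z hz hF ⟨x, hx.1, hx.2.2⟩]

open Classical in
lemma inner₁_single (T : 𝒯.elements) (β : Fin d → Poly d) (ρ : 𝒯.PwPoly) :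
    𝒯.inner₁ (𝒯.div (Pi.single T β)) ρ = ∫ x in 𝒯.cell T, pval (pdiv β) x * pval (ρ T) x := by
  rw [inner₁, Finset.sum_eq_single T]
  · simp [div]
  · intro T' _ hT'
    have : 𝒯.div (Pi.single T β) T' = 0 := by
      simp [div, Pi.single_eq_of_ne hT', pdiv]
    simp [this]
  · simp

open Classical in
lemma inner₁_single_radial (T : 𝒯.elements) {z : Euc d} (r : ℝ) {ρ : 𝒯.PwPoly} {c : ℝ}
    (hρ : ρ T = MvPolynomial.C c) :
    𝒯.inner₁ (𝒯.div (Pi.single T (r • radial z))) ρ = r * d * volume.real (𝒯.cell T) * c := by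
  rw [inner₁_single, pdiv_smul, pdiv_radial, hρ]
  simp only [pval_smul, pval_C, setIntegral_const, smul_eq_mul]
  ring

/-- The divergence maps `RT^q_{Γᶜ}(𝒯)` onto `P^q(𝒯)`. -/
lemma eq_zero_of_orthogonal_div (hd : 1 ≤ d) {Ω : Set (Euc d)} (hΩ : IsLipschitzDomain Ω)
    (hΩb : Bornology.IsBounded Ω) (hS : IsLipschitzDomain S) (hSΩ : S ⊆ Ω)
    (hΓ : frontier Ω ⊆ frontier S) {q : ℕ} {ρ : 𝒯.PwPoly} (hρ : ρ ∈ 𝒯.P q)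
    (h : ∀ σ ∈ 𝒯.RT₀ Ω q, 𝒯.inner₁ (𝒯.div σ) ρ = 0) : ρ = 0 := by
  classical
  -- Normal-free fields on one element extend by zero to members of the space, so the bubble lemma
  -- applies elementwise.
  have hC : ∀ T, ∃ c, ρ T = MvPolynomial.C c := by
    intro T
    refine eq_C_of_pgrad_eq_zero fun i =>
      (𝒯.isSimplex T).pgrad_eq_zero_of_bubble hd (hρ T) (fun β hβ hβ0 => ?_) i
    have hmem : (Pi.single T β : 𝒯.PwVec) ∈ 𝒯.RT₀ Ω q := by
      refine 𝒯.mem_RT₀_of_flux hd (fun T' => ?_) (fun _ _ => 0) (fun T' z hz x hx => ?_)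
        (fun _ _ _ _ _ => add_zero 0) (fun _ _ _ _ _ => rfl)
      · by_cases hT : T' = T
        · subst hT
          rw [Pi.single_eq_same]
          exact hβ
        · rw [Pi.single_eq_of_ne hT]
          exact isRT_zero q
      · by_cases hT : T' = T
        · subst hT
          rw [Pi.single_eq_same]
          exact hβ0 z hz x hx
        · rw [Pi.single_eq_of_ne hT]
          simp
    have := h _ hmem
    rwa [inner₁_single] at this
  choose c hc using hC
  have hvol : ∀ T, 0 < volume.real (𝒯.cell T) := fun T => (𝒯.isSimplex T).volume_hull_pos
  have hd0 : (0 : ℝ) < d := by exact_mod_cast hd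
  -- the normal component of a multiple of `radial z`
  have hflux : ∀ (T : 𝒯.elements) (r : ℝ), ∀ z ∈ (T : Finset (Euc d)),
      ∀ a ∈ (T : Finset (Euc d)), ∀ x ∈ face (T : Finset (Euc d)) a,
      inner ℝ (outerNormal (T : Finset (Euc d)) a) (vval (r • radial z) x) =
        if a = z then r * IsSimplex.height T z else 0 := by
    intro T r z hz a ha x hx
    rw [vval_smul, vval_radial, inner_smul_right,
      (𝒯.isSimplex T).inner_outerNormal_radial hd ha hz
        (((𝒯.isSimplex T).mem_face_iff ha).1 hx).2]
    split_ifs <;> simp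
  have hsame : ∀ T z T' z', 𝒯.Shared T z T' z' → c T = c T' := by
    intro T z T' z' hsh
    set h₁ := IsSimplex.height (T : Finset (Euc d)) z
    set h₂ := IsSimplex.height (T' : Finset (Euc d)) z'
    have hh₁ : 0 < h₁ := (𝒯.isSimplex T).height_pos hd hsh.mem
    have hh₂ : 0 < h₂ := (𝒯.isSimplex T').height_pos hd hsh.mem'
    -- The weights make the outward fluxes ± h₁h₂ through the common face cancel, and the other
    -- faces carry none. By |T| d = h₁|F| and |T'| d = h₂|F| the orthogonality becomes h₁h₂|F| (c T
    -- - c T') = 0.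
    set σ : 𝒯.PwVec := Pi.single T (h₂ • radial z) + Pi.single T' (-h₁ • radial z')
    have hσT : σ T = h₂ • radial z := by
      simp [σ, Pi.single_eq_of_ne hsh.ne]
    have hσT' : σ T' = -h₁ • radial z' := by
      simp [σ, Pi.single_eq_of_ne hsh.ne.symm]
    have hσ0 : ∀ T'', T'' ≠ T → T'' ≠ T' → σ T'' = 0 := by
      intro T'' e1 e2
      simp [σ, Pi.single_eq_of_ne e1, Pi.single_eq_of_ne e2]
    set fl : 𝒯.elements → Euc d → ℝ := fun A a =>
      if A = T ∧ a = z then h₂ * h₁ else if A = T' ∧ a = z' then -h₁ * h₂ else 0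
    have hmem : σ ∈ 𝒯.RT₀ Ω q := by
      refine 𝒯.mem_RT₀_of_flux hd (fun A => ?_) fl ?_ ?_ ?_
      · by_cases e1 : A = T
        · rw [e1, hσT]
          exact (isRT_radial q z).smul h₂
        · by_cases e2 : A = T'
          · rw [e2, hσT']
            exact (isRT_radial q z').smul (-h₁)
          · rw [hσ0 A e1 e2]
            exact isRT_zero q
      · intro A a ha x hx
        by_cases e1 : A = T
        · subst e1
          rw [hσT, hflux A h₂ z hsh.mem a ha x hx]
          simp [fl, hsh.ne, h₁]
        · by_cases e2 : A = T'
          · subst e2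
            rw [hσT', hflux A (-h₁) z' hsh.mem' a ha x hx]
            simp [fl, e1, h₂]
          · rw [hσ0 A e1 e2]
            simp [fl, e1, e2]
      · intro A a B b hAB
        by_cases e1 : A = T ∧ a = z
        · obtain ⟨rfl, rfl⟩ := e1
          obtain ⟨rfl, rfl⟩ := hsh.unique hd hAB
          simp [fl, hsh.ne.symm]
          ring
        · by_cases e2 : A = T' ∧ a = z'
          · obtain ⟨rfl, rfl⟩ := e2
            obtain ⟨rfl, rfl⟩ := hsh.symm.unique hd hAB
            simp [fl, hsh.ne.symm]
            ring
          · have e3 : ¬(B = T ∧ b = z) := by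
              rintro ⟨rfl, rfl⟩
              exact e2 (hsh.unique hd hAB.symm)
            have e4 : ¬(B = T' ∧ b = z') := by
              rintro ⟨rfl, rfl⟩
              exact e1 (hsh.symm.unique hd hAB.symm)
            simp only [fl, if_neg e1, if_neg e2, if_neg e3, if_neg e4, add_zero]
      · intro A a ha hF _
        have e1 : ¬(A = T ∧ a = z) := by
          rintro ⟨rfl, rfl⟩
          exact hsh.not_subset_frontier hd hS hF
        have e2 : ¬(A = T' ∧ a = z') := by
          rintro ⟨rfl, rfl⟩
          exact hsh.symm.not_subset_frontier hd hS hF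
        simp only [fl, if_neg e1, if_neg e2]
    have h0 := h σ hmem
    rw [← divL_apply, map_add, divL_apply, divL_apply, inner₁_add_left,
      𝒯.inner₁_single_radial T h₂ (hc T), 𝒯.inner₁_single_radial T' (-h₁) (hc T')] at h0
    have v1 := (𝒯.isSimplex T).volume_hull hd hsh.mem
    have v2 := (𝒯.isSimplex T').volume_hull hd hsh.mem'
    rw [← hsh.face_eq] at v2
    change (d : ℝ) * volume.real (𝒯.cell T) = h₁ * _ at v1
    change (d : ℝ) * volume.real (𝒯.cell T') = h₂ * _ at v2
    set m := (Measure.euclideanHausdorffMeasure (d - 1)).real (face (T : Finset (Euc d)) z)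
    have hm : 0 < m := by
      have : 0 < h₁ * m := by
        rw [← v1]
        exact mul_pos hd0 (hvol T)
      exact pos_of_mul_pos_right this hh₁.le
    rw [mul_assoc h₂, mul_assoc (-h₁), v1, v2] at h0
    have h5 : (h₂ * h₁ * m) * (c T - c T') = 0 := by linarith
    have h6 := (mul_eq_zero.1 h5).resolve_left (by positivity)
    linarith
  obtain ⟨T₀, z₀, hz₀, hF₀⟩ := 𝒯.exists_outer_face hd hΩ hΩb hS hSΩ hΓ
  -- A single radial field is admissible when its only flux passes through a face on Γ, where no
  -- condition is imposed; its divergence is a positive constant.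
  have hc₀ : c T₀ = 0 := by
    set fl : 𝒯.elements → Euc d → ℝ := fun A a =>
      if A = T₀ ∧ a = z₀ then 1 * IsSimplex.height (T₀ : Finset (Euc d)) z₀ else 0
    have hmem : (Pi.single T₀ ((1 : ℝ) • radial z₀) : 𝒯.PwVec) ∈ 𝒯.RT₀ Ω q := by
      refine 𝒯.mem_RT₀_of_flux hd (fun A => ?_) fl ?_ ?_ ?_
      · by_cases e1 : A = T₀
        · subst e1
          rw [Pi.single_eq_same]
          exact (isRT_radial q z₀).smul 1
        · rw [Pi.single_eq_of_ne e1]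
          exact isRT_zero q
      · intro A a ha x hx
        by_cases e1 : A = T₀
        · subst e1
          rw [Pi.single_eq_same, hflux A 1 z₀ hz₀ a ha x hx]
          simp [fl]
        · rw [Pi.single_eq_of_ne e1]
          simp [fl, e1]
      · intro A a B b hAB
        have e1 : ¬(A = T₀ ∧ a = z₀) := by
          rintro ⟨rfl, rfl⟩
          exact hAB.not_subset_frontier hd hS (hF₀.trans hΓ)
        have e2 : ¬(B = T₀ ∧ b = z₀) := by
          rintro ⟨rfl, rfl⟩
          exact hAB.symm.not_subset_frontier hd hS (hF₀.trans hΓ)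
        simp only [fl, if_neg e1, if_neg e2, add_zero]
      · rintro A a ha hF ⟨x, hx, hxΩ⟩
        have e1 : ¬(A = T₀ ∧ a = z₀) := by
          rintro ⟨rfl, rfl⟩
          exact hxΩ (hF₀ hx)
        simp only [fl, if_neg e1]
    have h0 := h _ hmem
    rw [𝒯.inner₁_single_radial T₀ 1 (hc T₀), one_mul] at h0
    exact (mul_eq_zero.1 h0).resolve_left (mul_pos hd0 (hvol T₀)).ne'
  ext1 T
  have := 𝒯.strongly_connected hS (A := {T | c T = 0}) ⟨T₀, hc₀⟩
    (fun A a B b hAB hA => (hsame A a B b hAB).symm.trans hA) T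
  rw [hc, this, map_zero]
  rfl

end Triangulation

namespace Triangulation

variable {S : Set (Euc d)} (𝒯 : Triangulation S)

/-! ### The mixed problem -/

lemma normalTrace_add (σ τ : 𝒯.PwVec) (x : Euc d) :
    𝒯.normalTrace (σ + τ) x = 𝒯.normalTrace σ x + 𝒯.normalTrace τ x := by
  simp only [normalTrace, ← Finset.sum_add_distrib]
  refine Finset.sum_congr rfl fun T _ => Finset.sum_congr rfl fun z _ => ?_
  split_ifs
  · rw [Pi.add_apply, vval_add, inner_add_right]
  · rw [add_zero]

lemma normalTrace_smul (r : ℝ) (σ : 𝒯.PwVec) (x : Euc d) :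
    𝒯.normalTrace (r • σ) x = r * 𝒯.normalTrace σ x := by
  simp only [normalTrace, Finset.mul_sum]
  refine Finset.sum_congr rfl fun T _ => Finset.sum_congr rfl fun z _ => ?_
  split_ifs
  · rw [Pi.smul_apply, vval_smul, inner_smul_right]
  · rw [mul_zero]

lemma memLp_normalTrace {μ : Measure (Euc d)} [IsFiniteMeasure μ] (σ : 𝒯.PwVec) :
    MemLp (𝒯.normalTrace σ) 2 μ := by
  classical
  have : 𝒯.normalTrace σ = fun x => ∑ T : 𝒯.elements, ∑ z ∈ (T : Finset (Euc d)),
      if face (T : Finset (Euc d)) z ⊆ frontier S then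
        (face (T : Finset (Euc d)) z).indicator (fun x =>
          inner ℝ (outerNormal (T : Finset (Euc d)) z) (vval (σ T) x)) x else 0 := by
    funext x
    refine Finset.sum_congr rfl fun T _ => Finset.sum_congr rfl fun z _ => ?_
    by_cases h1 : face (T : Finset (Euc d)) z ⊆ frontier S <;>
      by_cases h2 : x ∈ face (T : Finset (Euc d)) z <;> simp [h1, h2]
  rw [this]
  refine memLp_finsetSum _ fun T _ => memLp_finsetSum _ fun z _ => ?_
  by_cases h1 : face (T : Finset (Euc d)) z ⊆ frontier S
  · simp only [h1, if_true]
    have hK := IsSimplex.isCompact_face (T : Finset (Euc d)) z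
    have hc : Continuous fun x => inner ℝ (outerNormal (T : Finset (Euc d)) z) (vval (σ T) x) :=
      continuous_const.inner (continuous_vval _)
    obtain ⟨C, hC⟩ := hK.exists_bound_of_continuousOn hc.continuousOn
    refine (memLp_indicator_iff_restrict hK.measurableSet).2 (MemLp.of_bound
      hc.aestronglyMeasurable C ?_)
    filter_upwards [ae_restrict_mem hK.measurableSet] with x hx
    exact hC x hx
  · simp [h1]

lemma integrable_mul_normalTrace {Ω : Set (Euc d)} [IsFiniteMeasure (surf Ω)] (f : L2Bdry Ω)
    (σ : 𝒯.PwVec) : Integrable (fun x => f x * 𝒯.normalTrace σ x) (surf Ω) :=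
  (Lp.memLp f).integrable_mul (𝒯.memLp_normalTrace σ)

/-- The boundary pairing as a linear functional of the field. -/
def bdryPairingL {Ω : Set (Euc d)} [IsFiniteMeasure (surf Ω)] (f : L2Bdry Ω) :
    𝒯.PwVec →ₗ[ℝ] ℝ where
  toFun := 𝒯.bdryPairing f
  map_add' σ τ := by
    simp only [bdryPairing, normalTrace_add, mul_add]
    exact integral_add (𝒯.integrable_mul_normalTrace f σ) (𝒯.integrable_mul_normalTrace f τ)
  map_smul' r σ := by
    simp only [bdryPairing, normalTrace_smul, RingHom.id_apply, smul_eq_mul]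
    rw [← integral_const_mul]
    exact integral_congr_ae (Eventually.of_forall fun x => by ring)

/-- The two equations form one bilinear form on the product space. A kernel element (τ, ρ), tested
with τ in the first and ρ in the second equation, has τ = 0; then ρ is orthogonal to all divergences
and vanishes by `eq_zero_of_orthogonal_div`. -/
theorem existsUnique_mixed (hd : 1 ≤ d) {Ω : Set (Euc d)} (hΩ : IsLipschitzDomain Ω)
    (hΩb : Bornology.IsBounded Ω) (hS : IsLipschitzDomain S) (hSΩ : S ⊆ Ω)
    (hΓ : frontier Ω ⊆ frontier S) (q : ℕ) (f : L2Bdry Ω) :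
    ∃! z : 𝒯.PwVec × 𝒯.PwPoly, 𝒯.IsMixedSolution q f z.1 z.2 := by
  have := isFiniteMeasure_surf hd hΩ hS 𝒯 hSΩ hΓ
  let V : Submodule ℝ (𝒯.PwVec × 𝒯.PwPoly) := (𝒯.RT₀Sub Ω q).prod (𝒯.PSub q)
  have : FiniteDimensional ℝ V := Module.Finite.iff_fg.2
    ((Module.Finite.iff_fg.1 inferInstance).prod (Module.Finite.iff_fg.1 inferInstance))
  let p₁ := LinearMap.fst ℝ 𝒯.PwVec 𝒯.PwPoly
  let p₂ := LinearMap.snd ℝ 𝒯.PwVec 𝒯.PwPoly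
  let B : (𝒯.PwVec × 𝒯.PwPoly) →ₗ[ℝ] (𝒯.PwVec × 𝒯.PwPoly) →ₗ[ℝ] ℝ :=
    𝒯.form₂.compl₁₂ p₁ p₁ + 𝒯.form₁.compl₁₂ p₂ (𝒯.divL ∘ₗ p₁) +
      𝒯.form₁.compl₁₂ (𝒯.divL ∘ₗ p₁) p₂
  have hB : ∀ a b, B a b = 𝒯.inner₂ a.1 b.1 + 𝒯.inner₁ (𝒯.div b.1) a.2 +
      𝒯.inner₁ (𝒯.div a.1) b.2 := fun a b => by
    rw [𝒯.inner₁_comm (𝒯.div b.1)]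
    rfl
  have hdef : ∀ a ∈ V, (∀ b ∈ V, B a b = 0) → a = 0 := by
    rintro ⟨τ, ρ⟩ ⟨hτ, hρ⟩ h
    have h1 : ∀ σ ∈ 𝒯.RT₀ Ω q, 𝒯.inner₂ τ σ + 𝒯.inner₁ (𝒯.div σ) ρ = 0 := fun σ hσ => by
      have := h (σ, 0) ⟨hσ, (𝒯.PSub q).zero_mem⟩
      rwa [hB, ← 𝒯.form₁_apply _ (0 : 𝒯.PwPoly), map_zero, add_zero] at this
    have h2 : 𝒯.inner₁ (𝒯.div τ) ρ = 0 := by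
      have := h (0, ρ) ⟨(𝒯.RT₀Sub Ω q).zero_mem, hρ⟩
      rw [hB, ← 𝒯.form₂_apply _ (0 : 𝒯.PwVec), map_zero, ← 𝒯.divL_apply, map_zero,
        ← 𝒯.form₁_apply 0, map_zero, LinearMap.zero_apply] at this
      simpa using this
    have h3 : τ = 0 := by
      refine 𝒯.eq_zero_of_inner₂_self ?_
      have := h1 τ hτ
      rwa [h2, add_zero] at this
    have h4 : ρ = 0 := by
      refine 𝒯.eq_zero_of_orthogonal_div hd hΩ hΩb hS hSΩ hΓ hρ fun σ hσ => ?_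
      have := h1 σ hσ
      rwa [h3, ← 𝒯.form₂_apply 0, map_zero, LinearMap.zero_apply, zero_add] at this
    rw [h3, h4]
    rfl
  have hsol : ∀ a : 𝒯.PwVec × 𝒯.PwPoly, 𝒯.IsMixedSolution q f a.1 a.2 ↔
      a ∈ V ∧ ∀ b ∈ V, B a b = 𝒯.bdryPairing f b.1 := by
    rintro ⟨τ, ρ⟩
    constructor
    · rintro ⟨h1, h2, h3, h4⟩
      refine ⟨⟨h1, h2⟩, ?_⟩
      rintro ⟨σ, ψ⟩ ⟨hσ, hψ⟩
      rw [hB, h3 σ hσ, h4 ψ hψ, add_zero]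
    · rintro ⟨⟨h1, h2⟩, h⟩
      refine ⟨h1, h2, fun σ hσ => ?_, fun ψ hψ => ?_⟩
      · have := h (σ, 0) ⟨hσ, (𝒯.PSub q).zero_mem⟩
        rwa [hB, ← 𝒯.form₁_apply _ (0 : 𝒯.PwPoly), map_zero, add_zero] at this
      · have := h (0, ψ) ⟨(𝒯.RT₀Sub Ω q).zero_mem, hψ⟩
        rw [hB, ← 𝒯.form₂_apply _ (0 : 𝒯.PwVec), map_zero, ← 𝒯.divL_apply, map_zero,
          ← 𝒯.form₁_apply 0, map_zero, LinearMap.zero_apply,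
          show 𝒯.bdryPairing f (0 : 𝒯.PwVec) = 𝒯.bdryPairingL f 0 from rfl, map_zero] at this
        simpa using this
  obtain ⟨a, ha, hab⟩ := exists_forall_form_eq V B hdef
    ((𝒯.bdryPairingL f ∘ₗ p₁).domRestrict V)
  refine ⟨a, (hsol a).2 ⟨ha, fun b hb => hab ⟨b, hb⟩⟩, fun a' ha' => ?_⟩
  obtain ⟨h1, h2⟩ := (hsol a').1 ha'
  refine sub_eq_zero.1 (hdef _ (V.sub_mem h1 ha) fun b hb => ?_)
  rw [map_sub, LinearMap.sub_apply, h2 b hb, hab ⟨b, hb⟩]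
  exact sub_self _

end Triangulation

/-! ### Mollification with shifted kernels -/

open scoped Convolution

/-- `y ↦ ∫ F(x) H(x - y) dx` is continuous for `F, H ∈ L²`. -/
lemma continuous_correlation {F H : Euc d → ℝ} (hF : MemLp F 2) (hH : MemLp H 2) :
    Continuous fun y => ∫ x, F x * H (x - y) := by
  have hfact : Fact ((2 : ℝ≥0∞) ≠ ⊤) := ⟨by simp⟩
  have hc : Continuous fun y : Euc d =>
      inner ℝ ((DomAddAct.mk (-y) : (Euc d)ᵈᵃᵃ) +ᵥ hH.toLp H) (hF.toLp F) := by
    refine Continuous.inner ?_ continuous_const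
    exact (DomAddAct.continuous_mk.comp continuous_neg).vadd continuous_const
  refine hc.congr fun y => ?_
  rw [L2.inner_def]
  refine integral_congr_ae ?_
  rw [DomAddAct.mk_vadd_toLp]
  filter_upwards [hF.coeFn_toLp, (hH.comp_measurePreserving
    (measurePreserving_vadd (-y) volume)).coeFn_toLp] with x h1 h2
  rw [h1]
  refine (congrArg (fun t => inner ℝ t (F x)) h2).trans ?_
  simp [sub_eq_neg_add]

/-- Fubini's theorem; the integrand is dominated through |F||H| ≤ F² + H², each term of which is
integrable against |k|. -/
lemma integral_mul_convolution {k F H : Euc d → ℝ} (hk : Continuous k) (hkc : HasCompactSupport k)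
    (hF : MemLp F 2) (hH : MemLp H 2) :
    ∫ x, F x * (k ⋆[ContinuousLinearMap.lsmul ℝ ℝ, volume] H) x =
      ∫ y, k y * ∫ x, F x * H (x - y) := by
  have hki : Integrable k := hk.integrable_of_hasCompactSupport hkc
  have hH2 : Integrable (fun x => H x ^ 2) := hH.integrable_sq
  have hF2 : Integrable (fun x => F x ^ 2) := hF.integrable_sq
  have i1 : Integrable (fun p : Euc d × Euc d => F p.1 ^ 2 * ‖k p.2‖) (volume.prod volume) :=
    hF2.mul_prod hki.norm
  have i2 : Integrable (fun p : Euc d × Euc d => ‖k p.2‖ * H (p.1 - p.2) ^ 2)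
      (volume.prod volume) :=
    hki.norm.convolution_integrand (ContinuousLinearMap.lsmul ℝ ℝ) hH2
  have m0 : AEStronglyMeasurable (fun p : Euc d × Euc d => k p.2 * H (p.1 - p.2))
      (volume.prod volume) :=
    hki.aestronglyMeasurable.convolution_integrand (ContinuousLinearMap.lsmul ℝ ℝ)
      hH.aestronglyMeasurable
  have hintg : Integrable (fun p : Euc d × Euc d => F p.1 * (k p.2 * H (p.1 - p.2)))
      (volume.prod volume) := by
    refine (i1.add i2).mono' (hF.aestronglyMeasurable.comp_fst.mul m0)
      (Eventually.of_forall fun p => ?_)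
    simp only [Pi.add_apply, norm_mul, Real.norm_eq_abs]
    have h0 := abs_nonneg (k p.2)
    have h1 : |F p.1| * |H (p.1 - p.2)| ≤ F p.1 ^ 2 + H (p.1 - p.2) ^ 2 := by
      rw [← sq_abs (F p.1), ← sq_abs (H _)]
      nlinarith [sq_nonneg (|F p.1| - |H (p.1 - p.2)|), sq_nonneg (|F p.1|),
        sq_nonneg (|H (p.1 - p.2)|)]
    nlinarith [mul_le_mul_of_nonneg_left h1 h0]
  have e1 : ∀ x, F x * (k ⋆[ContinuousLinearMap.lsmul ℝ ℝ, volume] H) x =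
      ∫ y, F x * (k y * H (x - y)) := fun x => by
    rw [integral_const_mul]
    rfl
  simp_rw [e1]
  rw [integral_integral_swap hintg]
  refine integral_congr_ae (Eventually.of_forall fun y => ?_)
  simp only
  rw [← integral_const_mul]
  exact integral_congr_ae (Eventually.of_forall fun x => by ring)

/-- Weak convergence of mollifications whose kernels concentrate at the origin. -/
lemma tendsto_integral_mul_convolution {k : ℕ → Euc d → ℝ} (hk : ∀ n, Continuous (k n))
    (hkc : ∀ n, HasCompactSupport (k n)) (hk0 : ∀ n x, 0 ≤ k n x) (hk1 : ∀ n, ∫ x, k n x = 1)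
    (hks : Tendsto (fun n => Function.support (k n)) atTop (𝓝 0).smallSets)
    {F H : Euc d → ℝ} (hF : MemLp F 2) (hH : MemLp H 2) :
    Tendsto (fun n => ∫ x, F x * (k n ⋆[ContinuousLinearMap.lsmul ℝ ℝ, volume] H) x) atTop
      (𝓝 (∫ x, F x * H x)) := by
  -- The integral is the k_n-average of the correlation y ↦ ∫ F(x) H(x - y) dx, a continuous
  -- function, so it tends to the value at y = 0.
  have hc := continuous_correlation hF hH
  have hc' : Continuous fun y => ∫ x, F x * H (x + y) := by
    refine (hc.comp continuous_neg).congr fun y => ?_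
    simp
  have := convolution_tendsto_right (μ := (volume : Measure (Euc d))) (φ := k) (l := atTop)
    (g := fun _ => fun y => ∫ x, F x * H (x + y)) (x₀ := 0) (k := fun _ => 0)
    (z₀ := ∫ x, F x * H x) (Eventually.of_forall hk0) (Eventually.of_forall hk1) hks
    (Eventually.of_forall fun _ => hc'.aestronglyMeasurable) ?_ tendsto_const_nhds
  · refine this.congr fun n => ?_
    rw [integral_mul_convolution (hk n) (hkc n) hF hH]
    simp [convolution, sub_eq_add_neg]
  · have h := (hc'.tendsto 0).comp (tendsto_snd (f := (atTop : Filter ℕ)) (g := 𝓝 (0 : Euc d)))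
    simp only [add_zero] at h
    exact h

lemma fderiv_convolution_apply {k H : Euc d → ℝ} (hk : ContDiff ℝ ∞ k) (hkc : HasCompactSupport k)
    (hH : LocallyIntegrable H) (x v : Euc d) :
    fderiv ℝ (k ⋆[ContinuousLinearMap.lsmul ℝ ℝ, volume] H) x v =
      ∫ y, fderiv ℝ k (x - y) v * H y := by
  have h1 : ContDiff ℝ 1 k := hk.of_le (by simp)
  rw [(hkc.hasFDerivAt_convolution_left (ContinuousLinearMap.lsmul ℝ ℝ) h1 hH x).fderiv]
  have hex : ConvolutionExistsAt (fderiv ℝ k) H x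
      ((ContinuousLinearMap.lsmul ℝ ℝ).precompL (Euc d)) volume :=
    (hkc.fderiv ℝ).convolutionExists_left _ (h1.continuous_fderiv one_ne_zero) hH x
  rw [convolution, ContinuousLinearMap.integral_apply hex,
    ← integral_sub_left_eq_self _ volume x]
  refine integral_congr_ae (Eventually.of_forall fun y => ?_)
  simp [ContinuousLinearMap.precompL]

/-! ### Shifts at the boundary and localisation. -/

/-- Points of the closure of a Lipschitz domain, shifted in a suitable direction, lie in the
domain. -/
lemma IsLipschitzDomain.exists_shift {Ω : Set (Euc d)} (hΩ : IsLipschitzDomain Ω) {x₀ : Euc d}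
    (hx₀ : x₀ ∈ closure Ω) : ∃ r > 0, ∀ δ > 0, ∃ (c : Euc d) (ε : ℝ), 0 < ε ∧ ‖c‖ + ε < δ ∧
      ∀ x ∈ Metric.ball x₀ r, ∀ y ∈ Metric.ball x₀ r, ‖x - y - c‖ ≤ ε → x ∈ closure Ω → y ∈ Ω := by
  by_cases hx : x₀ ∈ Ω
  · obtain ⟨r, hr, h⟩ := Metric.isOpen_iff.1 hΩ.isOpen x₀ hx
    exact ⟨r, hr, fun δ hδ => ⟨0, δ / 2, by positivity, by simpa using hδ, fun _ _ y hy _ _ => h hy⟩⟩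
  · have hf : x₀ ∈ frontier Ω := ⟨hx₀, by rwa [hΩ.isOpen.interior_eq]⟩
    obtain ⟨e, L, ρ, he, hL, hLip, hc, hρ, -, hev⟩ := hΩ.exists_local_graph hf
    obtain ⟨r, hr, h⟩ := Metric.eventually_nhds_iff_ball.1 hev
    refine ⟨r, hr, fun δ hδ => ?_⟩
    -- Shift by c = t e: moving down raises ρ by t, and the error ε costs at most Lε < t, so ρ(y) ≥
    -- ρ(x) + t - Lε > 0. The factor 3 leaves room for ‖c‖ + ε ≤ 2t < δ.
    set t := δ / 3
    have ht : 0 < t := by positivity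
    set ε := min t (t / (L + 1) / 2)
    have hε : 0 < ε := by positivity
    have hLε : L * ε < t := by
      have h1 : ε ≤ t / (L + 1) / 2 := min_le_right _ _
      have h2 : L * ε ≤ (L + 1) * (t / (L + 1) / 2) := by
        gcongr
        linarith
      have h3 : (L + 1) * (t / (L + 1) / 2) = t / 2 := by
        field_simp
      linarith
    refine ⟨t • e, ε, hε, ?_, fun x hx y hy hxy hxc => ?_⟩
    · have : ε ≤ t := min_le_left _ _
      rw [norm_smul, he, Real.norm_of_nonneg ht.le]
      simp only [t] at *
      linarith
    · have hx0 : 0 ≤ ρ x := by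
        by_contra! hneg
        have : ∀ᶠ w in 𝓝 x, w ∉ Ω := by
          filter_upwards [Metric.isOpen_ball.mem_nhds hx, (hc.tendsto x).eventually_lt_const hneg]
            with w hw hw' hwΩ
          exact absurd ((h w hw).1 hwΩ) (by linarith)
        exact (mem_closure_iff_frequently.1 hxc) this
      refine (h y hy).2 ?_
      have h1 := hLip (x + (-t) • e) y
      rw [hρ] at h1
      have h2 : x + (-t) • e - y = x - y - t • e := by
        rw [neg_smul]
        abel
      rw [h2] at h1
      have h3 : L * ‖x - y - t • e‖ ≤ L * ε := by gcongr
      linarith [(abs_le.1 h1).2]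

/-- A local-to-global principle for first-order distributional identities up to the boundary. -/
lemma integral_eq_zero_of_locally {Ω : Set (Euc d)} (hΩ : IsOpen Ω) (hΩb : Bornology.IsBounded Ω)
    {a : Euc d → ℝ} {b : Fin d → Euc d → ℝ} (ha : IntegrableOn a Ω)
    (hb : ∀ i, IntegrableOn (b i) Ω)
    (hloc : ∀ x₀ ∈ closure Ω, ∃ r > 0, ∀ χ : Euc d → ℝ, ContDiff ℝ ∞ χ → HasCompactSupport χ →
      tsupport χ ⊆ Metric.ball x₀ r →
      ∫ x in Ω, (χ x * a x + ∑ i, fderiv ℝ χ x (EuclideanSpace.single i 1) * b i x) = 0) :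
    ∫ x in Ω, a x = 0 := by
  have hintg : ∀ χ : Euc d → ℝ, ContDiff ℝ ∞ χ → HasCompactSupport χ → IntegrableOn
      (fun x => χ x * a x + ∑ i, fderiv ℝ χ x (EuclideanSpace.single i 1) * b i x) Ω := by
    intro χ h1 h2
    refine Integrable.add ?_ (integrable_finsetSum _ fun i _ => ?_)
    · obtain ⟨C, hC⟩ := h2.exists_bound_of_continuous h1.continuous
      exact ha.bdd_mul h1.continuous.aestronglyMeasurable (Eventually.of_forall hC)
    · have hc : Continuous fun x => fderiv ℝ χ x (EuclideanSpace.single i 1) :=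
        (h1.continuous_fderiv (by simp)).clm_apply continuous_const
      obtain ⟨C, hC⟩ := (h2.fderiv_apply ℝ (EuclideanSpace.single i 1)).exists_bound_of_continuous hc
      exact (hb i).bdd_mul hc.aestronglyMeasurable (Eventually.of_forall hC)
  let Λ : (Euc d → ℝ) → ℝ := fun χ =>
    ∫ x in Ω, (χ x * a x + ∑ i, fderiv ℝ χ x (EuclideanSpace.single i 1) * b i x)
  have hadd : ∀ χ χ' : Euc d → ℝ, ContDiff ℝ ∞ χ → HasCompactSupport χ → ContDiff ℝ ∞ χ' →
      HasCompactSupport χ' → Λ (χ + χ') = Λ χ + Λ χ' := by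
    intro χ χ' h1 h2 h1' h2'
    simp only [Λ]
    rw [← integral_add (hintg χ h1 h2) (hintg χ' h1' h2')]
    refine integral_congr_ae (Eventually.of_forall fun x => ?_)
    simp only [Pi.add_apply]
    rw [fderiv_add (h1.differentiable (by simp) x) (h1'.differentiable (by simp) x)]
    simp only [_root_.add_apply, add_mul, Finset.sum_add_distrib]
    ring
  have hK : IsCompact (closure Ω) := hΩb.isCompact_closure
  -- Compact induction on the existence of a cut-off θ = 1 on A with Λ(χθ) = 0 for every smooth χ.
  -- For unions θ + (1 - θ)θ' works, because the factor 1 - θ is absorbed into χ. On the closure of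
  -- Ω one gets θ = 1, and its derivatives vanish in Ω.
  obtain ⟨θ, h1, h2, h3, h4⟩ := hK.induction_on
    (p := fun A => ∃ θ : Euc d → ℝ, ContDiff ℝ ∞ θ ∧ HasCompactSupport θ ∧ (∀ x ∈ A, θ x = 1) ∧
      ∀ χ : Euc d → ℝ, ContDiff ℝ ∞ χ → Λ (χ * θ) = 0)
    ⟨0, contDiff_const, HasCompactSupport.zero, by simp, fun χ _ => by simp [Λ]⟩
    (fun A B hAB ⟨θ, h1, h2, h3, h4⟩ => ⟨θ, h1, h2, fun x hx => h3 x (hAB hx), h4⟩)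
    (fun A B ⟨θ, h1, h2, h3, h4⟩ ⟨θ', h1', h2', h3', h4'⟩ => by
      refine ⟨θ + (1 - θ) * θ', h1.add ((contDiff_const.sub h1).mul h1'), h2.add h2'.mul_left,
        ?_, fun χ hχ => ?_⟩
      · rintro x (hx | hx)
        · simp [h3 x hx]
        · simp [h3' x hx]
      · rw [mul_add, ← mul_assoc, hadd (χ * θ) (χ * (1 - θ) * θ') (hχ.mul h1) h2.mul_left
          ((hχ.mul (contDiff_const.sub h1)).mul h1') h2'.mul_left, h4 χ hχ,
          h4' (χ * (1 - θ)) (hχ.mul (contDiff_const.sub h1)), add_zero])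
    (fun x hx => by
      obtain ⟨r, hr, hχ⟩ := hloc x hx
      let f : ContDiffBump x := ⟨r / 4, r / 2, by positivity, by linarith⟩
      refine ⟨Metric.ball x (r / 4), mem_nhdsWithin_of_mem_nhds (Metric.ball_mem_nhds x
        (by positivity)), f, f.contDiff, f.hasCompactSupport, fun y hy =>
        f.one_of_mem_closedBall (Metric.ball_subset_closedBall hy), fun χ h => ?_⟩
      refine hχ _ (h.mul f.contDiff) f.hasCompactSupport.mul_left ?_
      refine (tsupport_mul_subset_right).trans ?_
      rw [f.tsupport_eq]
      exact Metric.closedBall_subset_ball (by change r / 2 < r; linarith))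
  have h := h4 1 contDiff_const
  rw [one_mul] at h
  rw [← h]
  refine setIntegral_congr_fun hΩ.measurableSet fun x hx => ?_
  have hev : θ =ᶠ[𝓝 x] fun _ => 1 := by
    filter_upwards [hΩ.mem_nhds hx] with y hy
    exact h3 y (subset_closure hy)
  simp only [hev.fderiv_eq, hev.eq_of_nhds]
  simp

open scoped Convolution

lemma convolution_apply_sub (k H : Euc d → ℝ) (x : Euc d) :
    (k ⋆[ContinuousLinearMap.lsmul ℝ ℝ, volume] H) x = ∫ y, k (x - y) * H y := by
  rw [convolution, ← integral_sub_left_eq_self _ volume x]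
  simp

/-! ### Mollifying a cut-off and zero-extended function. -/

section Local

variable {Ω : Set (Euc d)}

lemma fderiv_mul_reflect {k χ : Euc d → ℝ} (hk : ContDiff ℝ ∞ k) (hχ : ContDiff ℝ ∞ χ)
    (x y v : Euc d) : fderiv ℝ (fun y => k (x - y) * χ y) y v =
      k (x - y) * fderiv ℝ χ y v - fderiv ℝ k (x - y) v * χ y := by
  have h1 : HasFDerivAt (fun y => k (x - y)) (-(fderiv ℝ k (x - y))) y := by
    have := ((hk.differentiable (by simp)) (x - y)).hasFDerivAt.comp y
      ((hasFDerivAt_id y).const_sub x)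
    convert! this using 1
    ext w
    simp
  have h2 := ((hχ.differentiable (by simp)) y).hasFDerivAt
  have h3 : HasFDerivAt (fun y => k (x - y) * χ y) _ y := h1.mul h2
  rw [h3.fderiv]
  simp
  ring

lemma contDiff_mul_reflect {k χ : Euc d → ℝ} (hk : ContDiff ℝ ∞ k) (hχ : ContDiff ℝ ∞ χ)
    (x : Euc d) : ContDiff ℝ ∞ fun y => k (x - y) * χ y :=
  (hk.comp (contDiff_const.sub contDiff_id)).mul hχ

lemma integrable_mul_of_hasCompactSupport {f g : Euc d → ℝ} {μ : Measure (Euc d)}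
    [IsFiniteMeasureOnCompacts μ] (hf : MemLp f 2 μ) (hg : Continuous g)
    (hgc : HasCompactSupport g) : Integrable (fun x => f x * g x) μ :=
  hf.integrable_mul (q := 2) (hg.memLp_of_hasCompactSupport hgc)

/-- The zero extension of `χ φ`. -/
def cut (Ω : Set (Euc d)) (χ φ : Euc d → ℝ) : Euc d → ℝ := Ω.indicator fun x => χ x * φ x

lemma memLp_cut (hΩ : MeasurableSet Ω) {χ φ : Euc d → ℝ} (hχ : Continuous χ)
    (hχc : HasCompactSupport χ) (hφ : MemLp φ 2 (volume.restrict Ω)) :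
    MemLp (cut Ω χ φ) 2 := by
  refine (memLp_indicator_iff_restrict hΩ).2 ?_
  obtain ⟨C, hC⟩ := hχc.exists_bound_of_continuous hχ
  refine (hφ.const_mul C).mono (hχ.aestronglyMeasurable.mul hφ.aestronglyMeasurable)
    (Eventually.of_forall fun x => ?_)
  rw [norm_mul, norm_mul]
  gcongr
  exact (hC x).trans (le_abs_self C)

lemma hasCompactSupport_cut {χ : Euc d → ℝ} (hχc : HasCompactSupport χ) (φ : Euc d → ℝ) :
    HasCompactSupport (cut Ω χ φ) := by
  refine hχc.mono fun x hx => ?_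
  rw [Function.mem_support] at hx ⊢
  contrapose! hx
  simp [cut, hx]

/-- The hypothesis is the weak-gradient identity of φ tested with y ↦ k(x - y)χ(y). It moves the
derivative from the kernel onto χφ without a boundary term, so it is required only at those x for
which this test function is admissible. -/
lemma fderiv_convolution_cut (hΩ : MeasurableSet Ω) {φ G χ k : Euc d → ℝ} {i : Fin d}
    (hφ : MemLp φ 2 (volume.restrict Ω)) (hG : MemLp G 2 (volume.restrict Ω))
    (hχ : ContDiff ℝ ∞ χ) (hχc : HasCompactSupport χ) (hk : ContDiff ℝ ∞ k)
    (hkc : HasCompactSupport k) {x : Euc d}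
    (h : ∫ y in Ω, (φ y * fderiv ℝ (fun y => k (x - y) * χ y) y (EuclideanSpace.single i 1) +
      G y * (k (x - y) * χ y)) = 0) :
    fderiv ℝ (k ⋆[ContinuousLinearMap.lsmul ℝ ℝ, volume] cut Ω χ φ) x
        (EuclideanSpace.single i 1) =
      (k ⋆[ContinuousLinearMap.lsmul ℝ ℝ, volume] (cut Ω χ G +
        cut Ω (fun y => fderiv ℝ χ y (EuclideanSpace.single i 1)) φ)) x := by
  set e : Euc d := EuclideanSpace.single i 1
  have hdχ : Continuous fun y => fderiv ℝ χ y e :=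
    (hχ.continuous_fderiv (by simp)).clm_apply continuous_const
  have hdk : Continuous fun y => fderiv ℝ k (x - y) e :=
    ((hk.continuous_fderiv (by simp)).comp (continuous_const.sub continuous_id)).clm_apply
      continuous_const
  have hkx : Continuous fun y => k (x - y) := hk.continuous.comp (continuous_const.sub continuous_id)
  rw [fderiv_convolution_apply hk hkc
    ((memLp_cut hΩ hχ.continuous hχc hφ).locallyIntegrable (by norm_num)), convolution_apply_sub]
  have e1 : ∀ y, fderiv ℝ k (x - y) e * cut Ω χ φ y =
      Ω.indicator (fun y => φ y * (fderiv ℝ k (x - y) e * χ y)) y := fun y => by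
    by_cases hy : y ∈ Ω
    · simp only [cut, indicator_of_mem hy]
      ring
    · simp [cut, indicator_of_notMem hy]
  have e2 : ∀ y, k (x - y) * (cut Ω χ G + cut Ω (fun y => fderiv ℝ χ y e) φ) y =
      Ω.indicator (fun y => G y * (k (x - y) * χ y) + φ y * (k (x - y) * fderiv ℝ χ y e)) y := by
    intro y
    by_cases hy : y ∈ Ω
    · simp only [cut, indicator_of_mem hy, Pi.add_apply]
      ring
    · simp [cut, indicator_of_notMem hy]
  simp_rw [e1, e2]
  rw [integral_indicator hΩ, integral_indicator hΩ]
  have i1 : IntegrableOn (fun y => φ y * (fderiv ℝ k (x - y) e * χ y)) Ω :=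
    integrable_mul_of_hasCompactSupport hφ (hdk.mul hχ.continuous) hχc.mul_left
  have i2 : IntegrableOn (fun y => φ y * (k (x - y) * fderiv ℝ χ y e)) Ω :=
    integrable_mul_of_hasCompactSupport hφ (hkx.mul hdχ) (hχc.fderiv_apply ℝ e).mul_left
  have i3 : IntegrableOn (fun y => G y * (k (x - y) * χ y)) Ω :=
    integrable_mul_of_hasCompactSupport hG (hkx.mul hχ.continuous) hχc.mul_left
  symm
  have i4 : IntegrableOn (fun y => G y * (k (x - y) * χ y) + φ y * (k (x - y) * fderiv ℝ χ y e)) Ω :=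
    i3.add i2
  rw [← sub_eq_zero, ← integral_sub i4 i1, ← h]
  refine integral_congr_ae (Eventually.of_forall fun y => ?_)
  simp only [fderiv_mul_reflect hk hχ]
  ring

/-- Passage to the limit in an identity tested with mollifications of `χ φ`. -/
lemma integral_cut_eq_zero (hΩ : MeasurableSet Ω) {u φ : Euc d → ℝ} {U G : Fin d → Euc d → ℝ}
    (hu : MemLp u 2 (volume.restrict Ω)) (hU : ∀ i, MemLp (U i) 2 (volume.restrict Ω))
    (hφ : MemLp φ 2 (volume.restrict Ω)) (hG : ∀ i, MemLp (G i) 2 (volume.restrict Ω))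
    {χ : Euc d → ℝ} (hχ : ContDiff ℝ ∞ χ) (hχc : HasCompactSupport χ)
    (h : ∀ δ > 0, ∃ k : Euc d → ℝ, ContDiff ℝ ∞ k ∧ HasCompactSupport k ∧ (∀ x, 0 ≤ k x) ∧
      ∫ x, k x = 1 ∧ Function.support k ⊆ Metric.ball 0 δ ∧
      (∀ x ∈ Ω, ∀ i, ∫ y in Ω, (φ y * fderiv ℝ (fun y => k (x - y) * χ y) y
        (EuclideanSpace.single i 1) + G i y * (k (x - y) * χ y)) = 0) ∧
      ∫ x in Ω, (u x * (k ⋆[ContinuousLinearMap.lsmul ℝ ℝ, volume] cut Ω χ φ) x +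
        ∑ i, U i x * fderiv ℝ (k ⋆[ContinuousLinearMap.lsmul ℝ ℝ, volume] cut Ω χ φ) x
          (EuclideanSpace.single i 1)) = 0) :
    ∫ x in Ω, (χ x * (u x * φ x + ∑ i, U i x * G i x) +
      ∑ i, fderiv ℝ χ x (EuclideanSpace.single i 1) * (φ x * U i x)) = 0 := by
  choose! k hk hkc hk0 hk1 hks hkG hku using h
  let δ : ℕ → ℝ := fun n => 1 / ((n : ℝ) + 1)
  have hδ : ∀ n, 0 < δ n := fun n => by positivity
  have hsm : Tendsto (fun n => Function.support (k (δ n))) atTop (𝓝 0).smallSets := by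
    rw [tendsto_smallSets_iff]
    intro t ht
    obtain ⟨r, hr, hrt⟩ := Metric.mem_nhds_iff.1 ht
    filter_upwards [(tendsto_one_div_add_atTop_nhds_zero_nat (𝕜 := ℝ)).eventually_lt_const hr]
      with n hn
    exact (hks _ (hδ n)).trans ((Metric.ball_subset_ball hn.le).trans hrt)
  have hdχ : ∀ i : Fin d, Continuous fun y => fderiv ℝ χ y (EuclideanSpace.single i 1) := fun i =>
    (hχ.continuous_fderiv (by simp)).clm_apply continuous_const
  have hdχc : ∀ i : Fin d, HasCompactSupport fun y => fderiv ℝ χ y (EuclideanSpace.single i 1) :=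
    fun i => hχc.fderiv_apply ℝ _
  let H := cut Ω χ φ
  let K : Fin d → Euc d → ℝ := fun i => cut Ω χ (G i) +
    cut Ω (fun y => fderiv ℝ χ y (EuclideanSpace.single i 1)) φ
  have hH : MemLp H 2 := memLp_cut hΩ hχ.continuous hχc hφ
  have hK : ∀ i, MemLp (K i) 2 := fun i =>
    (memLp_cut hΩ hχ.continuous hχc (hG i)).add (memLp_cut hΩ (hdχ i) (hdχc i) hφ)
  have hKc : ∀ i, HasCompactSupport (K i) := fun i =>
    (hasCompactSupport_cut hχc _).add (hasCompactSupport_cut (hdχc i) _)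
  have hu' : MemLp (Ω.indicator u) 2 := (memLp_indicator_iff_restrict hΩ).2 hu
  have hU' : ∀ i, MemLp (Ω.indicator (U i)) 2 := fun i =>
    (memLp_indicator_iff_restrict hΩ).2 (hU i)
  have hconv : ∀ n, ∀ {f g : Euc d → ℝ}, MemLp f 2 → MemLp g 2 → HasCompactSupport g →
      Integrable fun x => f x * (k (δ n) ⋆[ContinuousLinearMap.lsmul ℝ ℝ, volume] g) x := by
    intro n f g hf hg hgc
    refine integrable_mul_of_hasCompactSupport hf ?_ ((hkc _ (hδ n)).convolution _ hgc)
    exact (hkc _ (hδ n)).continuous_convolution_left _ (hk _ (hδ n)).continuous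
      (hg.locallyIntegrable (by norm_num))
  have hlim : Tendsto (fun n => (∫ x, Ω.indicator u x *
      (k (δ n) ⋆[ContinuousLinearMap.lsmul ℝ ℝ, volume] H) x) + ∑ i, ∫ x, Ω.indicator (U i) x *
      (k (δ n) ⋆[ContinuousLinearMap.lsmul ℝ ℝ, volume] K i) x) atTop
      (𝓝 ((∫ x, Ω.indicator u x * H x) + ∑ i, ∫ x, Ω.indicator (U i) x * K i x)) := by
    refine Tendsto.add ?_ (tendsto_finsetSum _ fun i _ => ?_)
    · exact tendsto_integral_mul_convolution (fun n => (hk _ (hδ n)).continuous)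
        (fun n => hkc _ (hδ n)) (fun n => hk0 _ (hδ n)) (fun n => hk1 _ (hδ n)) hsm hu' hH
    · exact tendsto_integral_mul_convolution (fun n => (hk _ (hδ n)).continuous)
        (fun n => hkc _ (hδ n)) (fun n => hk0 _ (hδ n)) (fun n => hk1 _ (hδ n)) hsm (hU' i) (hK i)
  -- On Ω the derivative of the mollified function is the mollification of K i, so this is the
  -- assumed identity for the kernel with index δ n.
  have hzero : ∀ n, (∫ x, Ω.indicator u x *
      (k (δ n) ⋆[ContinuousLinearMap.lsmul ℝ ℝ, volume] H) x) + ∑ i, ∫ x, Ω.indicator (U i) x *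
      (k (δ n) ⋆[ContinuousLinearMap.lsmul ℝ ℝ, volume] K i) x = 0 := by
    intro n
    rw [← integral_finsetSum _ fun i _ => hconv n (hU' i) (hK i) (hKc i),
      ← integral_add (hconv n hu' hH (hasCompactSupport_cut hχc _))
        (integrable_finsetSum _ fun i _ => hconv n (hU' i) (hK i) (hKc i)),
      ← hku _ (hδ n), ← integral_indicator hΩ]
    refine integral_congr_ae (Eventually.of_forall fun x => ?_)
    by_cases hx : x ∈ Ω
    · simp only [indicator_of_mem hx]
      congr 1
      refine Finset.sum_congr rfl fun i _ => ?_
      rw [fderiv_convolution_cut hΩ hφ (hG i) hχ hχc (hk _ (hδ n)) (hkc _ (hδ n))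
        (hkG _ (hδ n) x hx i)]
    · simp [indicator_of_notMem hx]
  simp_rw [hzero] at hlim
  have h0 := tendsto_nhds_unique hlim tendsto_const_nhds
  have i1 : Integrable fun x => Ω.indicator u x * H x := hu'.integrable_mul hH
  have i2 : ∀ i, Integrable fun x => Ω.indicator (U i) x * K i x :=
    fun i => (hU' i).integrable_mul (hK i)
  rw [← h0, ← integral_finsetSum _ fun i _ => i2 i,
    ← integral_add i1 (integrable_finsetSum _ fun i _ => i2 i), ← integral_indicator hΩ]
  refine integral_congr_ae (Eventually.of_forall fun x => ?_)
  by_cases hx : x ∈ Ω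
  · simp only [indicator_of_mem hx, H, K, cut, Pi.add_apply, mul_add, Finset.sum_add_distrib,
      Finset.mul_sum]
    rw [add_assoc]
    congr 1
    · ring
    · congr 1 <;> exact Finset.sum_congr rfl fun i _ => by ring
  · simp [indicator_of_notMem hx]

end Local

/-! ### Passing from smooth functions to H¹ by shifted mollification. -/

section Density

open scoped Convolution Pointwise

variable {Ω : Set (Euc d)}

lemma exists_kernel (c : Euc d) {ε : ℝ} (hε : 0 < ε) : ∃ k : Euc d → ℝ, ContDiff ℝ ∞ k ∧
    HasCompactSupport k ∧ (∀ x, 0 ≤ k x) ∧ ∫ x, k x = 1 ∧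
    Function.support k ⊆ Metric.closedBall c ε := by
  let f : ContDiffBump c := ⟨ε / 2, ε, by positivity, by linarith⟩
  refine ⟨f.normed volume, f.contDiff_normed, f.hasCompactSupport_normed, f.nonneg_normed,
    f.integral_normed, ?_⟩
  rw [f.support_normed_eq]
  exact Metric.ball_subset_closedBall

lemma tsupport_mul_reflect_subset {k χ : Euc d → ℝ} {c x : Euc d} {ε : ℝ}
    (hk : Function.support k ⊆ Metric.closedBall c ε) :
    tsupport (fun y => k (x - y) * χ y) ⊆ {y | ‖x - y - c‖ ≤ ε} ∩ tsupport χ := by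
  have hcl : IsClosed {y : Euc d | ‖x - y - c‖ ≤ ε} :=
    isClosed_le (by fun_prop) continuous_const
  refine closure_minimal (fun y hy => ?_) (hcl.inter (isClosed_tsupport χ))
  rw [Function.mem_support] at hy
  refine ⟨?_, subset_tsupport χ (right_ne_zero_of_mul hy)⟩
  have := hk (left_ne_zero_of_mul hy)
  rwa [mem_closedBall_iff_norm] at this

lemma integrableOn_sum_mul {f g : Fin d → Euc d → ℝ}
    (hf : ∀ i, MemLp (f i) 2 (volume.restrict Ω)) (hg : ∀ i, MemLp (g i) 2 (volume.restrict Ω)) :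
    IntegrableOn (fun x => ∑ i, f i x * g i x) Ω :=
  integrable_finsetSum _ fun i _ => (hf i).integrable_mul (hg i)

/-- A functional of `(φ, ∇φ)` which annihilates smooth functions annihilates `H¹(Ω)`. -/
lemma integral_eq_zero_of_forall_smooth (hΩ : IsLipschitzDomain Ω) (hΩb : Bornology.IsBounded Ω)
    {u φ : Euc d → ℝ} {U G : Fin d → Euc d → ℝ}
    (hu : MemLp u 2 (volume.restrict Ω)) (hU : ∀ i, MemLp (U i) 2 (volume.restrict Ω))
    (hφ : MemLp φ 2 (volume.restrict Ω)) (hG : ∀ i, MemLp (G i) 2 (volume.restrict Ω))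
    (hφG : ∀ η : Euc d → ℝ, IsTestFunction Ω η → ∀ i,
      ∫ x in Ω, (φ x * fderiv ℝ η x (EuclideanSpace.single i 1) + G i x * η x) = 0)
    (h : ∀ ψ : Euc d → ℝ, ContDiff ℝ ∞ ψ → HasCompactSupport ψ →
      ∫ x in Ω, (u x * ψ x + ∑ i, U i x * fderiv ℝ ψ x (EuclideanSpace.single i 1)) = 0) :
    ∫ x in Ω, (u x * φ x + ∑ i, U i x * G i x) = 0 := by
  refine integral_eq_zero_of_locally hΩ.isOpen hΩb
    ((hu.integrable_mul hφ).add (integrableOn_sum_mul hU hG))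
    (fun i => hφ.integrable_mul (hU i)) fun x₀ hx₀ => ?_
  obtain ⟨r, hr, hshift⟩ := hΩ.exists_shift hx₀
  refine ⟨r / 2, by positivity, fun χ hχ hχc hχs => ?_⟩
  refine integral_cut_eq_zero hΩ.isOpen.measurableSet hu hU hφ hG hχ hχc fun δ hδ => ?_
  obtain ⟨c, ε, hε, hcε, hin⟩ := hshift (min δ (r / 2)) (by positivity)
  -- A kernel centred at c samples φ near x - c, inside Ω for every x ∈ Ω near the support of χ.
  -- Thus k(x - ·)χ is a test function in Ω, while the mollification is smooth on the whole space.
  -- Supporting χ in the half ball leaves room for the shift.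
  obtain ⟨k, k1, k2, k3, k4, k5⟩ := exists_kernel c hε
  refine ⟨k, k1, k2, k3, k4, fun w hw => ?_, fun x hx i => ?_, ?_⟩
  · have h1 := k5 hw
    rw [mem_closedBall_iff_norm] at h1
    rw [mem_ball_zero_iff]
    have h2 := norm_add_le (w - c) c
    rw [sub_add_cancel] at h2
    linarith [min_le_left δ (r / 2)]
  · refine hφG _ ⟨contDiff_mul_reflect k1 hχ x, hχc.mul_left, fun y hy => ?_⟩ i
    obtain ⟨h1, h2⟩ := tsupport_mul_reflect_subset k5 hy
    have h1' : ‖x - y - c‖ ≤ ε := h1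
    have h3 := hχs h2
    rw [mem_ball_iff_norm] at h3
    refine hin x ?_ y ?_ h1 (subset_closure hx)
    · rw [mem_ball_iff_norm]
      have h4 : x - x₀ = (x - y - c) + c + (y - x₀) := by abel
      rw [h4]
      have h5 := norm_add₃_le (a := x - y - c) (b := c) (c := y - x₀)
      linarith [min_le_right δ (r / 2)]
    · rw [mem_ball_iff_norm]
      linarith
  · exact h _ (k2.contDiff_convolution_left _ k1
      ((memLp_cut hΩ.isOpen.measurableSet hχ.continuous hχc hφ).locallyIntegrable (by norm_num)))
      (k2.convolution _ (hasCompactSupport_cut hχc _))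

/-- A function whose zero extension is locally weakly differentiable with the zero-extended gradient
is orthogonal to gradients of harmonic functions. -/
lemma integral_eq_zero_of_zero_extension (hΩ : IsLipschitzDomain Ω) (hΩb : Bornology.IsBounded Ω)
    {φ : Euc d → ℝ} {U G : Fin d → Euc d → ℝ}
    (hU : ∀ i, MemLp (U i) 2 (volume.restrict Ω))
    (hφ : MemLp φ 2 (volume.restrict Ω)) (hG : ∀ i, MemLp (G i) 2 (volume.restrict Ω))
    (hφG : ∀ x₀ ∈ closure Ω, ∃ r > 0, ∀ η : Euc d → ℝ, ContDiff ℝ ∞ η → HasCompactSupport η →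
      tsupport η ⊆ Metric.ball x₀ r → ∀ i,
      ∫ x in Ω, (φ x * fderiv ℝ η x (EuclideanSpace.single i 1) + G i x * η x) = 0)
    (h : ∀ ψ : Euc d → ℝ, IsTestFunction Ω ψ →
      ∫ x in Ω, ∑ i, U i x * fderiv ℝ ψ x (EuclideanSpace.single i 1) = 0) :
    ∫ x in Ω, ∑ i, U i x * G i x = 0 := by
  refine integral_eq_zero_of_locally hΩ.isOpen hΩb (integrableOn_sum_mul hU hG)
    (fun i => hφ.integrable_mul (hU i)) fun x₀ hx₀ => ?_
  obtain ⟨r, hr, hshift⟩ := hΩ.exists_shift hx₀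
  obtain ⟨r', hr', hη⟩ := hφG x₀ hx₀
  refine ⟨min r' (r / 2), by positivity, fun χ hχ hχc hχs => ?_⟩
  have hm := hΩ.isOpen.measurableSet
  have := integral_cut_eq_zero hm (u := fun _ => 0) MemLp.zero' hU hφ hG hχ hχc fun δ hδ => ?_
  · simpa using this
  obtain ⟨c, ε, hε, hcε, hin⟩ := hshift (min δ (r / 2)) (by positivity)
  -- The opposite shift pushes the support of the mollification into Ω, so that it is a test
  -- function for the harmonic field U. The derivative formula needs no admissibility in Ω now,
  -- since the zero extension is weakly differentiable across the boundary.
  obtain ⟨k, k1, k2, k3, k4, k5⟩ := exists_kernel (-c) hε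
  refine ⟨k, k1, k2, k3, k4, fun w hw => ?_, fun x hx i => ?_, ?_⟩
  · have h1 := k5 hw
    rw [mem_closedBall_iff_norm, sub_neg_eq_add] at h1
    rw [mem_ball_zero_iff]
    have h2 := norm_sub_le (w + c) c
    rw [add_sub_cancel_right] at h2
    linarith [min_le_left δ (r / 2)]
  · refine hη _ (contDiff_mul_reflect k1 hχ x) hχc.mul_left ?_ i
    exact (tsupport_mul_reflect_subset k5).trans (inter_subset_right.trans
      (hχs.trans (Metric.ball_subset_ball (min_le_left _ _))))
  · simp only [zero_mul, zero_add]
    refine h _ ⟨k2.contDiff_convolution_left _ k1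
      ((memLp_cut hm hχ.continuous hχc hφ).locallyIntegrable (by norm_num)),
      k2.convolution _ (hasCompactSupport_cut hχc _), ?_⟩
    have hcl : IsClosed (closure Ω ∩ tsupport χ + Metric.closedBall (-c) ε) :=
      ((hχc.isCompact.inter_left isClosed_closure).add (isCompact_closedBall _ _)).isClosed
    refine (closure_minimal ?_ hcl).trans ?_
    · refine (support_convolution_subset_swap _).trans (add_subset_add (fun y hy => ?_) k5)
      rw [Function.mem_support, cut] at hy
      have hyΩ : y ∈ Ω := mem_of_indicator_ne_zero hy
      rw [indicator_of_mem hyΩ] at hy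
      exact ⟨subset_closure hyΩ, subset_tsupport χ (left_ne_zero_of_mul hy)⟩
    · rintro x ⟨y, ⟨hy1, hy2⟩, w, hw, rfl⟩
      rw [mem_closedBall_iff_norm, sub_neg_eq_add] at hw
      have h3 := hχs hy2
      rw [mem_ball_iff_norm] at h3
      have h3' := h3.trans_le (min_le_right _ _)
      refine hin y ?_ (y + w) ?_ ?_ hy1
      · rw [mem_ball_iff_norm]
        linarith
      · rw [mem_ball_iff_norm]
        have h4 : y + w - x₀ = (y - x₀) + (w + c) + -c := by abel
        rw [h4]
        have h5 := norm_add₃_le (a := y - x₀) (b := w + c) (c := -c)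
        rw [norm_neg] at h5
        linarith [min_le_right δ (r / 2)]
      · have h4 : y - (y + w) - c = -(w + c) := by abel
        rwa [h4, norm_neg]

end Density

/-! ### The trace operator -/

lemma gradient_apply (ψ : Euc d → ℝ) (x : Euc d) (i : Fin d) :
    gradient ψ x i = fderiv ℝ ψ x (EuclideanSpace.single i 1) := by
  rw [← inner_gradient_left (𝕜 := ℝ), EuclideanSpace.inner_single_right]
  simp

lemma norm_gradient (ψ : Euc d → ℝ) (x : Euc d) : ‖gradient ψ x‖ = ‖fderiv ℝ ψ x‖ := by
  rw [gradient, LinearIsometryEquiv.norm_map]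

lemma inner_eq_sum (x y : Euc d) : inner ℝ x y = ∑ i, x i * y i := by
  rw [PiLp.inner_apply]
  exact Finset.sum_congr rfl fun i _ => by simp [mul_comm]

lemma continuous_gradient {ψ : Euc d → ℝ} (hψ : ContDiff ℝ ∞ ψ) : Continuous (gradient ψ) :=
  (LinearIsometryEquiv.continuous _).comp (hψ.continuous_fderiv (by simp))

lemma norm_sq_eq_integral {α E : Type*} [MeasurableSpace α] {μ : Measure α}
    [NormedAddCommGroup E] [InnerProductSpace ℝ E] (f : Lp E 2 μ) :
    ‖f‖ ^ 2 = ∫ x, ‖f x‖ ^ 2 ∂μ := by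
  rw [← real_inner_self_eq_norm_sq, L2.inner_def]
  simp only [real_inner_self_eq_norm_sq]

/-! ### Density of smooth functions in H¹(Ω). -/

section H1

variable {Ω : Set (Euc d)}

lemma norm_sq_H1 (φ : H1 Ω) : ‖φ‖ ^ 2 = ‖fn φ‖ ^ 2 + ‖weakGrad φ‖ ^ 2 :=
  WithLp.prod_norm_sq_eq_of_L2 _

lemma norm_weakGrad_le (φ : H1 Ω) : ‖weakGrad φ‖ ≤ ‖φ‖ := by
  refine abs_le_of_sq_le_sq' ?_ (norm_nonneg _) |>.2
  rw [norm_sq_H1]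
  linarith [sq_nonneg ‖fn φ‖]

lemma memLp_of_continuous_of_isBounded {E : Type*} [NormedAddCommGroup E]
    (hΩb : Bornology.IsBounded Ω) {f : Euc d → E} [SecondCountableTopologyEither (Euc d) E]
    (hf : Continuous f) : MemLp f 2 (volume.restrict Ω) := by
  have hK : IsCompact (closure Ω) := hΩb.isCompact_closure
  obtain ⟨C, hC⟩ := hK.exists_bound_of_continuousOn hf.continuousOn
  have : IsFiniteMeasure (volume.restrict (closure Ω)) := ⟨by
    rw [Measure.restrict_apply_univ]
    exact hK.measure_lt_top⟩
  refine MemLp.mono_measure (Measure.restrict_mono subset_closure le_rfl) (MemLp.of_bound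
    hf.aestronglyMeasurable C ?_)
  filter_upwards [ae_restrict_mem isClosed_closure.measurableSet] with x hx
  exact hC x hx

lemma setIntegral_fderiv_mul {ψ η : Euc d → ℝ} (hψ : ContDiff ℝ ∞ ψ)
    (hη : IsTestFunction Ω η) (v : Euc d) :
    ∫ x in Ω, ψ x * fderiv ℝ η x v = -∫ x in Ω, fderiv ℝ ψ x v * η x := by
  obtain ⟨h1, h2, h3⟩ := hη
  have hs : ∀ x, x ∉ Ω → η x = 0 := fun x hx => image_eq_zero_of_notMem_tsupport fun h => hx (h3 h)
  have hs' : ∀ x, x ∉ Ω → fderiv ℝ η x v = 0 := fun x hx => by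
    rw [fderiv_of_notMem_tsupport ℝ fun h => hx (h3 h)]
    rfl
  have hdψ : Continuous fun x => fderiv ℝ ψ x v :=
    (hψ.continuous_fderiv (by simp)).clm_apply continuous_const
  have hdη : Continuous fun x => fderiv ℝ η x v :=
    (h1.continuous_fderiv (by simp)).clm_apply continuous_const
  rw [setIntegral_eq_integral_of_forall_compl_eq_zero fun x hx => by rw [hs' x hx, mul_zero],
    setIntegral_eq_integral_of_forall_compl_eq_zero fun x hx => by rw [hs x hx, mul_zero]]
  refine integral_mul_fderiv_eq_neg_fderiv_mul_of_integrable ?_ ?_ ?_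
    (fun x _ => hψ.differentiable (by simp) x) (fun x _ => h1.differentiable (by simp) x)
  · exact (hdψ.mul h1.continuous).integrable_of_hasCompactSupport h2.mul_left
  · exact (hψ.continuous.mul hdη).integrable_of_hasCompactSupport (h2.fderiv_apply ℝ v).mul_left
  · exact (hψ.continuous.mul h1.continuous).integrable_of_hasCompactSupport h2.mul_left

/-- The restriction of a smooth function belongs to `H¹(Ω)`. -/
lemma exists_smooth_H1 (hΩb : Bornology.IsBounded Ω) {ψ : Euc d → ℝ}
    (hψ : ContDiff ℝ ∞ ψ) : ∃ z : H1 Ω, fn z =ᵐ[volume.restrict Ω] ψ ∧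
      weakGrad z =ᵐ[volume.restrict Ω] gradient ψ := by
  have m1 : MemLp ψ 2 (volume.restrict Ω) := memLp_of_continuous_of_isBounded hΩb hψ.continuous
  have m2 : MemLp (gradient ψ) 2 (volume.restrict Ω) :=
    memLp_of_continuous_of_isBounded hΩb (continuous_gradient hψ)
  refine ⟨⟨WithLp.toLp 2 (m1.toLp ψ, m2.toLp (gradient ψ)), fun η hη i => ?_⟩, m1.coeFn_toLp,
    m2.coeFn_toLp⟩
  have e1 : ∫ x in Ω, m1.toLp ψ x * fderiv ℝ η x (EuclideanSpace.single i 1) =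
      ∫ x in Ω, ψ x * fderiv ℝ η x (EuclideanSpace.single i 1) :=
    integral_congr_ae (by filter_upwards [m1.coeFn_toLp] with x hx; rw [hx])
  have e2 : ∫ x in Ω, m2.toLp (gradient ψ) x i * η x =
      ∫ x in Ω, fderiv ℝ ψ x (EuclideanSpace.single i 1) * η x :=
    integral_congr_ae (by filter_upwards [m2.coeFn_toLp] with x hx; rw [hx, gradient_apply])
  change ∫ x in Ω, m1.toLp ψ x * fderiv ℝ η x (EuclideanSpace.single i 1) =
    -∫ x in Ω, m2.toLp (gradient ψ) x i * η x
  rw [e1, e2, setIntegral_fderiv_mul hψ hη]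

lemma integral_weakGrad_add (φ : H1 Ω) {η : Euc d → ℝ} (hη : IsTestFunction Ω η) (i : Fin d) :
    ∫ x in Ω, (fn φ x * fderiv ℝ η x (EuclideanSpace.single i 1) + weakGrad φ x i * η x) = 0 := by
  have i1 : Integrable (fun x => fn φ x * fderiv ℝ η x (EuclideanSpace.single i 1))
      (volume.restrict Ω) := (Lp.memLp (fn φ)).integrable_mul (hη.memLp_fderiv _)
  have i2 : Integrable (fun x => weakGrad φ x i * η x) (volume.restrict Ω) :=
    (memLp_coord (weakGrad φ) i).integrable_mul hη.memLp
  rw [integral_add i1 i2]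
  have h : ∫ x in Ω, fn φ x * fderiv ℝ η x (EuclideanSpace.single i 1) =
    -∫ x in Ω, weakGrad φ x i * η x := φ.2 η hη i
  rw [h, neg_add_cancel]

variable (Ω) in
/-- The restrictions of smooth functions, as a subspace of `H¹(Ω)`. -/
def smoothSub : Submodule ℝ (H1 Ω) where
  carrier := {z | ∃ ψ : Euc d → ℝ, ContDiff ℝ ∞ ψ ∧ fn z =ᵐ[volume.restrict Ω] ψ ∧
    weakGrad z =ᵐ[volume.restrict Ω] gradient ψ}
  zero_mem' := by
    refine ⟨0, contDiff_const, Lp.coeFn_zero _ _ _, ?_⟩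
    refine (Lp.coeFn_zero _ _ _).trans (Eventually.of_forall fun x => ?_)
    simp [gradient]
  add_mem' := by
    rintro a b ⟨ψ, h1, h2, h3⟩ ⟨χ, k1, k2, k3⟩
    refine ⟨ψ + χ, h1.add k1, (Lp.coeFn_add (fn a) (fn b)).trans (h2.add k2), ?_⟩
    refine (Lp.coeFn_add (weakGrad a) (weakGrad b)).trans ((h3.add k3).trans ?_)
    exact Eventually.of_forall fun x => (gradient_add_smooth h1 k1 x).symm
  smul_mem' := by
    rintro c a ⟨ψ, h1, h2, h3⟩
    refine ⟨c • ψ, h1.const_smul c, (Lp.coeFn_smul c (fn a)).trans (h2.const_smul c), ?_⟩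
    refine (Lp.coeFn_smul c (weakGrad a)).trans ((h3.const_smul c).trans ?_)
    exact Eventually.of_forall fun x => (gradient_smul_smooth h1 c x).symm

lemma inner_H1_eq (w : WithLp 2 (L2 Ω ℝ × L2 Ω (Euc d))) (z : H1 Ω) :
    inner ℝ w (z : WithLp 2 (L2 Ω ℝ × L2 Ω (Euc d))) =
      ∫ x in Ω, (w.fst x * fn z x + ∑ i, w.snd x i * weakGrad z x i) := by
  rw [WithLp.prod_inner_apply, L2.inner_def, L2.inner_def,
    ← integral_add (L2.integrable_inner _ _) (L2.integrable_inner _ _)]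
  refine integral_congr_ae (Eventually.of_forall fun x => ?_)
  simp only [inner_eq_sum]
  congr 1
  exact mul_comm _ _

lemma inner_eq_zero_of_forall_smooth (hΩ : IsLipschitzDomain Ω) (hΩb : Bornology.IsBounded Ω)
    {w : WithLp 2 (L2 Ω ℝ × L2 Ω (Euc d))}
    (hw : ∀ z ∈ smoothSub Ω, inner ℝ w (z : WithLp 2 (L2 Ω ℝ × L2 Ω (Euc d))) = 0) (φ : H1 Ω) :
    inner ℝ w (φ : WithLp 2 (L2 Ω ℝ × L2 Ω (Euc d))) = 0 := by
  rw [inner_H1_eq]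
  refine integral_eq_zero_of_forall_smooth hΩ hΩb (U := fun i x => w.snd x i)
    (G := fun i x => weakGrad φ x i) (Lp.memLp _)
    (fun i => memLp_coord _ i) (Lp.memLp _) (fun i => memLp_coord _ i)
    (fun η hη i => integral_weakGrad_add φ hη i) fun ψ hψ _ => ?_
  obtain ⟨z, hz1, hz2⟩ := exists_smooth_H1 hΩb hψ
  have h0 := hw z ⟨ψ, hψ, hz1, hz2⟩
  rw [inner_H1_eq] at h0
  refine Eq.trans (integral_congr_ae ?_) h0
  filter_upwards [hz1, hz2] with x h1 h2
  rw [h1, h2]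
  simp only [gradient_apply]

/-- Smooth functions are dense in `H¹(Ω)`. -/
lemma dense_smooth (hΩ : IsLipschitzDomain Ω) (hΩb : Bornology.IsBounded Ω) (φ : H1 Ω) {ε : ℝ}
    (hε : 0 < ε) : ∃ z ∈ smoothSub Ω, ‖z - φ‖ < ε := by
  have key : (φ : WithLp 2 (L2 Ω ℝ × L2 Ω (Euc d))) ∈
      ((smoothSub Ω).map (H1 Ω).subtype).topologicalClosure := by
    -- The closure is the double orthogonal complement, so density means that every w annihilating
    -- the smooth functions annihilates H¹(Ω).
    rw [← Submodule.orthogonal_orthogonal_eq_closure, Submodule.mem_orthogonal]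
    intro w hw
    rw [Submodule.mem_orthogonal'] at hw
    exact inner_eq_zero_of_forall_smooth hΩ hΩb (fun z hz => hw _ (Submodule.mem_map_of_mem hz)) φ
  rw [← SetLike.mem_coe, Submodule.topologicalClosure_coe, Metric.mem_closure_iff] at key
  obtain ⟨_, ⟨z, hz, rfl⟩, hlt⟩ := key ε hε
  refine ⟨z, hz, ?_⟩
  rw [← dist_eq_norm, dist_comm]
  exact hlt

end H1

/-! ### The trace inequality. -/

namespace Triangulation

variable {S : Set (Euc d)} (𝒯 : Triangulation S) {Ω : Set (Euc d)}

/-- The divergence theorem for ψ²(x - z) isolates the face opposite z, with factor h. With R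
bounding |x - z| on the cell, 2ψ ∇ψ · (x - z) ≤ ψ² + R²|∇ψ|², whence the constant h⁻¹(d + 1 + R²).
-/
lemma integral_face_sq_le (hd : 1 ≤ d) (hΩb : Bornology.IsBounded Ω)
    (hS : IsLipschitzDomain S) (hSΩ : S ⊆ Ω) (T : 𝒯.elements) {z : Euc d}
    (hz : z ∈ (T : Finset (Euc d))) : ∃ C : ℝ, 0 ≤ C ∧ ∀ ψ : Euc d → ℝ, ContDiff ℝ ∞ ψ →
      ∫ x in face (T : Finset (Euc d)) z, ψ x ^ 2 ∂(Measure.euclideanHausdorffMeasure (d - 1)) ≤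
        C * ∫ x in Ω, (ψ x ^ 2 + ‖gradient ψ x‖ ^ 2) := by
  obtain ⟨R, hR⟩ := (𝒯.isCompact_cell T).exists_bound_of_continuousOn
    (f := fun x => x - z) (by fun_prop)
  have hh := (𝒯.isSimplex T).height_pos hd hz
  set h := IsSimplex.height (T : Finset (Euc d)) z
  refine ⟨h⁻¹ * (d + 1 + R ^ 2), by positivity, fun ψ hψ => ?_⟩
  have hψ1 : ContDiff ℝ 1 ψ := hψ.of_le (by simp)
  have hc : Continuous fun x => ψ x ^ 2 + ‖gradient ψ x‖ ^ 2 :=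
    (hψ.continuous.pow 2).add ((continuous_gradient hψ).norm.pow 2)
  have hc2 : Continuous fun x => fderiv ℝ (fun x => ψ x ^ 2) x (x - z) + d * ψ x ^ 2 :=
    (((hψ1.pow 2).continuous_fderiv one_ne_zero).clm_apply (by fun_prop)).add
      (continuous_const.mul (hψ.continuous.pow 2))
  have h1 := (𝒯.isSimplex T).integral_div_radial hd hz (hψ1.pow 2)
  have hle : ∫ x in 𝒯.cell T, (fderiv ℝ (fun x => ψ x ^ 2) x (x - z) + d * ψ x ^ 2) ≤
      ∫ x in 𝒯.cell T, (d + 1 + R ^ 2) * (ψ x ^ 2 + ‖gradient ψ x‖ ^ 2) := by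
    refine setIntegral_mono_on (𝒯.integrableOn_cell T hc2)
      (𝒯.integrableOn_cell T (continuous_const.mul hc)) (𝒯.isCompact_cell T).measurableSet
      fun x hx => ?_
    have e : fderiv ℝ (fun x => ψ x ^ 2) x (x - z) = 2 * ψ x * fderiv ℝ ψ x (x - z) := by
      have := ((hψ.differentiable (by simp)) x).hasFDerivAt.pow 2
      rw [this.fderiv]
      simp
    rw [e, norm_gradient]
    have h2 : |fderiv ℝ ψ x (x - z)| ≤ ‖fderiv ℝ ψ x‖ * R :=
      (ContinuousLinearMap.le_opNorm (fderiv ℝ ψ x) (x - z)).trans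
        (mul_le_mul_of_nonneg_left (hR x hx) (norm_nonneg _))
    have h3 : fderiv ℝ ψ x (x - z) ^ 2 ≤ (‖fderiv ℝ ψ x‖ * R) ^ 2 := by
      rw [← sq_abs]
      gcongr
    have h4 : (0 : ℝ) ≤ d := Nat.cast_nonneg d
    have h5 := sq_nonneg (ψ x - fderiv ℝ ψ x (x - z))
    have h6 := mul_nonneg (sq_nonneg R) (sq_nonneg (ψ x))
    have h7 := mul_nonneg h4 (sq_nonneg ‖fderiv ℝ ψ x‖)
    nlinarith [sq_nonneg ‖fderiv ℝ ψ x‖]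
  have hintg : IntegrableOn (fun x => ψ x ^ 2 + ‖gradient ψ x‖ ^ 2) Ω :=
    (hc.continuousOn.integrableOn_compact hΩb.isCompact_closure).mono_set subset_closure
  have hsub : 𝒯.cell T ≤ᵐ[volume] Ω := by
    filter_upwards [𝒯.ae_mem_of_mem_closure hS] with x hx hxT
    exact hSΩ (hx (𝒯.cell_subset T hxT))
  have h2 : ∫ x in 𝒯.cell T, (ψ x ^ 2 + ‖gradient ψ x‖ ^ 2) ≤
      ∫ x in Ω, (ψ x ^ 2 + ‖gradient ψ x‖ ^ 2) :=
    setIntegral_mono_set hintg (Eventually.of_forall fun x => by positivity) hsub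
  rw [integral_const_mul] at hle
  change ∫ x in 𝒯.cell T, (fderiv ℝ (fun x => ψ x ^ 2) x (x - z) + d * ψ x ^ 2) = _ at h1
  rw [h1] at hle
  rw [mul_assoc, ← div_eq_inv_mul, le_div_iff₀' hh]
  exact hle.trans (mul_le_mul_of_nonneg_left h2 (by positivity))

include 𝒯 in
/-- The trace inequality for smooth functions. -/
lemma exists_trace_bound (hd : 1 ≤ d) (hΩ : IsLipschitzDomain Ω) (hΩb : Bornology.IsBounded Ω)
    (hS : IsLipschitzDomain S) (hSΩ : S ⊆ Ω) (hΓ : frontier Ω ⊆ frontier S) :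
    ∃ C : ℝ, 0 ≤ C ∧ ∀ ψ : Euc d → ℝ, ContDiff ℝ ∞ ψ →
      ∫ x, ψ x ^ 2 ∂(surf Ω) ≤ C * ∫ x in Ω, (ψ x ^ 2 + ‖gradient ψ x‖ ^ 2) := by
  classical
  have hfin := isFiniteMeasure_surf hd hΩ hS 𝒯 hSΩ hΓ
  choose! C hC0 hC using fun (T : 𝒯.elements) (z : Euc d) (hz : z ∈ (T : Finset (Euc d))) =>
    𝒯.integral_face_sq_le hd hΩb hS hSΩ T hz
  refine ⟨∑ T : 𝒯.elements, ∑ z ∈ (T : Finset (Euc d)), C T z,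
    Finset.sum_nonneg fun T _ => Finset.sum_nonneg fun z hz => hC0 T z hz, fun ψ hψ => ?_⟩
  have hc : Continuous fun x => ψ x ^ 2 := hψ.continuous.pow 2
  have hm : ∀ (T : 𝒯.elements) (z : Euc d), MeasurableSet (face (T : Finset (Euc d)) z) :=
    fun T z => (IsSimplex.isCompact_face _ z).measurableSet
  have hintg : ∀ T : 𝒯.elements, ∀ z ∈ (T : Finset (Euc d)), Integrable
      ((face (T : Finset (Euc d)) z).indicator fun x => ψ x ^ 2) (surf Ω) := fun T z hz =>
    ((integrable_indicator_iff (hm T z)).2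
      ((𝒯.isSimplex T).integrableOn_face hd hz hc)).mono_measure Measure.restrict_le_self
  calc ∫ x, ψ x ^ 2 ∂(surf Ω)
      ≤ ∫ x, ∑ T : 𝒯.elements, ∑ z ∈ (T : Finset (Euc d)),
          (face (T : Finset (Euc d)) z).indicator (fun x => ψ x ^ 2) x ∂(surf Ω) := by
        refine integral_mono_of_nonneg (Eventually.of_forall fun x => sq_nonneg _)
          (integrable_finsetSum _ fun T _ => integrable_finsetSum _ fun z hz => hintg T z hz) ?_
        filter_upwards [𝒯.ae_exists_face hΩ hS hSΩ hΓ] with x ⟨T, z, hz, _, hx⟩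
        have h0 : ∀ (T : 𝒯.elements) (z : Euc d),
            0 ≤ (face (T : Finset (Euc d)) z).indicator (fun x => ψ x ^ 2) x := fun T z =>
          indicator_nonneg (fun _ _ => sq_nonneg _) _
        have e : ψ x ^ 2 = (face (T : Finset (Euc d)) z).indicator (fun x => ψ x ^ 2) x := by
          rw [indicator_of_mem hx]
        rw [e]
        refine le_trans ?_ (Finset.single_le_sum
          (f := fun T : 𝒯.elements => ∑ z ∈ (T : Finset (Euc d)),
            (face (T : Finset (Euc d)) z).indicator (fun x => ψ x ^ 2) x)
          (fun T _ => Finset.sum_nonneg fun z _ => h0 T z) (Finset.mem_univ T))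
        exact Finset.single_le_sum (f := fun z =>
          (face (T : Finset (Euc d)) z).indicator (fun x => ψ x ^ 2) x) (fun z _ => h0 T z) hz
    _ = ∑ T : 𝒯.elements, ∑ z ∈ (T : Finset (Euc d)),
          ∫ x, (face (T : Finset (Euc d)) z).indicator (fun x => ψ x ^ 2) x ∂(surf Ω) := by
        rw [integral_finsetSum _ fun T _ => integrable_finsetSum _ fun z hz => hintg T z hz]
        exact Finset.sum_congr rfl fun T _ => integral_finsetSum _ fun z hz => hintg T z hz
    _ ≤ ∑ T : 𝒯.elements, ∑ z ∈ (T : Finset (Euc d)),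
          C T z * ∫ x in Ω, (ψ x ^ 2 + ‖gradient ψ x‖ ^ 2) := by
        refine Finset.sum_le_sum fun T _ => Finset.sum_le_sum fun z hz => ?_
        refine le_trans ?_ (hC T z hz ψ hψ)
        rw [← integral_indicator (hm T z)]
        exact integral_mono_measure Measure.restrict_le_self
          (Eventually.of_forall fun x => indicator_nonneg (fun _ _ => sq_nonneg _) _)
          ((integrable_indicator_iff (hm T z)).2 ((𝒯.isSimplex T).integrableOn_face hd hz hc))
    _ = _ := by
        simp only [Finset.sum_mul]

end Triangulation

/-! ### Existence and uniqueness of traces. -/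

section Trace

variable {Ω S : Set (Euc d)}

/-- The trace inequality on the graph of the trace operator. -/
lemma exists_norm_trace_le (hd : 1 ≤ d) (hΩ : IsLipschitzDomain Ω) (hΩb : Bornology.IsBounded Ω)
    (hS : IsLipschitzDomain S) (𝒯 : Triangulation S) (hSΩ : S ⊆ Ω) (hΓ : frontier Ω ⊆ frontier S) :
    ∃ C : ℝ, 0 ≤ C ∧ ∀ z ∈ traceGraph Ω, ‖z.2‖ ≤ C * ‖z.1‖ := by
  obtain ⟨C, hC0, hC⟩ := 𝒯.exists_trace_bound hd hΩ hΩb hS hSΩ hΓ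
  refine ⟨√C, Real.sqrt_nonneg C, fun z hz => ?_⟩
  have hcl : IsClosed {z : H1 Ω × L2Bdry Ω | ‖z.2‖ ≤ √C * ‖z.1‖} :=
    isClosed_le continuous_snd.norm (continuous_const.mul continuous_fst.norm)
  refine closure_minimal ?_ hcl hz
  rintro ⟨φ, f⟩ ⟨ψ, hψ, h1, h2, h3⟩
  simp only at h1 h2 h3
  simp only [mem_ofPred_eq]
  rw [← sq_le_sq₀ (norm_nonneg _) (by positivity), mul_pow, Real.sq_sqrt hC0, norm_sq_H1, norm_sq_eq_integral, norm_sq_eq_integral,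
    norm_sq_eq_integral, ← integral_add]
  · have e1 : ∫ x, ‖f x‖ ^ 2 ∂(surf Ω) = ∫ x, ψ x ^ 2 ∂(surf Ω) :=
      integral_congr_ae (by filter_upwards [h3] with x hx; rw [hx, Real.norm_eq_abs, sq_abs])
    have e2 : ∫ x in Ω, (‖fn φ x‖ ^ 2 + ‖weakGrad φ x‖ ^ 2) =
        ∫ x in Ω, (ψ x ^ 2 + ‖gradient ψ x‖ ^ 2) :=
      integral_congr_ae (by
        filter_upwards [h1, h2] with x hx hx'
        rw [hx, hx', Real.norm_eq_abs, sq_abs])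
    rw [e1, e2]
    exact hC ψ hψ
  · exact (Lp.memLp (fn φ)).integrable_norm_pow (by norm_num)
  · exact (Lp.memLp (weakGrad φ)).integrable_norm_pow (by norm_num)

lemma exists_trace_of_smooth [IsFiniteMeasure (surf Ω)] (hΩb : Bornology.IsBounded Ω) {z : H1 Ω}
    (hz : z ∈ smoothSub Ω) : ∃ f : L2Bdry Ω, (z, f) ∈ traceGraph Ω := by
  obtain ⟨ψ, hψ, h1, h2⟩ := hz
  have hm : MemLp ψ 2 (surf Ω) := by
    obtain ⟨B, hB⟩ := (hΩb.isCompact_closure).exists_bound_of_continuousOn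
      hψ.continuous.continuousOn
    refine MemLp.of_bound hψ.continuous.aestronglyMeasurable B ?_
    filter_upwards [ae_restrict_mem isClosed_frontier.measurableSet] with x hx
    exact hB x (frontier_subset_closure hx)
  have hmem : (z, hm.toLp ψ) ∈ smoothTraceGraph Ω := ⟨ψ, hψ, h1, h2, hm.coeFn_toLp⟩
  exact ⟨hm.toLp ψ, Submodule.le_topologicalClosure _ hmem⟩

lemma isClosed_traceGraph : IsClosed (traceGraph Ω : Set (H1 Ω × L2Bdry Ω)) :=
  Submodule.isClosed_topologicalClosure _

/-- Extension by continuity, phrased for a graph: the estimate makes second components Cauchy when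
the first ones converge, closedness keeps the limit in A, and the estimate applied to a difference
gives uniqueness. -/
lemma existsUnique_mem_of_dense {E F : Type*} [NormedAddCommGroup E] [NormedAddCommGroup F]
    [CompleteSpace F] {A : AddSubgroup (E × F)} (hA : IsClosed (A : Set (E × F))) {C : ℝ}
    (hC0 : 0 ≤ C) (hC : ∀ z ∈ A, ‖z.2‖ ≤ C * ‖z.1‖) {x : E}
    (hx : ∀ ε > 0, ∃ z ∈ A, ‖z.1 - x‖ < ε) : ∃! y, (x, y) ∈ A := by
  have hdiff : ∀ {a b : E × F}, a ∈ A → b ∈ A → dist a.2 b.2 ≤ C * dist a.1 b.1 := by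
    intro a b ha hb
    rw [dist_eq_norm, dist_eq_norm]
    exact hC _ (A.sub_mem ha hb)
  choose z hz hzx using fun n : ℕ => hx (1 / ((n : ℝ) + 1)) (by positivity)
  have hlim : Tendsto (fun n => (z n).1) atTop (𝓝 x) := by
    rw [tendsto_iff_norm_sub_tendsto_zero]
    exact squeeze_zero (fun n => norm_nonneg _) (fun n => (hzx n).le)
      tendsto_one_div_add_atTop_nhds_zero_nat
  have hcauchy : CauchySeq fun n => (z n).2 := by
    have hzc := hlim.cauchySeq
    rw [Metric.cauchySeq_iff'] at hzc ⊢
    intro ε hε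
    obtain ⟨N, hN⟩ := hzc (ε / (C + 1)) (by positivity)
    refine ⟨N, fun n hn => ?_⟩
    calc dist (z n).2 (z N).2 ≤ C * dist (z n).1 (z N).1 := hdiff (hz n) (hz N)
      _ ≤ C * (ε / (C + 1)) := by gcongr; exact (hN n hn).le
      _ < ε := by
        rw [mul_div_assoc', div_lt_iff₀ (by positivity)]
        linarith
  obtain ⟨y, hy⟩ := cauchySeq_tendsto_of_complete hcauchy
  have hmem : (x, y) ∈ A :=
    hA.mem_of_tendsto (hlim.prodMk_nhds hy) (Eventually.of_forall hz)
  refine ⟨y, hmem, fun y' hy' => ?_⟩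
  have := hdiff hy' hmem
  rw [dist_self, mul_zero] at this
  exact dist_le_zero.1 this

/-- Traces exist and are unique. -/
lemma existsUnique_traceGraph (hd : 1 ≤ d) (hΩ : IsLipschitzDomain Ω)
    (hΩb : Bornology.IsBounded Ω) (hS : IsLipschitzDomain S) (𝒯 : Triangulation S) (hSΩ : S ⊆ Ω)
    (hΓ : frontier Ω ⊆ frontier S) (φ : H1 Ω) : ∃! f : L2Bdry Ω, (φ, f) ∈ traceGraph Ω := by
  have hfin := Triangulation.isFiniteMeasure_surf hd hΩ hS 𝒯 hSΩ hΓ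
  obtain ⟨C, hC0, hC⟩ := exists_norm_trace_le hd hΩ hΩb hS 𝒯 hSΩ hΓ
  refine existsUnique_mem_of_dense (A := (traceGraph Ω).toAddSubgroup) isClosed_traceGraph hC0 hC
    fun ε hε => ?_
  obtain ⟨z, hz, hlt⟩ := dense_smooth hΩ hΩb φ hε
  obtain ⟨f, hf⟩ := exists_trace_of_smooth hΩb hz
  exact ⟨(z, f), hf, hlt⟩

lemma trace_mem (hd : 1 ≤ d) (hΩ : IsLipschitzDomain Ω)
    (hΩb : Bornology.IsBounded Ω) (hS : IsLipschitzDomain S) (𝒯 : Triangulation S) (hSΩ : S ⊆ Ω)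
    (hΓ : frontier Ω ⊆ frontier S) (φ : H1 Ω) : (φ, (trace φ : L2Bdry Ω)) ∈ traceGraph Ω := by
  obtain ⟨f, hf, -⟩ := existsUnique_traceGraph hd hΩ hΩb hS 𝒯 hSΩ hΓ φ
  have h : ∃ f : HHalf Ω, (φ, (f : L2Bdry Ω)) ∈ traceGraph Ω :=
    ⟨⟨f, Submodule.mem_map.2 ⟨(φ, f), hf, rfl⟩⟩, hf⟩
  rw [trace, dif_pos h]
  exact h.choose_spec

lemma trace_eq (hd : 1 ≤ d) (hΩ : IsLipschitzDomain Ω)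
    (hΩb : Bornology.IsBounded Ω) (hS : IsLipschitzDomain S) (𝒯 : Triangulation S) (hSΩ : S ⊆ Ω)
    (hΓ : frontier Ω ⊆ frontier S) {φ : H1 Ω} {f : HHalf Ω}
    (h : (φ, (f : L2Bdry Ω)) ∈ traceGraph Ω) : trace φ = f :=
  Subtype.ext ((existsUnique_traceGraph hd hΩ hΩb hS 𝒯 hSΩ hΓ φ).unique
    (trace_mem hd hΩ hΩb hS 𝒯 hSΩ hΓ φ) h)

end Trace

/-! ### Green's formulas -/

lemma vval_single (i : Fin d) (P : Poly d) (x : Euc d) :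
    vval (Pi.single i P) x = pval P x • EuclideanSpace.single i (1 : ℝ) := by
  ext j
  by_cases h : j = i
  · subst h
    simp
  · simp [h]

lemma pdiv_single (i : Fin d) (P : Poly d) : pdiv (Pi.single i P) = MvPolynomial.pderiv i P := by
  rw [pdiv, Finset.sum_eq_single i]
  · simp
  · intro j _ hj
    simp [hj]
  · simp

lemma continuous_integral_inner {α E : Type*} [MeasurableSpace α] {μ : Measure α}
    [NormedAddCommGroup E] [InnerProductSpace ℝ E] {g : α → E} (hg : MemLp g 2 μ) :
    Continuous fun f : Lp E 2 μ => ∫ x, inner ℝ (f x) (g x) ∂μ := by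
  have h : Continuous fun f : Lp E 2 μ => inner ℝ f (hg.toLp g) :=
    continuous_id.inner continuous_const
  refine h.congr fun f => ?_
  rw [L2.inner_def]
  exact integral_congr_ae (by filter_upwards [hg.coeFn_toLp] with x hx; rw [hx])

lemma continuous_integral_mul {α : Type*} [MeasurableSpace α] {μ : Measure α} {g : α → ℝ}
    (hg : MemLp g 2 μ) : Continuous fun f : Lp ℝ 2 μ => ∫ x, f x * g x ∂μ :=
  (continuous_integral_inner hg).congr fun f => integral_congr_ae (Eventually.of_forall fun x => by
    simp [mul_comm])

lemma continuous_integral_coord_mul {Ω : Set (Euc d)} {g : Euc d → ℝ}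
    (hg : MemLp g 2 (volume.restrict Ω)) (i : Fin d) :
    Continuous fun f : L2 Ω (Euc d) => ∫ x in Ω, f x i * g x := by
  have hm : MemLp (fun x => g x • EuclideanSpace.single i (1 : ℝ)) 2 (volume.restrict Ω) :=
    (ContinuousLinearMap.toSpanSingleton ℝ (EuclideanSpace.single i (1 : ℝ))).comp_memLp' hg
  refine (continuous_integral_inner hm).congr fun f => integral_congr_ae
    (Eventually.of_forall fun x => ?_)
  simp [inner_smul_right, EuclideanSpace.inner_single_right, mul_comm]

lemma continuous_fn {Ω : Set (Euc d)} : Continuous (fn : H1 Ω → L2 Ω ℝ) :=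
  (WithLp.prod_continuous_ofLp 2 _ _).fst.comp continuous_subtype_val

lemma continuous_weakGrad {Ω : Set (Euc d)} : Continuous (weakGrad : H1 Ω → L2 Ω (Euc d)) :=
  (WithLp.prod_continuous_ofLp 2 _ _).snd.comp continuous_subtype_val

namespace Triangulation

variable {S : Set (Euc d)} (𝒯 : Triangulation S) {Ω : Set (Euc d)}

/-- Green's formula for the product of a smooth function and a piecewise polynomial field. -/
lemma green_mul (hd : 1 ≤ d) (hΩ : IsLipschitzDomain Ω) (hS : IsLipschitzDomain S)
    (hSΩ : S ⊆ Ω) (hΓ : frontier Ω ⊆ frontier S) {ψ : Euc d → ℝ} (hψ : ContDiff ℝ ∞ ψ)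
    {σ : 𝒯.PwVec}
    (hjump : ∀ T z T' z', 𝒯.Shared T z T' z' → ∀ x ∈ face (T : Finset (Euc d)) z,
      inner ℝ (outerNormal (T : Finset (Euc d)) z) (vval (σ T) x) =
      inner ℝ (outerNormal (T : Finset (Euc d)) z) (vval (σ T') x))
    (hzero : ∀ T : 𝒯.elements, ∀ z ∈ (T : Finset (Euc d)),
      face (T : Finset (Euc d)) z ⊆ frontier S →
      ∀ x ∈ face (T : Finset (Euc d)) z ∩ (frontier S \ frontier Ω),
        ψ x * inner ℝ (outerNormal (T : Finset (Euc d)) z) (vval (σ T) x) = 0) :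
    ∑ T, ∫ x in 𝒯.cell T, (inner ℝ (gradient ψ x) (vval (σ T) x) + ψ x * pval (pdiv (σ T)) x) =
      ∫ x, ψ x * 𝒯.normalTrace σ x ∂(surf Ω) := by
  have hF : ∀ (T : 𝒯.elements) (x : Euc d),
      (WithLp.toLp 2 fun i => ψ x * pval (σ T i) x : Euc d) = ψ x • vval (σ T) x := fun T x => rfl
  have h := 𝒯.green hd hΩ hS hSΩ hΓ (F := fun T i x => ψ x * pval (σ T i) x)
    (fun T i => (hψ.mul (contDiff_pval _)).of_le (by simp))
    (fun T z T' z' hsh x hx => by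
      simp only [hF]
      rw [inner_smul_right, inner_smul_right, hjump T z T' z' hsh x hx])
    (fun T z hz hb x hx => by
      simp only [hF]
      rw [inner_smul_right, hzero T z hz hb x hx])
  refine Eq.trans (Finset.sum_congr rfl fun T _ => ?_) (h.trans ?_)
  · refine integral_congr_ae (Eventually.of_forall fun x => ?_)
    simp only [inner_eq_sum, pdiv, pval_sum, Finset.mul_sum, ← Finset.sum_add_distrib]
    refine Finset.sum_congr rfl fun i _ => ?_
    have h1 : HasFDerivAt (fun x => ψ x * pval (σ T i) x) _ x :=
      ((hψ.differentiable (by simp)) x).hasFDerivAt.mul (differentiable_pval (σ T i) x).hasFDerivAt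
    rw [h1.fderiv, gradient_apply, ← fderiv_pval_single]
    simp
    ring
  · refine integral_congr_ae (Eventually.of_forall fun x => ?_)
    simp only [normalTrace, Finset.mul_sum]
    refine Finset.sum_congr rfl fun T _ => Finset.sum_congr rfl fun z _ => ?_
    split_ifs
    · rw [hF, inner_smul_right]
    · rw [mul_zero]

/-! ### Functions glued from their values on the cells -/

/-- The function which is given by `F T` on each cell `T` and vanishes outside of `S`. -/
def glue {E : Type*} [AddCommMonoid E] (F : 𝒯.elements → Euc d → E) (x : Euc d) : E :=
  ∑ T, (𝒯.cell T).indicator (F T) x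

lemma ae_glue_eq {E : Type*} [AddCommMonoid E] (F : 𝒯.elements → Euc d → E) :
    ∀ᵐ x : Euc d, ∀ T, x ∈ 𝒯.cell T → 𝒯.glue F x = F T x := by
  filter_upwards [ae_all_iff.2 𝒯.ae_mem_interior_cell] with x hx T hT
  rw [glue, Finset.sum_eq_single T, indicator_of_mem hT]
  · intro T' _ hT'
    exact indicator_of_notMem (fun h => hT' (𝒯.eq_of_mem_interior (hx T hT) h).symm) _
  · simp

lemma glue_eq_zero {E : Type*} [AddCommMonoid E] (F : 𝒯.elements → Euc d → E) {x : Euc d}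
    (hx : ∀ T, x ∉ 𝒯.cell T) : 𝒯.glue F x = 0 :=
  Finset.sum_eq_zero fun T _ => indicator_of_notMem (hx T) _

lemma memLp_glue {E : Type*} [NormedAddCommGroup E] [SecondCountableTopology E]
    {F : 𝒯.elements → Euc d → E} (hF : ∀ T, Continuous (F T)) :
    MemLp (𝒯.glue F) 2 (volume.restrict Ω) := by
  refine memLp_finsetSum (f := fun T => (𝒯.cell T).indicator (F T)) _ fun T _ => ?_
  have hK := 𝒯.isCompact_cell T
  obtain ⟨C, hC⟩ := hK.exists_bound_of_continuousOn (hF T).continuousOn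
  have : IsFiniteMeasure (volume.restrict (𝒯.cell T)) := ⟨by
    rw [Measure.restrict_apply_univ]
    exact hK.measure_lt_top⟩
  refine MemLp.restrict Ω ((memLp_indicator_iff_restrict hK.measurableSet).2 (MemLp.of_bound
    (hF T).aestronglyMeasurable C ?_))
  filter_upwards [ae_restrict_mem hK.measurableSet] with x hx
  exact hC x hx

lemma cell_ae_subset (hS : IsLipschitzDomain S) (hSΩ : S ⊆ Ω) (T : 𝒯.elements) :
    𝒯.cell T ≤ᵐ[volume] Ω := by
  filter_upwards [𝒯.ae_mem_of_mem_closure hS] with x hx hxT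
  exact hSΩ (hx (𝒯.cell_subset T hxT))

lemma integral_glue (hS : IsLipschitzDomain S) (hSΩ : S ⊆ Ω) {g : 𝒯.elements → Euc d → ℝ}
    (hg : ∀ T, IntegrableOn (g T) (𝒯.cell T)) :
    ∫ x in Ω, 𝒯.glue g x = ∑ T, ∫ x in 𝒯.cell T, g T x := by
  have hm : ∀ T, MeasurableSet (𝒯.cell T) := fun T => (𝒯.isCompact_cell T).measurableSet
  simp only [glue]
  rw [integral_finsetSum _ fun T _ => ((integrable_indicator_iff (hm T)).2 (hg T)).restrict]
  refine Finset.sum_congr rfl fun T _ => ?_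
  rw [setIntegral_indicator (hm T)]
  refine setIntegral_congr_set ?_
  filter_upwards [𝒯.cell_ae_subset hS hSΩ T] with x hx
  exact propext ⟨fun h => h.2, fun h => ⟨hx h, h⟩⟩

lemma integral_norm_sq_glue (hS : IsLipschitzDomain S) (hSΩ : S ⊆ Ω) (σ : 𝒯.PwVec) :
    ∫ x in Ω, ‖𝒯.glue (fun T => vval (σ T)) x‖ ^ 2 = 𝒯.norm₂ σ ^ 2 := by
  rw [norm₂_sq, inner₂, ← 𝒯.integral_glue (Ω := Ω) hS hSΩ
    fun T => 𝒯.integrableOn_cell T (continuous_inner_vval _ _)]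
  refine integral_congr_ae (ae_restrict_of_ae ?_)
  filter_upwards [𝒯.ae_glue_eq fun T => vval (σ T),
    𝒯.ae_glue_eq fun T x => inner ℝ (vval (σ T) x) (vval (σ T) x)] with x h1 h2
  by_cases h : ∃ T, x ∈ 𝒯.cell T
  · obtain ⟨T, hT⟩ := h
    rw [h1 T hT, h2 T hT, real_inner_self_eq_norm_sq]
  · have h' : ∀ T, x ∉ 𝒯.cell T := fun T hT => h ⟨T, hT⟩
    rw [𝒯.glue_eq_zero _ h', 𝒯.glue_eq_zero _ h']
    simp

/-! ### The lower bound -/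

/-- For smooth functions this is Green's formula with no volume term, as div τ = 0, and none on Γᶜ.
Both sides are continuous in the pair (φ, f), so it passes to the closed trace graph. -/
lemma bdryPairing_eq (hd : 1 ≤ d) (hΩ : IsLipschitzDomain Ω) (hS : IsLipschitzDomain S)
    (hSΩ : S ⊆ Ω) (hΓ : frontier Ω ⊆ frontier S) {q : ℕ} {τ : 𝒯.PwVec} (hτ : τ ∈ 𝒯.RT₀ Ω q)
    (hdiv : 𝒯.div τ = 0) {z : H1 Ω × L2Bdry Ω} (hz : z ∈ traceGraph Ω) :
    𝒯.bdryPairing z.2 τ =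
      ∫ x in Ω, inner ℝ (weakGrad z.1 x) (𝒯.glue (fun T => vval (τ T)) x) := by
  have hfin := isFiniteMeasure_surf hd hΩ hS 𝒯 hSΩ hΓ
  have hcl : IsClosed {z : H1 Ω × L2Bdry Ω | 𝒯.bdryPairing z.2 τ =
      ∫ x in Ω, inner ℝ (weakGrad z.1 x) (𝒯.glue (fun T => vval (τ T)) x)} :=
    isClosed_eq ((continuous_integral_mul (𝒯.memLp_normalTrace τ)).comp continuous_snd)
      ((continuous_integral_inner (𝒯.memLp_glue fun T => continuous_vval _)).comp
        (continuous_weakGrad.comp continuous_fst))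
  refine closure_minimal ?_ hcl hz
  rintro ⟨φ, f⟩ ⟨ψ, hψ, h1, h2, h3⟩
  simp only at h1 h2 h3
  have hg := 𝒯.green_mul hd hΩ hS hSΩ hΓ hψ (σ := τ)
    (fun T z T' z' h x hx => by
      have := hτ.1.2 T T' h.ne z h.mem z' h.mem' h.diff_eq x hx
      rwa [inner_sub_right, sub_eq_zero] at this)
    (fun T z hz hb x hx => by rw [hτ.2 T z hz hb x hx, mul_zero])
  have e1 : 𝒯.bdryPairing f τ = ∫ x, ψ x * 𝒯.normalTrace τ x ∂(surf Ω) :=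
    integral_congr_ae (by filter_upwards [h3] with x hx; rw [hx])
  have e2 : ∫ x in Ω, inner ℝ (weakGrad φ x) (𝒯.glue (fun T => vval (τ T)) x) =
      ∫ x in Ω, 𝒯.glue (fun T x => inner ℝ (gradient ψ x) (vval (τ T) x)) x := by
    refine integral_congr_ae ?_
    filter_upwards [h2] with x hx
    rw [hx, glue, glue, inner_sum]
    refine Finset.sum_congr rfl fun T _ => ?_
    by_cases h : x ∈ 𝒯.cell T <;> simp [h]
  simp only [mem_ofPred_eq]
  rw [e1, e2, ← hg, 𝒯.integral_glue hS hSΩ]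
  · refine Finset.sum_congr rfl fun T _ => integral_congr_ae (Eventually.of_forall fun x => ?_)
    have : pdiv (τ T) = 0 := congrFun hdiv T
    simp [this]
  · exact fun T => 𝒯.integrableOn_cell T ((continuous_gradient hψ).inner (continuous_vval _))

/-- The divergence of τ lies in P^q and may be tested against itself. -/
lemma IsMixedSolution.div_eq_zero {q : ℕ} {f : L2Bdry Ω} {τ : 𝒯.PwVec} {ρ : 𝒯.PwPoly}
    (h : 𝒯.IsMixedSolution q f τ ρ) : 𝒯.div τ = 0 := by
  have h1 := h.div_free (𝒯.div τ) fun T => IsRT.totalDegree_pdiv_le (h.mem_RT.1.1 T)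
  have h2 : ∀ T ∈ Finset.univ, ∫ x in 𝒯.cell T, pval (𝒯.div τ T) x * pval (𝒯.div τ T) x = 0 :=
    (Finset.sum_eq_zero_iff_of_nonneg fun T _ => integral_nonneg fun _ => mul_self_nonneg _).1 h1
  ext1 T
  refine poly_eq_zero_of_isOpen isOpen_interior (𝒯.interior_cell_nonempty T) fun x hx => ?_
  have := 𝒯.eq_zero_of_integral_cell_eq_zero T ((continuous_pval _).mul (continuous_pval _))
    (fun _ _ => mul_self_nonneg _) (h2 T (Finset.mem_univ T)) x hx
  exact mul_self_eq_zero.1 this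

/-- Expand 0 ≤ ‖∇φ - τ‖² for the zero extension of τ; the mixed term is the boundary pairing. -/
theorem lower_bound (hd : 1 ≤ d) (hΩ : IsLipschitzDomain Ω) (hS : IsLipschitzDomain S)
    (hSΩ : S ⊆ Ω) (hΓ : frontier Ω ⊆ frontier S) {q : ℕ} {f : L2Bdry Ω} {τ : 𝒯.PwVec}
    {ρ : 𝒯.PwPoly} (h : 𝒯.IsMixedSolution q f τ ρ) {φ : H1 Ω} (hφ : (φ, f) ∈ traceGraph Ω) :
    2 * 𝒯.bdryPairing f τ - 𝒯.norm₂ τ ^ 2 ≤ ‖weakGrad φ‖ ^ 2 := by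
  have hm : MemLp (𝒯.glue fun T => vval (τ T)) 2 (volume.restrict Ω) :=
    𝒯.memLp_glue fun T => continuous_vval _
  have e1 : 𝒯.bdryPairing f τ = inner ℝ (weakGrad φ) (hm.toLp _) := by
    rw [𝒯.bdryPairing_eq hd hΩ hS hSΩ hΓ h.mem_RT h.div_eq_zero hφ, L2.inner_def]
    exact integral_congr_ae (by filter_upwards [hm.coeFn_toLp] with x hx; rw [hx])
  have e2 : 𝒯.norm₂ τ ^ 2 = ‖hm.toLp _‖ ^ 2 := by
    rw [← 𝒯.integral_norm_sq_glue (Ω := Ω) hS hSΩ, norm_sq_eq_integral]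
    exact integral_congr_ae (by filter_upwards [hm.coeFn_toLp] with x hx; rw [hx])
  rw [e1, e2]
  have := sq_nonneg ‖weakGrad φ - hm.toLp _‖
  rw [norm_sub_sq_real] at this
  linarith

end Triangulation

lemma isHarmonic_sub {Ω : Set (Euc d)} {u v : H1 Ω} (hu : IsHarmonic u) (hv : IsHarmonic v) :
    IsHarmonic (u - v) := by
  intro η hη
  have hm : MemLp (gradient η) 2 (volume.restrict Ω) := by
    refine ((continuous_gradient hη.1).memLp_of_hasCompactSupport ?_).restrict Ω
    refine (hη.2.1.fderiv ℝ).mono fun x hx => ?_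
    rw [Function.mem_support] at hx ⊢
    contrapose! hx
    rw [gradient, hx, map_zero]
  have hintg : ∀ w : H1 Ω, Integrable (fun x => inner ℝ (weakGrad w x) (gradient η x))
      (volume.restrict Ω) := fun w => by
    refine (L2.integrable_inner (𝕜 := ℝ) (weakGrad w) (hm.toLp _)).congr ?_
    filter_upwards [hm.coeFn_toLp] with x hx
    rw [hx]
  have h := integral_sub (hintg u) (hintg v)
  rw [hu η hη, hv η hη, sub_zero] at h
  refine Eq.trans (integral_congr_ae ?_) h
  filter_upwards [Lp.coeFn_sub (weakGrad u) (weakGrad v)] with x hx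
  have k : weakGrad (u - v) x = weakGrad u x - weakGrad v x := hx
  rw [k, inner_sub_left]

namespace Triangulation

variable {S : Set (Euc d)} (𝒯 : Triangulation S) {Ω : Set (Euc d)}

/-! ### The upper bound -/

/-- The `i`-th component of the exterior unit normal. -/
def normalComp (i : Fin d) : Euc d → ℝ := 𝒯.normalTrace fun _ => Pi.single i 1

lemma memLp_mul_normalComp [IsFiniteMeasure (surf Ω)] {η : Euc d → ℝ} (hη : Continuous η)
    (hηc : HasCompactSupport η) (i : Fin d) :
    MemLp (fun x => η x * 𝒯.normalComp i x) 2 (surf Ω) := by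
  have hN : MemLp (𝒯.normalComp i) 2 (surf Ω) := 𝒯.memLp_normalTrace _
  obtain ⟨C, hC⟩ := hηc.exists_bound_of_continuous hη
  refine (hN.const_mul C).mono (hη.aestronglyMeasurable.mul hN.aestronglyMeasurable)
    (Eventually.of_forall fun x => ?_)
  rw [norm_mul, norm_mul]
  gcongr
  exact (hC x).trans (le_abs_self C)

/-- Green's formula on `Ω`, localised to a neighbourhood of a boundary point. -/
lemma exists_local_green (hd : 1 ≤ d) (hΩ : IsLipschitzDomain Ω)
    (hS : IsLipschitzDomain S) (hSΩ : S ⊆ Ω) (hΓ : frontier Ω ⊆ frontier S) {x₀ : Euc d}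
    (hx₀ : x₀ ∈ frontier Ω) : ∃ r > 0, ∀ η : Euc d → ℝ, ContDiff ℝ ∞ η → HasCompactSupport η →
      tsupport η ⊆ Metric.ball x₀ r → ∀ (i : Fin d), ∀ z ∈ traceGraph Ω,
      ∫ x in Ω, (fn z.1 x * fderiv ℝ η x (EuclideanSpace.single i 1) + weakGrad z.1 x i * η x) =
        ∫ x, z.2 x * (η x * 𝒯.normalComp i x) ∂(surf Ω) := by
  have hfin := isFiniteMeasure_surf hd hΩ hS 𝒯 hSΩ hΓ
  obtain ⟨r, hr, hball⟩ := Metric.eventually_nhds_iff_ball.1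
    ((hΩ.eventually_mem_iff hS hSΩ hΓ hx₀).and (hΩ.eventually_frontier hS hSΩ hΓ hx₀))
  refine ⟨r, hr, fun η hη hηc hηs i z hz => ?_⟩
  have hdη : Continuous fun x => fderiv ℝ η x (EuclideanSpace.single i 1) :=
    (hη.continuous_fderiv (by simp)).clm_apply continuous_const
  have m1 : MemLp η 2 (volume.restrict Ω) :=
    (hη.continuous.memLp_of_hasCompactSupport hηc).restrict Ω
  have m2 : MemLp (fun x => fderiv ℝ η x (EuclideanSpace.single i 1)) 2 (volume.restrict Ω) :=
    (hdη.memLp_of_hasCompactSupport (hηc.fderiv_apply ℝ _)).restrict Ω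
  have hsplit : ∀ φ : H1 Ω, ∫ x in Ω, (fn φ x * fderiv ℝ η x (EuclideanSpace.single i 1) +
      weakGrad φ x i * η x) = (∫ x in Ω, fn φ x * fderiv ℝ η x (EuclideanSpace.single i 1)) +
      ∫ x in Ω, weakGrad φ x i * η x := fun φ =>
    integral_add ((Lp.memLp (fn φ)).integrable_mul m2)
      ((memLp_coord (weakGrad φ) i).integrable_mul m1)
  have hcl : IsClosed {z : H1 Ω × L2Bdry Ω |
      (∫ x in Ω, fn z.1 x * fderiv ℝ η x (EuclideanSpace.single i 1)) +
      ∫ x in Ω, weakGrad z.1 x i * η x = ∫ x, z.2 x * (η x * 𝒯.normalComp i x) ∂(surf Ω)} := by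
    refine isClosed_eq (Continuous.add ?_ ?_) ?_
    · exact (continuous_integral_mul m2).comp (continuous_fn.comp continuous_fst)
    · exact (continuous_integral_coord_mul m1 i).comp (continuous_weakGrad.comp continuous_fst)
    · exact (continuous_integral_mul (𝒯.memLp_mul_normalComp hη.continuous hηc i)).comp
        continuous_snd
  rw [hsplit]
  refine closure_minimal ?_ hcl hz
  rintro ⟨φ, f⟩ ⟨ψ, hψ, h1, h2, h3⟩
  simp only at h1 h2 h3
  simp only [mem_ofPred_eq]
  rw [← hsplit]
  have hψη : ContDiff ℝ ∞ fun x => ψ x * η x := hψ.mul hη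
  have hder : ∀ x, fderiv ℝ (fun x => ψ x * η x) x (EuclideanSpace.single i 1) =
      ψ x * fderiv ℝ η x (EuclideanSpace.single i 1) +
        fderiv ℝ ψ x (EuclideanSpace.single i 1) * η x := fun x => by
    have h : HasFDerivAt (fun x => ψ x * η x) _ x :=
      ((hψ.differentiable (by simp)) x).hasFDerivAt.mul
        ((hη.differentiable (by simp)) x).hasFDerivAt
    rw [h.fderiv]
    simp
    ring
  have hout : ∀ x ∉ Metric.ball x₀ r, η x = 0 := fun x hx =>
    image_eq_zero_of_notMem_tsupport fun h => hx (hηs h)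
  have hg := 𝒯.green_mul hd hΩ hS hSΩ hΓ hψη (σ := fun _ => Pi.single i 1)
    (fun _ _ _ _ _ _ _ => rfl)
    (fun T z hz hb x hx => by
      -- A constant field has no reason to be tangential on Γᶜ. It is the cut-off that removes this
      -- part: inside the ball all of ∂S belongs to ∂Ω.
      have : x ∉ Metric.ball x₀ r := fun h => hx.2.2 ((hball x h).2 hx.2.1)
      rw [hout x this, mul_zero, zero_mul])
  have hc : Continuous fun x => fderiv ℝ (fun x => ψ x * η x) x (EuclideanSpace.single i 1) :=
    (hψη.continuous_fderiv (by simp)).clm_apply continuous_const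
  have e1 : ∫ x in Ω, (fn φ x * fderiv ℝ η x (EuclideanSpace.single i 1) +
      weakGrad φ x i * η x) =
      ∫ x in Ω, fderiv ℝ (fun x => ψ x * η x) x (EuclideanSpace.single i 1) := by
    refine integral_congr_ae ?_
    filter_upwards [h1, h2] with x hx hx'
    rw [hx, hx', hder, gradient_apply]
  -- Within the ball S and Ω coincide and outside it the integrand vanishes, so the integral over Ω
  -- reduces to the triangulated set S.
  have e2 : ∫ x in Ω, fderiv ℝ (fun x => ψ x * η x) x (EuclideanSpace.single i 1) =
      ∫ x in S, fderiv ℝ (fun x => ψ x * η x) x (EuclideanSpace.single i 1) := by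
    refine setIntegral_eq_of_subset_of_forall_sdiff_eq_zero hΩ.isOpen.measurableSet hSΩ
      fun x hx => ?_
    have hxb : x ∉ Metric.ball x₀ r := fun h => hx.2 ((hball x h).1.2 hx.1)
    rw [hder, hout x hxb, fderiv_of_notMem_tsupport ℝ fun h => hxb (hηs h)]
    simp
  have e3 : ∫ x, f x * (η x * 𝒯.normalComp i x) ∂(surf Ω) =
      ∫ x, ψ x * η x * 𝒯.normalComp i x ∂(surf Ω) := by
    refine integral_congr_ae ?_
    filter_upwards [h3] with x hx
    rw [hx, mul_assoc]
  rw [e1, e2, e3]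
  refine Eq.trans ?_ hg
  rw [← 𝒯.sum_integral_cell hS]
  · refine Finset.sum_congr rfl fun T _ => integral_congr_ae (Eventually.of_forall fun x => ?_)
    simp only [vval_single, pdiv_single]
    rw [inner_smul_right, inner_gradient_left]
    simp
  · exact ((hc.continuousOn).integrableOn_compact 𝒯.isCompact_closure).mono_set subset_closure

/-- Green's formula for a continuous piecewise polynomial which vanishes on `∂S \ ∂Ω`. -/
lemma green_glue (hd : 1 ≤ d) (hΩ : IsLipschitzDomain Ω) (hS : IsLipschitzDomain S)
    (hSΩ : S ⊆ Ω) (hΓ : frontier Ω ⊆ frontier S) {p : ℕ} {w : 𝒯.PwPoly} (hw : w ∈ 𝒯.Lagrange p)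
    (hw0 : 𝒯.VanishesOn w (frontier S \ frontier Ω)) {f : L2Bdry Ω} (hf : 𝒯.RestrictsTo w f)
    {η : Euc d → ℝ} (hη : ContDiff ℝ ∞ η) (i : Fin d) :
    ∫ x in Ω, (𝒯.glue (fun T => pval (w T)) x * fderiv ℝ η x (EuclideanSpace.single i 1) +
      𝒯.glue (fun T => vval (𝒯.grad w T)) x i * η x) =
        ∫ x, f x * (η x * 𝒯.normalComp i x) ∂(surf Ω) := by
  have hdη : Continuous fun x => fderiv ℝ η x (EuclideanSpace.single i 1) :=
    (hη.continuous_fderiv (by simp)).clm_apply continuous_const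
  have hg := 𝒯.green_mul hd hΩ hS hSΩ hΓ hη (σ := fun T => Pi.single i (w T))
    (fun T z T' z' h x hx => by
      have h1 : x ∈ 𝒯.cell T := 𝒯.face_subset_cell T z hx
      have h2 : x ∈ 𝒯.cell T' := 𝒯.face_subset_cell T' z' (h.face_eq ▸ hx)
      rw [vval_single, vval_single, hw.2 T T' x ⟨h1, h2⟩])
    (fun T z hz hb x hx => by
      rw [vval_single, hw0 T x ⟨𝒯.face_subset_cell T z hx.1, hx.2⟩, zero_smul, inner_zero_right,
        mul_zero])
  have e1 : ∫ x in Ω, (𝒯.glue (fun T => pval (w T)) x *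
      fderiv ℝ η x (EuclideanSpace.single i 1) + 𝒯.glue (fun T => vval (𝒯.grad w T)) x i * η x) =
      ∫ x in Ω, 𝒯.glue (fun T x => inner ℝ (gradient η x) (vval (Pi.single i (w T)) x) +
        η x * pval (pdiv (Pi.single i (w T))) x) x := by
    refine integral_congr_ae (ae_restrict_of_ae ?_)
    filter_upwards [𝒯.ae_glue_eq fun T => pval (w T), 𝒯.ae_glue_eq fun T => vval (𝒯.grad w T),
      𝒯.ae_glue_eq fun T x => inner ℝ (gradient η x) (vval (Pi.single i (w T)) x) +
        η x * pval (pdiv (Pi.single i (w T))) x] with x h1 h2 h3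
    by_cases h : ∃ T, x ∈ 𝒯.cell T
    · obtain ⟨T, hT⟩ := h
      rw [h1 T hT, h2 T hT, h3 T hT, vval_single, pdiv_single, inner_smul_right,
        inner_gradient_left, vval_apply, grad, pgrad]
      ring
    · have h' : ∀ T, x ∉ 𝒯.cell T := fun T hT => h ⟨T, hT⟩
      rw [𝒯.glue_eq_zero _ h', 𝒯.glue_eq_zero _ h', 𝒯.glue_eq_zero _ h']
      simp
  rw [e1, 𝒯.integral_glue hS hSΩ, hg]
  · refine integral_congr_ae ?_
    filter_upwards [hf] with x hx
    simp only [normalComp, normalTrace, Finset.mul_sum]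
    refine Finset.sum_congr rfl fun T _ => Finset.sum_congr rfl fun z _ => ?_
    split_ifs with h
    · rw [vval_single, vval_single, hx T (𝒯.face_subset_cell T z h.2), inner_smul_right,
        inner_smul_right, pval_one]
      ring
    · ring
  · exact fun T => 𝒯.integrableOn_cell T (((continuous_gradient hη).inner (continuous_vval _)).add
      (hη.continuous.mul (continuous_pval _)))

/-- The zero extension of a continuous piecewise polynomial which vanishes on `∂S \ ∂Ω`. -/
lemma exists_zero_extension (hd : 1 ≤ d) (hΩ : IsLipschitzDomain Ω) (hS : IsLipschitzDomain S)
    (hSΩ : S ⊆ Ω) (hΓ : frontier Ω ⊆ frontier S) {p : ℕ} {w : 𝒯.PwPoly} (hw : w ∈ 𝒯.Lagrange p)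
    (hw0 : 𝒯.VanishesOn w (frontier S \ frontier Ω)) {f : L2Bdry Ω} (hf : 𝒯.RestrictsTo w f) :
    ∃ W : H1 Ω, ‖weakGrad W‖ = 𝒯.norm₂ (𝒯.grad w) ∧ ∀ η : Euc d → ℝ, ContDiff ℝ ∞ η →
      ∀ i : Fin d, ∫ x in Ω, (fn W x * fderiv ℝ η x (EuclideanSpace.single i 1) +
        weakGrad W x i * η x) = ∫ x, f x * (η x * 𝒯.normalComp i x) ∂(surf Ω) := by
  have m1 : MemLp (𝒯.glue fun T => pval (w T)) 2 (volume.restrict Ω) :=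
    𝒯.memLp_glue fun T => continuous_pval _
  have m2 : MemLp (𝒯.glue fun T => vval (𝒯.grad w T)) 2 (volume.restrict Ω) :=
    𝒯.memLp_glue fun T => continuous_vval _
  have hgreen : ∀ η : Euc d → ℝ, ContDiff ℝ ∞ η → ∀ i : Fin d,
      ∫ x in Ω, (m1.toLp _ x * fderiv ℝ η x (EuclideanSpace.single i 1) + m2.toLp _ x i * η x) =
        ∫ x, f x * (η x * 𝒯.normalComp i x) ∂(surf Ω) := by
    intro η hη i
    rw [← 𝒯.green_glue hd hΩ hS hSΩ hΓ hw hw0 hf hη i]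
    refine integral_congr_ae ?_
    filter_upwards [m1.coeFn_toLp, m2.coeFn_toLp] with x h1 h2
    rw [h1, h2]
  have hweak : IsWeakGradient Ω (m1.toLp _) (m2.toLp _) := by
    intro η hη i
    have i1 : Integrable (fun x => m1.toLp _ x * fderiv ℝ η x (EuclideanSpace.single i 1))
        (volume.restrict Ω) := (Lp.memLp (m1.toLp _)).integrable_mul (hη.memLp_fderiv _)
    have i2 : Integrable (fun x => m2.toLp _ x i * η x) (volume.restrict Ω) :=
      (memLp_coord (m2.toLp _) i).integrable_mul hη.memLp
    have h := hgreen η hη.1 i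
    rw [integral_add i1 i2] at h
    -- A test function has its support in the open set Ω and therefore vanishes on Γ; this leaves
    -- the definition of the weak gradient.
    have h0 : ∫ x, f x * (η x * 𝒯.normalComp i x) ∂(surf Ω) = 0 := by
      refine integral_eq_zero_of_ae ?_
      filter_upwards [ae_restrict_mem isClosed_frontier.measurableSet] with x hx
      have : η x = 0 := image_eq_zero_of_notMem_tsupport fun h => by
        rw [hΩ.isOpen.frontier_eq] at hx
        exact hx.2 (hη.2.2 h)
      simp [this]
    rw [h0] at h
    linarith
  have hnorm : ‖m2.toLp _‖ = 𝒯.norm₂ (𝒯.grad w) := by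
    refine (sq_eq_sq₀ (norm_nonneg _) (Real.sqrt_nonneg _)).1 ?_
    change _ = 𝒯.norm₂ (𝒯.grad w) ^ 2
    rw [← 𝒯.integral_norm_sq_glue (Ω := Ω) hS hSΩ, norm_sq_eq_integral]
    refine integral_congr_ae ?_
    filter_upwards [m2.coeFn_toLp] with x hx
    rw [hx]
  exact ⟨⟨WithLp.toLp 2 (m1.toLp _, m2.toLp _), hweak⟩, hnorm, hgreen⟩

/-- `H¹(Ω)`-functions whose traces are those of a discrete function differ from its zero extension by
a function whose gradient is orthogonal to gradients of harmonic functions. -/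
lemma inner_weakGrad_eq_zero (hd : 1 ≤ d) (hΩ : IsLipschitzDomain Ω)
    (hΩb : Bornology.IsBounded Ω) (hS : IsLipschitzDomain S)
    (hSΩ : S ⊆ Ω) (hΓ : frontier Ω ⊆ frontier S) {f : L2Bdry Ω} {φ W : H1 Ω}
    (hφ : (φ, f) ∈ traceGraph Ω) (hW : ∀ η : Euc d → ℝ, ContDiff ℝ ∞ η →
      ∀ i : Fin d, ∫ x in Ω, (fn W x * fderiv ℝ η x (EuclideanSpace.single i 1) +
        weakGrad W x i * η x) = ∫ x, f x * (η x * 𝒯.normalComp i x) ∂(surf Ω))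
    {u : H1 Ω} (hu : IsHarmonic u) : inner ℝ (weakGrad u) (weakGrad (φ - W)) = 0 := by
  have e : inner ℝ (weakGrad u) (weakGrad (φ - W)) =
      ∫ x in Ω, ∑ i, weakGrad u x i * weakGrad (φ - W) x i := by
    rw [L2.inner_def]
    simp only [inner_eq_sum]
  rw [e]
  refine integral_eq_zero_of_zero_extension hΩ hΩb (φ := fn (φ - W))
    (U := fun i x => weakGrad u x i) (G := fun i x => weakGrad (φ - W) x i)
    (fun i => memLp_coord _ i) (Lp.memLp _) (fun i => memLp_coord _ i) (fun x₀ hx₀ => ?_)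
    (fun ψ hψ => ?_)
  -- Near an interior point this is the weak-gradient identity. Near a boundary point φ and W
  -- satisfy Green's formula with the same boundary term, so it cancels in the difference and the
  -- zero extension of φ - W has no jump.
  · by_cases hx : x₀ ∈ Ω
    · obtain ⟨r, hr, hball⟩ := Metric.isOpen_iff.1 hΩ.isOpen x₀ hx
      exact ⟨r, hr, fun η h1 h2 h3 i => integral_weakGrad_add _ ⟨h1, h2, h3.trans hball⟩ i⟩
    · have hf : x₀ ∈ frontier Ω := ⟨hx₀, by rwa [hΩ.isOpen.interior_eq]⟩
      obtain ⟨r, hr, h⟩ := 𝒯.exists_local_green hd hΩ hS hSΩ hΓ hf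
      refine ⟨r, hr, fun η h1 h2 h3 i => ?_⟩
      have a1 := h η h1 h2 h3 i _ hφ
      have a2 := hW η h1 i
      have hdη : Continuous fun x => fderiv ℝ η x (EuclideanSpace.single i 1) :=
        (h1.continuous_fderiv (by simp)).clm_apply continuous_const
      have hintg : ∀ v : H1 Ω, Integrable (fun x => fn v x *
          fderiv ℝ η x (EuclideanSpace.single i 1) + weakGrad v x i * η x) (volume.restrict Ω) :=
        fun v => (integrable_mul_of_hasCompactSupport (Lp.memLp (fn v)) hdη
          (h2.fderiv_apply ℝ _)).add
          (integrable_mul_of_hasCompactSupport (memLp_coord (weakGrad v) i) h1.continuous h2)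
      simp only at a1
      rw [← a2, ← sub_eq_zero, ← integral_sub (hintg φ) (hintg W)] at a1
      refine Eq.trans (integral_congr_ae ?_) a1
      filter_upwards [Lp.coeFn_sub (fn φ) (fn W), Lp.coeFn_sub (weakGrad φ) (weakGrad W)]
        with x hx1 hx2
      have k1 : fn (φ - W) x = fn φ x - fn W x := hx1
      have k2 : weakGrad (φ - W) x = weakGrad φ x - weakGrad W x := hx2
      rw [k1, k2, PiLp.sub_apply]
      ring
  · rw [← hu ψ hψ]
    refine integral_congr_ae (Eventually.of_forall fun x => ?_)
    simp only [inner_eq_sum, gradient_apply]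

/-- For any φ with trace f - fh, the function u - φ - W has zero trace, W being the zero extension
of w. Testing with the harmonic u gives ‖∇u‖² = (∇u, ∇φ + ∇W), and the gradient part of ‖φ‖ is all
that is needed before taking the infimum. -/
theorem upper_bound (hd : 1 ≤ d) (hΩ : IsLipschitzDomain Ω)
    (hΩb : Bornology.IsBounded Ω) (hS : IsLipschitzDomain S)
    (hSΩ : S ⊆ Ω) (hΓ : frontier Ω ⊆ frontier S) {p : ℕ} {f fh : HHalf Ω} {w : 𝒯.PwPoly}
    (hw : 𝒯.IsDirichletSolution p (fh : L2Bdry Ω) w) {u : H1 Ω} (hu : IsHarmonic u)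
    (huf : (u, (f : L2Bdry Ω)) ∈ traceGraph Ω) :
    ‖weakGrad u‖ ≤ 𝒯.norm₂ (𝒯.grad w) + halfNorm (f - fh) := by
  obtain ⟨W, hWn, hW⟩ := 𝒯.exists_zero_extension hd hΩ hS hSΩ hΓ hw.mem hw.zero_on hw.eq_on
  rw [← sub_le_iff_le_add', ← hWn]
  refine le_csInf ?_ ?_
  -- The infimum of an empty set of reals would be 0, so some function with the given trace must be
  -- exhibited.
  · obtain ⟨z, hz, hzf⟩ := Submodule.mem_map.1 (f - fh).2
    refine ⟨‖z.1‖, z.1, trace_eq hd hΩ hΩb hS 𝒯 hSΩ hΓ ?_, rfl⟩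
    rw [← hzf]
    exact hz
  · rintro _ ⟨φ, hφ, rfl⟩
    have h1 := trace_mem hd hΩ hΩb hS 𝒯 hSΩ hΓ φ
    rw [hφ] at h1
    have h2 : (u - φ, (fh : L2Bdry Ω)) ∈ traceGraph Ω := by
      have := (traceGraph Ω).sub_mem huf h1
      simpa using this
    have h3 := 𝒯.inner_weakGrad_eq_zero hd hΩ hΩb hS hSΩ hΓ h2 hW hu
    have h4 : weakGrad (u - φ - W) = weakGrad u - (weakGrad φ + weakGrad W) := by
      rw [← sub_sub]
      rfl
    rw [h4, inner_sub_right, real_inner_self_eq_norm_sq, sub_eq_zero] at h3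
    have h5 := real_inner_le_norm (weakGrad u) (weakGrad φ + weakGrad W)
    have h6 := norm_add_le (weakGrad φ) (weakGrad W)
    have h7 := norm_weakGrad_le φ
    rw [← h3, sq] at h5
    -- Cancelling one factor ‖∇u‖ requires it to be nonzero; otherwise the bound is trivial.
    rcases (norm_nonneg (weakGrad u)).eq_or_lt with h0 | h0
    · rw [← h0]
      linarith [norm_nonneg (weakGrad W), norm_nonneg φ]
    · linarith [le_of_mul_le_mul_left h5 h0]

end Triangulation

end BoundaryLayer

end

/-! ### The theorem, applied to u - v with trace g - v|_Γ. -/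

open BoundaryLayer in
theorem theorem3p2 {d : ℕ} (hd : d = 2 ∨ d = 3)
    -- the bounded Lipschitz domain `Ω` and the triangulated boundary layer `S`
    (Ω S : Set (Euc d)) (hΩ : IsLipschitzDomain Ω) (hΩb : Bornology.IsBounded Ω)
    (hS : IsLipschitzDomain S) (hSΩ : S ⊆ Ω) (hΓS : frontier Ω ⊆ frontier S)
    (𝒯 : Triangulation S)
    -- `u` solves the Dirichlet problem with data `g`, and `v` is harmonic
    (g : HHalf Ω) (u v : H1 Ω) (hu : IsHarmonic u) (hug : trace u = g) (hv : IsHarmonic v)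
    -- `J` is a projection of `H^{1/2}(Γ)` onto the Lagrange traces of order `p`
    (p q : ℕ) (hp : 1 ≤ p) (J : HHalf Ω → HHalf Ω)
    (hJ : ∀ f, J f ∈ 𝒯.LagrangeTraces Ω p) (hJp : ∀ f ∈ 𝒯.LagrangeTraces Ω p, J f = f) :
    (∃! w : 𝒯.PwPoly, 𝒯.IsDirichletSolution p (J (g - trace v) : L2Bdry Ω) w) ∧
    (∃! z : 𝒯.PwVec × 𝒯.PwPoly, 𝒯.IsMixedSolution q ((g - trace v : HHalf Ω) : L2Bdry Ω) z.1 z.2) ∧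
    (∀ τ ρ, 𝒯.IsMixedSolution q ((g - trace v : HHalf Ω) : L2Bdry Ω) τ ρ →
      2 * 𝒯.bdryPairing ((g - trace v : HHalf Ω) : L2Bdry Ω) τ - 𝒯.norm₂ τ ^ 2
        ≤ ‖weakGrad (u - v)‖ ^ 2) ∧
    (∀ w, 𝒯.IsDirichletSolution p (J (g - trace v) : L2Bdry Ω) w →
      ‖weakGrad (u - v)‖ ≤ 𝒯.norm₂ (𝒯.grad w) + halfNorm ((g - trace v) - J (g - trace v))) := by
  have hd1 : 1 ≤ d := by
    rcases hd with rfl | rfl <;> norm_num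
  have htr : (u - v, ((g - trace v : HHalf Ω) : L2Bdry Ω)) ∈ traceGraph Ω := by
    have h := (traceGraph Ω).sub_mem (trace_mem hd1 hΩ hΩb hS 𝒯 hSΩ hΓS u)
      (trace_mem hd1 hΩ hΩb hS 𝒯 hSΩ hΓS v)
    rw [hug] at h
    exact h
  exact ⟨𝒯.existsUnique_dirichlet hd1 hΩ hS hSΩ hΓS hp (hJ _),
    𝒯.existsUnique_mixed hd1 hΩ hΩb hS hSΩ hΓS q _,
    fun τ ρ h => 𝒯.lower_bound hd1 hΩ hS hSΩ hΓS h htr,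
    fun w hw => 𝒯.upper_bound hd1 hΩ hΩb hS hSΩ hΓS hw (isHarmonic_sub hu hv) htr⟩
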